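/- **Setting.** Let $N\ge 1$, let $H^0$ be a self-adjoint operator on $L^2(\mathbb R^3)=L^2(\mathbb R^3,\mathbb C)$, and let $v^{(N)}:\mathbb R^3\to\mathbb R$ be measurable with $v^{(N)}(-x)=v^{(N)}(x)$. Let $H_j^0$ denote $H^0$ acting on the $j$-th variable of $L^2(\mathbb R^{3N})$, let $\sum_j H_j^0$ be the closure of its restriction to finite linear combinations of products of vectors in the domain of $H^0$, and let $$H^N=\sum_{j=1}^N H_j^0+\sum_{1\le i<j\le N}v^{(N)}(x_i-x_j)$$ be the closure of the operator sum (on the intersection of the domains of $\sum_j H^0_j$ and of the multiplication operator). Assume that $H^N$ is self-adjoint. For a self-adjoint operator $A$, a solution of $i\partial_t f=Af+g$ on $[0,T)$ is a function $f$ that is continuous on $[0,T)$ with values in the Hilbert space and satisfies $\frac{d}{dt}\langle u,f(t)\rangle=-i\big(\langle Au,f(t)\rangle+\langle u,g(t)\rangle\big)$ for all $u$ in the domain of $A$ and all $t\in[0,T)$ (one-sided derivative at $t=0$). For orthonormal $\varphi_1,\dots,\varphi_N\in L^2(\mathbb R^3)$ and $m=1,\dots,N$ let $$(p_m\psi)(x_1,\dots,x_N)=\sum_{j=1}^N\varphi_j(x_m)\int\varphi_j^*(x_m)\,\psi(x_1,\dots,x_N)\,d^3x_m,\qquad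 q_m=1-p_m,$$ $$P_{N,k}=\sum_{a\in\{0,1\}^N,\ \sum_m a_m=k}\ \prod_{m=1}^N (p_m)^{1-a_m}(q_m)^{a_m},\qquad \alpha_n(\psi,\varphi_1,\dots,\varphi_N)=\sum_{k=0}^N\frac kN\,\langle\psi,P_{N,k}\psi\rangle .$$ **Theorem.** Let $0<T\le\infty$. Let $\psi^t\in L^2(\mathbb R^{3N})$, $t\in[0,T)$, be a solution of the Schrödinger equation $i\partial_t\psi^t=H^N\psi^t$ whose initial value $\psi^0$ is antisymmetric with $\|\psi^0\|=1$. Let $\varphi_1^t,\dots,\varphi_N^t\in L^2(\mathbb R^3)$, $t\in[0,T)$, be solutions of the fermionic Hartree equations $$i\partial_t\varphi_j^t=H^0\varphi_j^t+\big(v^{(N)}\star\rho_N^t\big)\varphi_j^t,\qquad j=1,\dots,N,\qquad \rho_N^t=\sum_{i=1}^N|\varphi_i^t|^2,$$ with orthonormal initial values $\varphi_1^0,\dots,\varphi_N^0$ (where $(v^{(N)}\star\rho_N^t)(x)$ is given by an absolutely convergent integral for almost every $x$, and $(v^{(N)}\star\rho_N^t)\varphi_j^t\in L^2(\mathbb R^3)$).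 Let $D:[0,T)\to[0,\infty)$ be such that $\sqrt D$ is integrable on $[0,t]$ for every $t\in[0,T)$, and $$\sup_{y\in\mathbb R^3}\Big(\big(v^{(N)}\big)^2\star\rho_N^t\Big)(y)\le D(t)\,N^{-1}\qquad\text{for all }t\in[0,T).$$ Set $C(t)=24\sqrt{D(t)}$ and $\alpha_n(t)=\alpha_n(\psi^t,\varphi_1^t,\dots,\varphi_N^t)$. Then for all $t\in[0,T)$ one has $\alpha_n(t)=\langle\psi^t,q_m\psi^t\rangle$ for every $m=1,\dots,N$ (in particular for $m=1$), and $$\alpha_n(t)\le e^{\int_0^t C(s)\,ds}\,\alpha_n(0)+\Big(e^{\int_0^t C(s)\,ds}-1\Big)N^{-1}.$$ -/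

import Mathlib

open MeasureTheory Set Filter Topology
open scoped ComplexConjugate

noncomputable section

namespace FermionMF

/-! ### Configuration spaces and Hilbert spaces -/

/-- Physical space `ℝ³`. -/
abbrev Space : Type := EuclideanSpace ℝ (Fin 3)

/-- Configurations `(x₁, …, x_N) ∈ ℝ^{3N}` of `N` particles. -/
abbrev Config (N : ℕ) : Type := Fin N → Space

/-- The one-particle Hilbert space `L²(ℝ³, ℂ)`. -/
abbrev OneParticle : Type := Lp ℂ 2 (volume : Measure Space)

/-- The `N`-particle Hilbert space `L²(ℝ^{3N}, ℂ)`. -/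
abbrev NParticle (N : ℕ) : Type := Lp ℂ 2 (volume : Measure (Config N))

/-- Antisymmetry: exchanging any two coordinates changes the sign (almost everywhere). -/
def IsAntisymmetric {N : ℕ} (ψ : NParticle N) : Prop :=
  ∀ j k : Fin N, j ≠ k → (fun x : Config N => ψ (x ∘ Equiv.swap j k)) =ᵐ[volume] fun x => -ψ x

/-! ### Product vectors and multiplication operators -/

theorem memLp_prod {N : ℕ} (u : Fin N → OneParticle) :
    MemLp (fun x : Config N => ∏ i, u i (x i)) 2 volume := by
  have hm : AEStronglyMeasurable (fun x : Config N => ∏ i, u i (x i)) volume := by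
    refine Finset.aestronglyMeasurable_fun_prod _ fun i _ => ?_
    exact (Lp.aestronglyMeasurable (u i)).comp_quasiMeasurePreserving
      (Measure.quasiMeasurePreserving_eval (fun _ : Fin N => (volume : Measure Space)) i)
  rw [memLp_two_iff_integrable_sq_norm hm]
  have h : Integrable (fun x : Config N => ∏ i, ‖u i (x i)‖ ^ 2) volume :=
    Integrable.fintype_prod (f := fun i y => ‖u i y‖ ^ 2) fun i =>
      (memLp_two_iff_integrable_sq_norm (Lp.aestronglyMeasurable (u i))).1 (Lp.memLp (u i))
  simpa [norm_prod, Finset.prod_pow] using h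

/-- The product vector `u₁ ⊗ ⋯ ⊗ u_N`, i.e. `(x₁, …, x_N) ↦ ∏ᵢ uᵢ(xᵢ)`. -/
def tensor {N : ℕ} (u : Fin N → OneParticle) : NParticle N := (memLp_prod u).toLp _

/-- The maximal domain `{ψ ∈ L² : V ψ ∈ L²}` of multiplication by `V`. -/
def mulDomain {N : ℕ} (V : Config N → ℝ) : Submodule ℂ (NParticle N) where
  carrier := {ψ | MemLp (fun x => (V x : ℂ) * ψ x) 2 volume}
  zero_mem' := by
    refine (memLp_congr_ae ?_).2 (MemLp.zero (ε := ℂ))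
    filter_upwards [Lp.coeFn_zero ℂ 2 (volume : Measure (Config N))] with x hx
    rw [hx, Pi.zero_apply, mul_zero]
  add_mem' := fun {a b} ha hb => by
    refine (memLp_congr_ae ?_).2 (MemLp.add ha hb)
    filter_upwards [Lp.coeFn_add a b] with x hx
    rw [hx, Pi.add_apply, mul_add, Pi.add_apply]
  smul_mem' := fun c a ha => by
    refine (memLp_congr_ae ?_).2 (MemLp.const_smul ha c)
    filter_upwards [Lp.coeFn_smul c a] with x hx
    rw [hx, Pi.smul_apply, Pi.smul_apply, smul_eq_mul, smul_eq_mul, mul_left_comm]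

theorem memLp_of_mulDomain {N : ℕ} {V : Config N → ℝ} (ψ : mulDomain V) :
    MemLp (fun x => (V x : ℂ) * (ψ : NParticle N) x) 2 volume := ψ.2

/-- Multiplication by the real function `V` on its maximal domain. -/
def mulOp {N : ℕ} (V : Config N → ℝ) : NParticle N →ₗ.[ℂ] NParticle N where
  domain := mulDomain V
  toFun :=
    { toFun := fun ψ => (memLp_of_mulDomain ψ).toLp _
      map_add' := fun a b => by
        rw [← MemLp.toLp_add (memLp_of_mulDomain a) (memLp_of_mulDomain b)]
        refine MemLp.toLp_congr _ _ ?_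
        filter_upwards [Lp.coeFn_add (a : NParticle N) b] with x hx
        rw [Submodule.coe_add, hx, Pi.add_apply, mul_add, Pi.add_apply]
      map_smul' := fun c a => by
        rw [RingHom.id_apply, ← MemLp.toLp_const_smul c (memLp_of_mulDomain a)]
        refine MemLp.toLp_congr _ _ ?_
        filter_upwards [Lp.coeFn_smul c (a : NParticle N)] with x hx
        rw [Submodule.coe_smul, hx, Pi.smul_apply, Pi.smul_apply, smul_eq_mul, smul_eq_mul,
          mul_left_comm] }

/-! ### The Hamiltonian -/

/-- `∑ⱼ Hⱼ⁰` with `Hⱼ⁰ = 1 ⊗ ⋯ ⊗ H⁰ ⊗ ⋯ ⊗ 1` (`H⁰` acting on the `j`-th particle): the closure of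
the operator which maps `u₁ ⊗ ⋯ ⊗ u_N`, with all `uᵢ` in the domain of `H⁰`, to
`∑ⱼ u₁ ⊗ ⋯ ⊗ H⁰uⱼ ⊗ ⋯ ⊗ u_N` (extended linearly). -/
def freeHamiltonian (N : ℕ) (H0 : OneParticle →ₗ.[ℂ] OneParticle) :
    NParticle N →ₗ.[ℂ] NParticle N :=
  (Submodule.span ℂ (range fun u : Fin N → H0.domain =>
    ((tensor fun i => (u i : OneParticle),
      ∑ j, tensor (Function.update (fun i => (u i : OneParticle)) j (H0 (u j)))) :
        NParticle N × NParticle N))).topologicalClosure.toLinearPMap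

/-- The pair interaction `∑_{i<j} v(xᵢ - xⱼ)`. -/
def pairPotential (N : ℕ) (v : Space → ℝ) (x : Config N) : ℝ :=
  ∑ p ∈ Finset.univ.filter (fun p : Fin N × Fin N => p.1 < p.2), v (x p.1 - x p.2)

/-- `H^N = ∑ⱼ Hⱼ⁰ + ∑_{i<j} v(xᵢ - xⱼ)`: the closure of the operator sum, which has as its domain
the intersection of the two domains. If the operator sum is already self-adjoint, then it is closed
and the closure changes nothing. -/
def hamiltonian (N : ℕ) (H0 : OneParticle →ₗ.[ℂ] OneParticle) (v : Space → ℝ) :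
    NParticle N →ₗ.[ℂ] NParticle N :=
  (freeHamiltonian N H0 + mulOp (pairPotential N v)).closure

/-! ### Evolution equations -/

/-- The time interval `[0, T)`, where `T ≤ ∞`. -/
def timeInterval (T : EReal) : Set ℝ := {t | 0 ≤ t ∧ (t : EReal) < T}

/-- `f` solves `i ∂ₜ f = A f + g` on `[0, T)`, for a self-adjoint operator `A`: `f` is continuous
with values in the Hilbert space, and the equation holds when tested against every vector in the
domain of `A`. Every strong solution is of this kind; for `g = 0` the only
solution with initial value `f 0` is `f t = exp(-i t A) (f 0)`. -/
def IsSolution {E : Type*} [NormedAddCommGroup E] [InnerProductSpace ℂ E]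
    (A : E →ₗ.[ℂ] E) (T : EReal) (f g : ℝ → E) : Prop :=
  ContinuousOn f (timeInterval T) ∧
  ∀ t ∈ timeInterval T, ∀ u : A.domain,
    HasDerivWithinAt (fun s => inner ℂ (u : E) (f s))
      (-Complex.I * (inner ℂ (A u) (f t) + inner ℂ (u : E) (g t))) (timeInterval T) t

/-- The Schrödinger equation `i ∂ₜ ψ = H^N ψ`. -/
def IsSchroedingerSolution {N : ℕ} (H0 : OneParticle →ₗ.[ℂ] OneParticle) (v : Space → ℝ)
    (T : EReal) (ψ : ℝ → NParticle N) : Prop :=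
  IsSolution (hamiltonian N H0 v) T ψ 0

/-- The density `ρ_N = ∑ᵢ |φᵢ|²`. -/
def density {N : ℕ} (φ : Fin N → OneParticle) (x : Space) : ℝ := ∑ i, ‖φ i x‖ ^ 2

/-- The mean field `(v ⋆ ρ_N)(x) = ∫ v(x - y) ρ_N(y) dy`. -/
def meanField {N : ℕ} (v : Space → ℝ) (φ : Fin N → OneParticle) (x : Space) : ℝ :=
  ∫ y, v (x - y) * density φ y

/-- The fermionic Hartree equations `i ∂ₜ φⱼ = H⁰ φⱼ + (v ⋆ ρ_N) φⱼ`, `j = 1, …, N`. It is part of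
the notion that the mean field is defined and that `(v ⋆ ρ_N) φⱼ` is an element `g t` of `L²`. -/
def IsHartreeSolution {N : ℕ} (H0 : OneParticle →ₗ.[ℂ] OneParticle) (v : Space → ℝ)
    (T : EReal) (φ : ℝ → Fin N → OneParticle) : Prop :=
  (∀ t ∈ timeInterval T, ∀ᵐ x : Space,
    Integrable (fun y => v (x - y) * density (φ t) y)) ∧
  ∀ j : Fin N, ∃ g : ℝ → OneParticle,
    (∀ t ∈ timeInterval T, g t =ᵐ[volume] fun x => (meanField v (φ t) x : ℂ) * φ t j x) ∧
    IsSolution H0 T (fun t => φ t j) g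

/-! ### The counting functional -/

/-- `(p_m ψ)(x₁, …, x_N) = ∑ⱼ φⱼ(x_m) ∫ φⱼ*(x_m) ψ(x₁, …, x_N) dx_m`. -/
def pProj {N : ℕ} (φ : Fin N → OneParticle) (m : Fin N) (ψ : Config N → ℂ) : Config N → ℂ :=
  fun x => ∑ j, φ j (x m) * ∫ y, conj (φ j y) * ψ (Function.update x m y)

/-- `q_m = 1 - p_m`. -/
def qProj {N : ℕ} (φ : Fin N → OneParticle) (m : Fin N) (ψ : Config N → ℂ) : Config N → ℂ :=
  fun x => ψ x - pProj φ m ψ x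

open Classical in
/-- `P_{N,k} = ∑_a ∏_{m=1}^N (p_m)^{1-a_m} (q_m)^{a_m}`, the sum over all `a ∈ {0,1}^N` with
`∑ a_m = k`; here `a` is given by the set `s = {m : a_m = 1}`, and the product
is the composition of the factors `m = 1, …, N`. -/
def PProj {N : ℕ} (φ : Fin N → OneParticle) (k : ℕ) (ψ : Config N → ℂ) : Config N → ℂ :=
  fun x => ∑ s ∈ Finset.powersetCard k (Finset.univ : Finset (Fin N)),
    (List.finRange N).foldr (fun m g => if m ∈ s then qProj φ m g else pProj φ m g) ψ x

/-- `f̂ = ∑_{k=0}^N f(k) P_{N,k}`. -/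
def weightOp {N : ℕ} (f : ℕ → ℝ) (φ : Fin N → OneParticle) (ψ : Config N → ℂ) : Config N → ℂ :=
  fun x => ∑ k ∈ Finset.range (N + 1), (f k : ℂ) * PProj φ k ψ x

/-- The scalar product `⟨ψ, χ⟩ = ∫ ψ* χ` on `ℝ^{3N}`. -/
def scp {N : ℕ} (ψ χ : Config N → ℂ) : ℂ := ∫ x, conj (ψ x) * χ x

/-- The counting functional `α_f(ψ, φ₁, …, φ_N) = ⟨ψ, f̂ ψ⟩` (a real number, since `f̂` is symmetric
for orthonormal `φ₁, …, φ_N` and real `f`). -/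
def countingFunctional {N : ℕ} (f : ℕ → ℝ) (ψ : NParticle N) (φ : Fin N → OneParticle) : ℝ :=
  (scp (fun x => ψ x) (weightOp f φ fun x => ψ x)).re

/-- `α_n`, the counting functional with the weight `n(k) = k / N`. -/
def alphaN {N : ℕ} (ψ : NParticle N) (φ : Fin N → OneParticle) : ℝ :=
  countingFunctional (fun k => (k : ℝ) / N) ψ φ

end FermionMF

end

noncomputable section

namespace FermionMF

/-! ### Resolvents of self-adjoint operators and a product rule for weak derivatives. -/

section

section Abstract

variable {E : Type*} [NormedAddCommGroup E] [InnerProductSpace ℂ E] [CompleteSpace E]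
  {A : E →ₗ.[ℂ] E}

/-! ### Resolvents of self-adjoint operators -/

/-! Write N = n + 1, let p_m, q_m = 1 - p_m be the projections for particle m, and index the
distinguished particle by 0. Since the weighted sum ∑ k P_{N,k} equals ∑ q_m and antisymmetry makes
⟨ψ, q_m ψ⟩ independent of m, the counting functional is α = ‖q_0 ψ‖² (`alphaN_eq_excitation`).
Formally p_0 evolves by the commutator with ∑ H_j^0 + V(x_0), where V = v ⋆ ρ. In the derivative of
α the free Hamiltonian therefore cancels, as do all pair interactions not involving particle 0, and
what remains is, up to sign, twice the imaginary part of ⟨ψ, (∑_{m≠0} v(x_0 - x_m) - V(x_0)) p_0 ψ⟩.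

Insert p_m + q_m on both sides of each pair term, and drop p_0 on the left because it contributes a
real number. The term p_m q_0 … q_m p_0 is real by exchange symmetry
(`im_inner_projAt_coprojAt_eq_zero`). The term p_m q_0 … p_m p_0 is the direct interaction, which
the mean field cancels up to excitations (`norm_sum_inner_proj_proj_le`). The term q_m q_0 … q_m p_0
is already quadratic in excitations (`norm_sum_inner_coproj_coproj_le`). The term q_m q_0 … p_m p_0
raises the number of excitations by two and is estimated sector by sector
(`norm_sum_inner_coproj_proj_le`).

The Fermi statistics enter through the exclusion principle. With g_y = ∑ φ_j(y)* φ_j the kernel of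
the projection, ∑_{m≠0} p_m u(x_0 - x_m) p_m is an integral over y of u(x_0 - y) times the
occupation n_y = ∑_{m≠0} |g_y⟩⟨g_y|_m. On antisymmetric vectors n_y² = ρ(y) n_y, so 0 ≤ n_y ≤ ρ(y).
Hence a sum over N - 1 particles costs only sup v² ⋆ ρ ≤ D/N (`sum_norm_pairL_sq_le`), and the
difference from the mean field is controlled by the holes ρ(y) - n_y, whose total is 1 plus the
number of excitations, up to normalisation (`norm_sum_inner_pairL_sub_le`).

Altogether |dα/dt| ≤ 6 √D (α + 1/N), and Gronwall's inequality for α + 1/N gives the claim.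

The analytic difficulty is that ψ need not lie in the domain of H^N, the orbitals need not lie in
the domain of H^0, and the domain of H^N is only that of a closure. So ψ is replaced by (1 + i l
H^N)⁻¹ ψ, which is antisymmetric, solves the same equation and lies in the domain. The evolution of
p_0 is used in time-integrated form, an identity between bounded operators that extends to closures
of graphs (`HartreeFlow.exists_integral_projAt`, `HartreeFlow.exists_norm_inner_projAt_sub_le`). A
Gronwall inequality that needs only short-time increments replaces differentiation
(`gronwall_of_local`), and finally l → 0. Unbounded v are treated by truncation
(`abs_im_inner_mulOp_sub_le`). -/

theorem inner_map_eq_of_isSelfAdjoint (hA : IsSelfAdjoint A) (x y : A.domain) :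
    inner ℂ (A x) (y : E) = inner ℂ (x : E) (A y) := by
  have h := LinearPMap.adjoint_isFormalAdjoint (T := A) hA.dense_domain
  rw [LinearPMap.isSelfAdjoint_def.1 hA] at h
  exact h x y

theorem im_inner_map_self_of_isSelfAdjoint (hA : IsSelfAdjoint A) (x : A.domain) :
    (inner ℂ (x : E) (A x)).im = 0 := by
  rw [← Complex.conj_eq_iff_im, inner_conj_symm, inner_map_eq_of_isSelfAdjoint hA]

theorem norm_add_smul_sq_of_isSelfAdjoint (hA : IsSelfAdjoint A) (l : ℝ) (x : A.domain) :
    ‖(x : E) + (Complex.I * l) • A x‖ ^ 2 = ‖(x : E)‖ ^ 2 + l ^ 2 * ‖A x‖ ^ 2 := by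
  have h2 := im_inner_map_self_of_isSelfAdjoint hA x
  rw [@norm_add_sq ℂ, inner_smul_right, norm_smul, norm_mul, Complex.norm_I, Complex.norm_real,
    mul_pow]
  simp [h2]

/-- By the preceding Pythagorean identity the map (x, Ax) ↦ x + i l A x is bounded below on the
closed graph, so it is injective with closed range. A vector orthogonal to the range lies in the
domain of the adjoint, which is A itself, and the real part of its pairing with its own image is its
squared norm, so it vanishes. -/
theorem exists_resolvent (hA : IsSelfAdjoint A) {l : ℝ} (hl : l ≠ 0) :
    ∃ J : E →L[ℂ] E, (∀ w, ∃ h : J w ∈ A.domain, J w + (Complex.I * l) • A ⟨J w, h⟩ = w) ∧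
      ∀ x : A.domain, J ((x : E) + (Complex.I * l) • A x) = x := by
  have hcl : IsClosed (A.graph : Set (E × E)) := hA.isClosed
  have : CompleteSpace A.graph := hcl.completeSpace_coe
  let S : A.graph →L[ℂ] E :=
    (ContinuousLinearMap.fst ℂ E E + (Complex.I * l : ℂ) • ContinuousLinearMap.snd ℂ E E).comp
      A.graph.subtypeL
  have hS : ∀ (x : A.domain) (h : ((x : E), A x) ∈ A.graph),
      S ⟨((x : E), A x), h⟩ = (x : E) + (Complex.I * l) • A x := fun x h => rfl
  have hanti : AntilipschitzWith (Real.toNNReal (max 1 |l|⁻¹)) S := by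
    refine ContinuousLinearMap.antilipschitz_of_bound S fun g => ?_
    obtain ⟨⟨a, b⟩, hg⟩ := g
    obtain ⟨x, hx1, hx2⟩ := (LinearPMap.mem_graph_iff A).1 hg
    simp only at hx1 hx2
    subst hx1 hx2
    rw [hS, Real.coe_toNNReal _ (le_trans zero_le_one (le_max_left _ _))]
    have h := norm_add_smul_sq_of_isSelfAdjoint hA l x
    have hn := norm_nonneg ((x : E) + (Complex.I * l) • A x)
    have h1 : ‖(x : E)‖ ≤ ‖(x : E) + (Complex.I * l) • A x‖ := by
      apply le_of_sq_le_sq _ hn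
      nlinarith [mul_nonneg (sq_nonneg l) (sq_nonneg ‖A x‖)]
    have h2 : |l| * ‖A x‖ ≤ ‖(x : E) + (Complex.I * l) • A x‖ := by
      apply le_of_sq_le_sq _ hn
      rw [mul_pow, sq_abs]
      nlinarith [sq_nonneg ‖(x : E)‖]
    have hl' : 0 < |l| := abs_pos.2 hl
    refine max_le ?_ ?_
    · calc ‖(x : E)‖ ≤ 1 * ‖(x : E) + (Complex.I * l) • A x‖ := by rw [one_mul]; exact h1
        _ ≤ _ := mul_le_mul_of_nonneg_right (le_max_left _ _) hn
    · calc ‖A x‖ = |l|⁻¹ * (|l| * ‖A x‖) := by field_simp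
        _ ≤ |l|⁻¹ * ‖(x : E) + (Complex.I * l) • A x‖ := by gcongr
        _ ≤ _ := mul_le_mul_of_nonneg_right (le_max_right _ _) hn
  have hrange : LinearMap.range S.toLinearMap = ⊤ := by
    have hc : IsClosed (LinearMap.range S.toLinearMap : Set E) :=
      hanti.isClosed_range S.uniformContinuous
    have : CompleteSpace (LinearMap.range S.toLinearMap) := hc.completeSpace_coe
    rw [← Submodule.orthogonal_eq_bot_iff, Submodule.eq_bot_iff]
    intro w hw
    rw [Submodule.mem_orthogonal'] at hw
    have hw' : ∀ x : A.domain, inner ℂ w ((x : E) + (Complex.I * l) • A x) = 0 := fun x =>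
      hw _ ⟨⟨((x : E), A x), A.mem_graph x⟩, rfl⟩
    have hc0 : (Complex.I * l : ℂ) ≠ 0 := by simp [hl]
    have key : ∀ x : A.domain,
        inner ℂ ((-(starRingEnd ℂ (Complex.I * l)⁻¹)) • w) (x : E) = inner ℂ w (A x) := by
      intro x
      have := hw' x
      rw [inner_add_right, inner_smul_right] at this
      rw [inner_smul_left, map_neg, Complex.conj_conj, neg_mul, neg_eq_iff_eq_neg,
        inv_mul_eq_iff_eq_mul₀ hc0]
      linear_combination this
    have hmem : w ∈ A.domain := by
      have := LinearPMap.mem_adjoint_domain_of_exists (T := A) w ⟨_, key⟩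
      rwa [LinearPMap.isSelfAdjoint_def.1 hA] at this
    have h0 := hw' ⟨w, hmem⟩
    have him : (inner ℂ w (A ⟨w, hmem⟩)).im = 0 :=
      im_inner_map_self_of_isSelfAdjoint hA ⟨w, hmem⟩
    rw [inner_add_right, inner_smul_right] at h0
    have h1 := congrArg Complex.re h0
    simp [-inner_self_eq_norm_sq_to_K, him] at h1
    exact (re_inner_self_nonpos (𝕜 := ℂ)).1 h1.le
  have hbij : Function.Bijective S :=
    ⟨hanti.injective, LinearMap.range_eq_top.1 hrange⟩
  let e := ContinuousLinearEquiv.ofBijective S (LinearMap.ker_eq_bot.2 hbij.1) hrange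
  refine ⟨(ContinuousLinearMap.fst ℂ E E).comp (A.graph.subtypeL.comp e.symm.toContinuousLinearMap),
    fun w => ?_, fun x => ?_⟩
  · have hw : S (e.symm w) = w := e.apply_symm_apply w
    obtain ⟨x, hx1, hx2⟩ := (LinearPMap.mem_graph_iff A).1 (e.symm w).2
    have hx1' : (ContinuousLinearMap.fst ℂ E E).comp
        (A.graph.subtypeL.comp e.symm.toContinuousLinearMap) w = x := hx1.symm
    have hmem : (ContinuousLinearMap.fst ℂ E E).comp
        (A.graph.subtypeL.comp e.symm.toContinuousLinearMap) w ∈ A.domain := by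
      rw [hx1']; exact x.2
    have : (⟨_, hmem⟩ : A.domain) = x := Subtype.ext hx1'
    refine ⟨hmem, ?_⟩
    rw [this, hx1', hx2, hx1]
    exact hw
  · have : e.symm (S ⟨((x : E), A x), A.mem_graph x⟩) = ⟨((x : E), A x), A.mem_graph x⟩ :=
      e.symm_apply_apply _
    rw [hS] at this
    change ((e.symm ((x : E) + (Complex.I * l) • A x) : A.graph) : E × E).1 = x
    rw [this]

open Classical in
/-- The operator `(1 + i l A)⁻¹`, for a self-adjoint operator `A` and real `l ≠ 0`. -/
def resolvent (A : E →ₗ.[ℂ] E) (l : ℝ) : E →L[ℂ] E :=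
  if h : IsSelfAdjoint A ∧ l ≠ 0 then (exists_resolvent h.1 h.2).choose else 0

variable {l : ℝ}

theorem resolvent_spec (hA : IsSelfAdjoint A) (hl : l ≠ 0) :
    (∀ w, ∃ h : resolvent A l w ∈ A.domain,
      resolvent A l w + (Complex.I * l) • A ⟨resolvent A l w, h⟩ = w) ∧
      ∀ x : A.domain, resolvent A l ((x : E) + (Complex.I * l) • A x) = x := by
  rw [resolvent, dif_pos ⟨hA, hl⟩]
  exact (exists_resolvent hA hl).choose_spec

theorem resolvent_mem (hA : IsSelfAdjoint A) (hl : l ≠ 0) (w : E) :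
    resolvent A l w ∈ A.domain := ((resolvent_spec hA hl).1 w).1

theorem resolvent_add (hA : IsSelfAdjoint A) (hl : l ≠ 0) (w : E) :
    resolvent A l w + (Complex.I * l) • A ⟨resolvent A l w, resolvent_mem hA hl w⟩ = w :=
  ((resolvent_spec hA hl).1 w).2

theorem resolvent_apply_add (hA : IsSelfAdjoint A) (hl : l ≠ 0) (x : A.domain) :
    resolvent A l ((x : E) + (Complex.I * l) • A x) = x := (resolvent_spec hA hl).2 x

theorem norm_resolvent_le (hA : IsSelfAdjoint A) (hl : l ≠ 0) (w : E) :
    ‖resolvent A l w‖ ≤ ‖w‖ := by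
  apply le_of_sq_le_sq _ (norm_nonneg w)
  have h := norm_add_smul_sq_of_isSelfAdjoint hA l ⟨_, resolvent_mem hA hl w⟩
  rw [resolvent_add hA hl w] at h
  rw [h]
  exact le_add_of_nonneg_right (by positivity)

theorem map_resolvent (hA : IsSelfAdjoint A) (hl : l ≠ 0) (w : E) :
    A ⟨resolvent A l w, resolvent_mem hA hl w⟩ = (Complex.I * l)⁻¹ • (w - resolvent A l w) := by
  have hc0 : (Complex.I * l : ℂ) ≠ 0 := by simp [hl]
  rw [eq_inv_smul_iff₀ hc0, eq_sub_iff_add_eq, add_comm]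
  exact resolvent_add hA hl w

/-- This moves the regularisation from a solution onto a test vector, which thereby enters the
domain of A. -/
theorem inner_resolvent_neg (hA : IsSelfAdjoint A) (hl : l ≠ 0) (w f : E) :
    inner ℂ (resolvent A (-l) w) f = inner ℂ w (resolvent A l f) := by
  have hl' : -l ≠ 0 := neg_ne_zero.2 hl
  have h1 := resolvent_add hA hl f
  have h2 := resolvent_add hA hl' w
  have hs := inner_map_eq_of_isSelfAdjoint hA ⟨_, resolvent_mem hA hl' w⟩ ⟨_, resolvent_mem hA hl f⟩
  simp only at hs
  conv_lhs => rw [← h1]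
  conv_rhs => rw [← h2]
  rw [inner_add_right, inner_add_left, inner_smul_right, inner_smul_left, hs]
  simp

theorem inner_map_resolvent_neg (hA : IsSelfAdjoint A) (hl : l ≠ 0) (w f : E) :
    inner ℂ (A ⟨resolvent A (-l) w, resolvent_mem hA (neg_ne_zero.2 hl) w⟩) f =
      inner ℂ w (A ⟨resolvent A l f, resolvent_mem hA hl f⟩) := by
  rw [map_resolvent hA hl, map_resolvent hA (neg_ne_zero.2 hl), inner_smul_left, inner_smul_right,
    inner_sub_left, inner_sub_right, inner_resolvent_neg hA hl]
  simp

/-- On the domain, the error is i l times the resolvent of A x and so is O(l); the uniform bound by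
1 and density extend the limit to all vectors. -/
theorem tendsto_resolvent (hA : IsSelfAdjoint A) (w : E) :
    Tendsto (fun l : ℝ => resolvent A l w) (𝓝[≠] 0) (𝓝 w) := by
  rw [Metric.tendsto_nhds]
  intro ε hε
  obtain ⟨x, hx, hxw⟩ := Metric.mem_closure_iff.1 (hA.dense_domain w) (ε / 3) (by positivity)
  have hlim : Tendsto (fun l : ℝ => |l| * ‖A ⟨x, hx⟩‖) (𝓝[≠] 0) (𝓝 0) := by
    have : Tendsto (fun l : ℝ => |l| * ‖A ⟨x, hx⟩‖) (𝓝 0) (𝓝 (|0| * ‖A ⟨x, hx⟩‖)) :=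
      (continuous_abs.mul continuous_const).tendsto _
    rw [abs_zero, zero_mul] at this
    exact this.mono_left nhdsWithin_le_nhds
  filter_upwards [hlim.eventually (gt_mem_nhds (show (0 : ℝ) < ε / 3 by positivity)),
    self_mem_nhdsWithin] with l hl1 hl
  have h1 : resolvent A l x - x = -((Complex.I * l) • resolvent A l (A ⟨x, hx⟩)) := by
    have := resolvent_apply_add hA hl ⟨x, hx⟩
    rw [map_add, map_smul] at this
    simp only at this
    rw [← eq_sub_iff_add_eq] at this
    rw [this]; abel
  have h2 : ‖resolvent A l x - x‖ < ε / 3 := by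
    rw [h1, norm_neg, norm_smul, norm_mul, Complex.norm_I, one_mul, Complex.norm_real]
    refine lt_of_le_of_lt ?_ hl1
    exact mul_le_mul_of_nonneg_left (norm_resolvent_le hA hl _) (norm_nonneg _)
  have h3 : ‖resolvent A l (w - x)‖ < ε / 3 := by
    refine lt_of_le_of_lt (norm_resolvent_le hA hl _) ?_
    rwa [dist_eq_norm] at hxw
  have h4 : ‖x - w‖ < ε / 3 := by
    rwa [dist_comm, dist_eq_norm] at hxw
  have : resolvent A l w - w = resolvent A l (w - x) + (resolvent A l x - x) + (x - w) := by
    rw [map_sub]; abel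
  rw [dist_eq_norm, this]
  calc _ ≤ _ := norm_add₃_le
    _ < ε := by linarith

/-! ### Weak derivatives -/

/-- The product rule for weakly differentiable functions, one of which is continuous. -/
theorem hasDerivWithinAt_inner_of_weak {f h : ℝ → E} {f' h' : E} {s : Set ℝ} {t : ℝ}
    (hf : ∀ u, HasDerivWithinAt (fun r => inner ℂ u (f r)) (inner ℂ u f') s t)
    (hh : ∀ u, HasDerivWithinAt (fun r => inner ℂ u (h r)) (inner ℂ u h') s t)
    (hc : ContinuousWithinAt h s t) :
    HasDerivWithinAt (fun r => inner ℂ (f r) (h r))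
      (inner ℂ f' (h t) + inner ℂ (f t) h') s t := by
  rw [hasDerivWithinAt_iff_tendsto_slope]
  refine tendsto_of_seq_tendsto fun u hu => ?_
  set a : ℕ → E := fun k => ((u k - t)⁻¹ : ℂ) • (f (u k) - f t) with ha
  have hweak : ∀ x, Tendsto (fun k => inner ℂ x (a k)) atTop (𝓝 (inner ℂ x f')) := by
    intro x
    have h1 := ((hasDerivWithinAt_iff_tendsto_slope.1 (hf x)).comp hu)
    refine h1.congr fun k => ?_
    simp only [ha, Function.comp, slope_def_module, inner_smul_right, inner_sub_right,
      Complex.real_smul]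
    push_cast
    ring
  -- The difference quotients of f converge only weakly; Banach–Steinhaus bounds them, which
  -- suffices since the other factor converges in norm.
  have hbdd : ∃ C, ∀ k, ‖a k‖ ≤ C := by
    obtain ⟨C, hC⟩ := banach_steinhaus (g := fun k => innerSL ℂ (a k)) fun x => by
      obtain ⟨C, hC⟩ := (hweak x).norm.bddAbove_range
      refine ⟨C, fun k => ?_⟩
      rw [innerSL_apply_apply, norm_inner_symm]
      exact hC ⟨k, rfl⟩
    exact ⟨C, fun k => by simpa using hC k⟩
  obtain ⟨C, hC⟩ := hbdd
  have hu' : Tendsto u atTop (𝓝[s] t) :=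
    hu.mono_right (nhdsWithin_mono _ sdiff_subset)
  have hcu : Tendsto (fun k => h (u k)) atTop (𝓝 (h t)) := hc.tendsto.comp hu'
  have hz : Tendsto (fun k => inner ℂ (a k) (h (u k) - h t)) atTop (𝓝 0) := by
    have h0 : Tendsto (fun k => C * ‖h (u k) - h t‖) atTop (𝓝 0) := by
      have := (tendsto_iff_norm_sub_tendsto_zero.1 hcu).const_mul C
      simpa using this
    refine squeeze_zero_norm (fun k => ?_) h0
    exact (norm_inner_le_norm _ _).trans (mul_le_mul_of_nonneg_right (hC k) (norm_nonneg _))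
  have h1 : Tendsto (fun k => inner ℂ (a k) (h t)) atTop (𝓝 (inner ℂ f' (h t))) := by
    have := (Complex.continuous_conj.tendsto _).comp (hweak (h t))
    simpa [Function.comp_def] using this
  have h2 := (hasDerivWithinAt_iff_tendsto_slope.1 (hh (f t))).comp hu
  have hsum := (hz.add h1).add h2
  rw [zero_add] at hsum
  refine hsum.congr fun k => ?_
  simp only [ha, Function.comp, slope_def_module, inner_smul_left, inner_sub_right, inner_sub_left,
      Complex.real_smul, map_inv₀, map_sub, Complex.conj_ofReal]
  push_cast
  ring

end Abstract

end

/-! ### Conservation laws for weak solutions, and Gronwall's inequality. -/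

section

/-! ### The time interval -/

theorem mem_timeInterval_of_le {T : EReal} {s t : ℝ} (ht : t ∈ timeInterval T) (h0 : 0 ≤ s)
    (hs : s ≤ t) : s ∈ timeInterval T :=
  ⟨h0, lt_of_le_of_lt (EReal.coe_le_coe_iff.2 hs) ht.2⟩

theorem Icc_subset_timeInterval {T : EReal} {t : ℝ} (ht : t ∈ timeInterval T) :
    Icc 0 t ⊆ timeInterval T := fun _ hs => mem_timeInterval_of_le ht hs.1 hs.2

theorem timeInterval_mem_nhds {T : EReal} {s : ℝ} (hs : s ∈ timeInterval T) (h0 : 0 < s) :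
    timeInterval T ∈ 𝓝 s := by
  have h1 : ∀ᶠ r : ℝ in 𝓝 s, (r : EReal) < T :=
    continuous_coe_real_ereal.continuousAt.eventually (gt_mem_nhds hs.2)
  filter_upwards [h1, lt_mem_nhds h0] with r hr hr0 using ⟨hr0.le, hr⟩

section Abstract

variable {E : Type*} [NormedAddCommGroup E] [InnerProductSpace ℂ E] [CompleteSpace E]
  {A : E →ₗ.[ℂ] E} {T : EReal} {l : ℝ}

/-! ### Solutions of evolution equations -/

/-- Use the resolvent at -l of w as test vector: the regularised solution is then weakly
differentiable against every vector, not only against the domain. -/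
theorem IsSolution.hasDerivWithinAt_resolvent (hA : IsSelfAdjoint A) (hl : l ≠ 0) {f g : ℝ → E}
    (h : IsSolution A T f g) {t : ℝ} (ht : t ∈ timeInterval T) (w : E) :
    HasDerivWithinAt (fun s => inner ℂ w (resolvent A l (f s)))
      (inner ℂ w (-Complex.I • (A ⟨resolvent A l (f t), resolvent_mem hA hl _⟩ +
        resolvent A l (g t)))) (timeInterval T) t := by
  have := h.2 t ht ⟨resolvent A (-l) w, resolvent_mem hA (neg_ne_zero.2 hl) w⟩
  simp only [inner_resolvent_neg hA hl, inner_map_resolvent_neg hA hl] at this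
  rwa [inner_smul_right, inner_add_right]

theorem exists_bound_of_continuousOn_timeInterval {E : Type*} [NormedAddCommGroup E] {f : ℝ → E} (hf : ContinuousOn f (timeInterval T))
    {t : ℝ} (ht : t ∈ timeInterval T) : ∃ K, ∀ s ∈ Icc 0 t, ‖f s‖ ≤ K :=
  isCompact_Icc.exists_bound_of_continuousOn (hf.mono (Icc_subset_timeInterval ht))

/-- Scalar products of two solutions are conserved if the inhomogeneities act symmetrically. -/
theorem IsSolution.inner_eq (hA : IsSelfAdjoint A) {f₁ g₁ f₂ g₂ : ℝ → E}
    (h₁ : IsSolution A T f₁ g₁) (h₂ : IsSolution A T f₂ g₂) {t : ℝ} (ht : t ∈ timeInterval T)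
    (hg : ∀ s ∈ Icc 0 t, inner ℂ (g₁ s) (f₂ s) = inner ℂ (f₁ s) (g₂ s)) {c : ℝ → ℝ}
    (hc : IntervalIntegrable c volume 0 t) (hb₁ : ∀ s ∈ Icc 0 t, ‖g₁ s‖ ≤ c s)
    (hb₂ : ∀ s ∈ Icc 0 t, ‖g₂ s‖ ≤ c s) :
    inner ℂ (f₁ t) (f₂ t) = inner ℂ (f₁ 0) (f₂ 0) := by
  obtain ⟨K₁, hK₁⟩ := exists_bound_of_continuousOn_timeInterval h₁.1 ht
  obtain ⟨K₂, hK₂⟩ := exists_bound_of_continuousOn_timeInterval h₂.1 ht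
  have ht0 : 0 ≤ t := ht.1
  -- After regularisation the A-terms in the derivative cancel by symmetry. The remaining derivative
  -- `d l` is dominated uniformly in l and tends to 0 by `hg`, so its integral vanishes in the limit
  -- l → 0.
  let J : ℝ → E →L[ℂ] E := resolvent A
  let d : ℝ → ℝ → ℂ := fun l s =>
    Complex.I * (inner ℂ (J l (g₁ s)) (J l (f₂ s)) - inner ℂ (J l (f₁ s)) (J l (g₂ s)))
  have hder : ∀ l ≠ 0, ∀ s ∈ timeInterval T,
      HasDerivWithinAt (fun s => inner ℂ (J l (f₁ s)) (J l (f₂ s))) (d l s) (timeInterval T) s := by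
    intro l hl s hs
    have hcont : ContinuousWithinAt (fun s => J l (f₂ s)) (timeInterval T) s :=
      ((J l).continuous.comp_continuousOn h₂.1) s hs
    have := hasDerivWithinAt_inner_of_weak
      (fun w => h₁.hasDerivWithinAt_resolvent hA hl hs w)
      (fun w => h₂.hasDerivWithinAt_resolvent hA hl hs w) hcont
    convert! this using 1
    have hsym := inner_map_eq_of_isSelfAdjoint hA ⟨_, resolvent_mem hA hl (f₁ s)⟩
      ⟨_, resolvent_mem hA hl (f₂ s)⟩
    simp only at hsym
    simp only [inner_smul_left, inner_smul_right, inner_add_left, inner_add_right, hsym, d, J,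
      map_neg, Complex.conj_I]
    ring
  have hcontF : ∀ l, ContinuousOn (fun s => inner ℂ (J l (f₁ s)) (J l (f₂ s))) (Icc 0 t) :=
    fun l => (((J l).continuous.comp_continuousOn h₁.1).inner
      ((J l).continuous.comp_continuousOn h₂.1)).mono (Icc_subset_timeInterval ht)
  have hderAt : ∀ l ≠ 0, ∀ s ∈ Ioo 0 t,
      HasDerivAt (fun s => inner ℂ (J l (f₁ s)) (J l (f₂ s))) (d l s) s := fun l hl s hs =>
    (hder l hl s (mem_timeInterval_of_le ht hs.1.le hs.2.le)).hasDerivAt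
      (timeInterval_mem_nhds (mem_timeInterval_of_le ht hs.1.le hs.2.le) hs.1)
  -- Nothing is known about measurability of the sources in time; `d l` is measurable because it is
  -- a derivative.
  have hmeas : ∀ l ≠ 0, AEStronglyMeasurable (d l) (volume.restrict (Ioc 0 t)) := by
    intro l hl
    rw [Measure.restrict_congr_set Ioo_ae_eq_Ioc.symm]
    refine (measurable_deriv fun s => inner ℂ (J l (f₁ s)) (J l (f₂ s))).aestronglyMeasurable.congr
      ?_
    filter_upwards [ae_restrict_mem measurableSet_Ioo] with s hs using (hderAt l hl s hs).deriv
  have hbound : ∀ l ≠ 0, ∀ s ∈ Icc 0 t, ‖d l s‖ ≤ c s * K₂ + K₁ * c s := by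
    intro l hl s hs
    have hc0 : 0 ≤ c s := (norm_nonneg _).trans (hb₁ s hs)
    have e1 : ‖inner ℂ (J l (g₁ s)) (J l (f₂ s))‖ ≤ c s * K₂ :=
      (norm_inner_le_norm _ _).trans (mul_le_mul ((norm_resolvent_le hA hl _).trans (hb₁ s hs))
        ((norm_resolvent_le hA hl _).trans (hK₂ s hs)) (norm_nonneg _) hc0)
    have e2 : ‖inner ℂ (J l (f₁ s)) (J l (g₂ s))‖ ≤ K₁ * c s :=
      (norm_inner_le_norm _ _).trans (mul_le_mul ((norm_resolvent_le hA hl _).trans (hK₁ s hs))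
        ((norm_resolvent_le hA hl _).trans (hb₂ s hs)) (norm_nonneg _)
        ((norm_nonneg _).trans (hK₁ s hs)))
    calc ‖d l s‖ = ‖inner ℂ (J l (g₁ s)) (J l (f₂ s)) - inner ℂ (J l (f₁ s)) (J l (g₂ s))‖ := by
          simp [d]
      _ ≤ _ := (norm_sub_le _ _).trans (add_le_add e1 e2)
  have hbint : IntervalIntegrable (fun s => c s * K₂ + K₁ * c s) volume 0 t :=
    (hc.mul_const K₂).add (hc.const_mul K₁)
  have hftc : ∀ l ≠ 0, ∫ s in (0 : ℝ)..t, d l s =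
      inner ℂ (J l (f₁ t)) (J l (f₂ t)) - inner ℂ (J l (f₁ 0)) (J l (f₂ 0)) := by
    intro l hl
    refine intervalIntegral.integral_eq_sub_of_hasDerivAt_of_le ht0 (hcontF l) (hderAt l hl) ?_
    rw [intervalIntegrable_iff_integrableOn_Ioc_of_le ht0] at hbint ⊢
    refine hbint.mono' (hmeas l hl) ?_
    filter_upwards [ae_restrict_mem measurableSet_Ioc] with s hs
      using hbound l hl s ⟨hs.1.le, hs.2⟩
  have hlim0 : Tendsto (fun l => ∫ s in (0 : ℝ)..t, d l s) (𝓝[≠] 0) (𝓝 (∫ s in (0 : ℝ)..t, (0 : ℂ))) := by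
    refine intervalIntegral.tendsto_integral_filter_of_dominated_convergence
      (fun s => c s * K₂ + K₁ * c s) ?_ ?_ hbint ?_
    · filter_upwards [self_mem_nhdsWithin] with l hl
      rw [uIoc_of_le ht0]
      exact hmeas l hl
    · filter_upwards [self_mem_nhdsWithin] with l hl
      refine Eventually.of_forall fun s hs => ?_
      rw [uIoc_of_le ht0] at hs
      exact hbound l hl s ⟨hs.1.le, hs.2⟩
    · refine Eventually.of_forall fun s hs => ?_
      rw [uIoc_of_le ht0] at hs
      have h := (((tendsto_resolvent hA (g₁ s)).inner (𝕜 := ℂ) (tendsto_resolvent hA (f₂ s))).sub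
        ((tendsto_resolvent hA (f₁ s)).inner (𝕜 := ℂ) (tendsto_resolvent hA (g₂ s)))).const_mul Complex.I
      rw [hg s ⟨hs.1.le, hs.2⟩, sub_self, mul_zero] at h
      exact h
  have hlim1 := (((tendsto_resolvent hA (f₁ t)).inner (𝕜 := ℂ) (tendsto_resolvent hA (f₂ t))).sub
    ((tendsto_resolvent hA (f₁ 0)).inner (𝕜 := ℂ) (tendsto_resolvent hA (f₂ 0))))
  have := tendsto_nhds_unique (hlim0.congr' (by
    filter_upwards [self_mem_nhdsWithin] with l hl using hftc l hl)) hlim1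
  rw [intervalIntegral.integral_zero] at this
  exact sub_eq_zero.1 this.symm

/-- Solutions of the homogeneous equation have constant norm. -/
theorem IsSolution.norm_eq (hA : IsSelfAdjoint A) {f : ℝ → E} (h : IsSolution A T f 0) {t : ℝ}
    (ht : t ∈ timeInterval T) : ‖f t‖ = ‖f 0‖ := by
  have := h.inner_eq hA h ht (c := fun _ => 0) (by simp) intervalIntegrable_const (by simp) (by simp)
  rw [inner_self_eq_norm_sq_to_K, inner_self_eq_norm_sq_to_K] at this
  have h2 : ‖f t‖ ^ 2 = ‖f 0‖ ^ 2 := by exact_mod_cast this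
  exact (sq_eq_sq₀ (norm_nonneg _) (norm_nonneg _)).1 h2

/-- The resolvent turns a solution of the homogeneous equation into a uniformly differentiable
one. -/
theorem IsSolution.exists_norm_resolvent_sub_le (hA : IsSelfAdjoint A) (hl : l ≠ 0) {f : ℝ → E}
    (h : IsSolution A T f 0) {t : ℝ} (ht : t ∈ timeInterval T) {ε : ℝ} (hε : 0 < ε) :
    ∃ δ > 0, ∀ a b, 0 ≤ a → a ≤ b → b ≤ t → b - a < δ →
      ‖resolvent A l (f b) - resolvent A l (f a) +
        (Complex.I * ((b - a : ℝ) : ℂ)) • A ⟨resolvent A l (f a), resolvent_mem hA hl _⟩‖ ≤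
          ε * (b - a) := by
  let k : ℝ → E := fun s => A ⟨resolvent A l (f s), resolvent_mem hA hl _⟩
  have hk : ContinuousOn k (Icc 0 t) := by
    have : k = fun s => (Complex.I * l : ℂ)⁻¹ • (f s - resolvent A l (f s)) :=
      funext fun s => map_resolvent hA hl (f s)
    rw [this]
    exact ((h.1.sub ((resolvent A l).continuous.comp_continuousOn h.1)).const_smul _).mono
      (Icc_subset_timeInterval ht)
  have huc := isCompact_Icc.uniformContinuousOn_of_continuous hk
  obtain ⟨δ, hδ, huc⟩ := Metric.uniformContinuousOn_iff.1 huc ε hε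
  refine ⟨δ, hδ, fun a b h0 hab hbt hd => ?_⟩
  set z := resolvent A l (f b) - resolvent A l (f a) + (Complex.I * ((b - a : ℝ) : ℂ)) • k a with hz
  -- Testing the Taylor remainder z against itself reduces the claim to the scalar mean value
  -- inequality, for which weak differentiability is enough: the increment of `F` is ‖z‖².
  let F : ℝ → ℂ := fun s => inner ℂ z (resolvent A l (f s)) + (Complex.I * inner ℂ z (k a)) * (s : ℂ)
  have hmv := norm_image_sub_le_of_norm_deriv_le_segment' (f := F) (a := a) (b := b)
    (f' := fun s => inner ℂ z (-Complex.I • (k s + resolvent A l 0)) +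
      (Complex.I * inner ℂ z (k a)) * 1) (C := ε * ‖z‖) (fun s hs => by
      have hs' : s ∈ timeInterval T :=
        mem_timeInterval_of_le ht (h0.trans hs.1) (hs.2.trans hbt)
      have hsub : Icc a b ⊆ timeInterval T := fun r hr =>
        mem_timeInterval_of_le ht (h0.trans hr.1) (hr.2.trans hbt)
      refine ((h.hasDerivWithinAt_resolvent hA hl hs' z).mono hsub).add ?_
      exact ((Complex.ofRealCLM.hasDerivAt).hasDerivWithinAt).const_mul _) (fun s hs => by
      have : inner ℂ z (-Complex.I • (k s + resolvent A l 0)) + (Complex.I * inner ℂ z (k a)) * 1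
          = Complex.I * inner ℂ z (k a - k s) := by
        rw [map_zero, add_zero, inner_smul_right, inner_sub_right]; ring
      rw [this, norm_mul, Complex.norm_I, one_mul, mul_comm ε]
      refine (norm_inner_le_norm _ _).trans (mul_le_mul_of_nonneg_left ?_ (norm_nonneg _))
      rw [← dist_eq_norm]
      refine (huc a ⟨h0, hab.trans hbt⟩ s ⟨h0.trans hs.1, hs.2.le.trans hbt⟩ ?_).le
      rw [Real.dist_eq, abs_sub_comm, abs_of_nonneg (by linarith [hs.1])]
      linarith [hs.2]) b (right_mem_Icc.2 hab)
  have hFz : F b - F a = inner ℂ z z := by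
    have h1 : inner ℂ z z = inner ℂ z (resolvent A l (f b) - resolvent A l (f a) +
      (Complex.I * ((b - a : ℝ) : ℂ)) • k a) := by rw [← hz]
    rw [h1, inner_add_right, inner_sub_right, inner_smul_right]
    simp only [F]
    push_cast
    ring
  rw [hFz, inner_self_eq_norm_sq_to_K, norm_pow, RCLike.norm_ofReal, abs_of_nonneg (norm_nonneg _)]
    at hmv
  rcases (norm_nonneg z).eq_or_lt with h0 | h0
  · rw [← h0]; exact mul_nonneg hε.le (by linarith)
  · refine le_of_mul_le_mul_right ?_ h0
    calc ‖z‖ * ‖z‖ = ‖z‖ ^ 2 := (sq _).symm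
      _ ≤ _ := hmv
      _ = _ := by ring

end Abstract

/-- A local form of the Gronwall inequality. -/
theorem gronwall_of_local {y c : ℝ → ℝ} {t : ℝ} (ht : 0 ≤ t) (hy : ∀ s ∈ Icc 0 t, 0 ≤ y s)
    (hc : IntervalIntegrable c volume 0 t) (hc0 : ∀ s ∈ Icc 0 t, 0 ≤ c s)
    (h : ∀ ε > 0, ∃ δ > 0, ∀ a b, 0 ≤ a → a ≤ b → b ≤ t → b - a < δ →
      y b ≤ y a + (y a + ε) * (∫ s in a..b, c s) + ε * (b - a)) :
    y t ≤ Real.exp (∫ s in (0 : ℝ)..t, c s) * y 0 := by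
  have hint : ∀ a b, 0 ≤ a → a ≤ b → b ≤ t → IntervalIntegrable c volume a b :=
    fun a b h0 hab hb => hc.mono_set (by
      rw [uIcc_of_le hab, uIcc_of_le ht]; exact Icc_subset_Icc h0 hb)
  have hnn : ∀ a b, 0 ≤ a → a ≤ b → b ≤ t → 0 ≤ ∫ s in a..b, c s := fun a b h0 hab hb =>
    intervalIntegral.integral_nonneg hab fun s hs => hc0 s ⟨h0.trans hs.1, hs.2.trans hb⟩
  have key : ∀ ε > 0, y t ≤ Real.exp (∫ s in (0 : ℝ)..t, c s) *
      (y 0 + ε * ((∫ s in (0 : ℝ)..t, c s) + t)) := by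
    intro ε hε
    obtain ⟨δ, hδ, hloc⟩ := h ε hε
    -- Steps have length at most δ/2 because the local hypothesis wants a length strictly below δ.
    -- The exponential factors multiply and the ε-errors add along the steps.
    have chain : ∀ n : ℕ, ∀ a b, 0 ≤ a → a ≤ b → b ≤ t → b - a ≤ n * (δ / 2) →
        y b ≤ Real.exp (∫ s in a..b, c s) * (y a + ε * ((∫ s in a..b, c s) + (b - a))) := by
      intro n
      induction n with
      | zero =>
        intro a b h0 hab hb hd
        have : a = b := le_antisymm hab (by simpa using hd)
        subst this
        simp
      | succ n ih =>
        intro a b h0 hab hb hd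
        set m := max a (b - δ / 2) with hm
        have ham : a ≤ m := le_max_left _ _
        have hmb : m ≤ b := max_le hab (by linarith)
        have h1 := ih a m h0 ham (hmb.trans hb) (by
          push_cast at hd
          rcases max_cases a (b - δ / 2) with h | h
          · rw [hm, h.1, sub_self]; positivity
          · rw [hm, h.1]; linarith)
        have h2 := hloc m b (h0.trans ham) hmb hb (by
          have : b - δ / 2 ≤ m := le_max_right _ _
          linarith)
        have hadd := intervalIntegral.integral_add_adjacent_intervals
          (hint a m h0 ham (hmb.trans hb)) (hint m b (h0.trans ham) hmb hb)
        rw [← hadd]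
        set C1 := ∫ s in a..m, c s
        have hC1 : 0 ≤ C1 := hnn a m h0 ham (hmb.trans hb)
        set C2 := ∫ s in m..b, c s
        have hC2 : 0 ≤ C2 := hnn m b (h0.trans ham) hmb hb
        have hym : 0 ≤ y m := hy m ⟨h0.trans ham, hmb.trans hb⟩
        have hexp := Real.add_one_le_exp C2
        have hexp1 : 1 ≤ Real.exp C2 := Real.one_le_exp hC2
        have hexp2 : 1 ≤ Real.exp C1 := Real.one_le_exp hC1
        have h3 : y b ≤ Real.exp C2 * (y m + ε * (C2 + (b - m))) := by
          have e1 : y m * (C2 + 1) ≤ y m * Real.exp C2 := mul_le_mul_of_nonneg_left hexp hym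
          have e2 : 1 * (ε * (C2 + (b - m))) ≤ Real.exp C2 * (ε * (C2 + (b - m))) :=
            mul_le_mul_of_nonneg_right hexp1 (mul_nonneg hε.le (by linarith))
          linarith
        have h4 : y m + ε * (C2 + (b - m)) ≤
            Real.exp C1 * (y a + ε * ((C1 + C2) + (b - a))) := by
          have e2 : 1 * (ε * (C2 + (b - m))) ≤ Real.exp C1 * (ε * (C2 + (b - m))) :=
            mul_le_mul_of_nonneg_right hexp2 (mul_nonneg hε.le (by linarith))
          linarith
        calc y b ≤ _ := h3
          _ ≤ Real.exp C2 * (Real.exp C1 * (y a + ε * ((C1 + C2) + (b - a)))) :=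
            mul_le_mul_of_nonneg_left h4 (Real.exp_pos _).le
          _ = _ := by rw [Real.exp_add]; ring
    obtain ⟨n, hn⟩ := exists_nat_gt (t / (δ / 2))
    have := chain n 0 t le_rfl ht le_rfl (by
      rw [div_lt_iff₀ (by positivity)] at hn; linarith)
    simpa using this
  set C := ∫ s in (0 : ℝ)..t, c s
  have hC : 0 ≤ C := hnn 0 t le_rfl ht le_rfl
  refine le_of_forall_pos_le_add fun η hη => ?_
  have hp : 0 < Real.exp C * (C + t) + 1 := by positivity
  have h1 := key (η / (Real.exp C * (C + t) + 1)) (by positivity)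
  have h2 : η / (Real.exp C * (C + t) + 1) * (Real.exp C * (C + t)) ≤ η := by
    rw [div_mul_eq_mul_div, div_le_iff₀ hp]
    nlinarith
  linarith

end

/-! ### Insertion and contraction of one particle. -/

section

variable {n N : ℕ}

/-! ### Splitting off one particle -/

theorem inner_eq_integral {α : Type*} {_ : MeasurableSpace α} {μ : Measure α} (f g : Lp ℂ 2 μ) :
    inner ℂ f g = ∫ x, conj (f x) * g x ∂μ := by
  rw [L2.inner_def]
  simp only [RCLike.inner_apply, mul_comm]

theorem integrable_conj_mul {α : Type*} {_ : MeasurableSpace α} {μ : Measure α} (f g : Lp ℂ 2 μ) :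
    Integrable (fun x => conj (f x) * g x) μ := by
  have := L2.integrable_inner (𝕜 := ℂ) f g
  simpa only [RCLike.inner_apply, mul_comm] using this

theorem measurePreserving_split (m : Fin (n + 1)) :
    MeasurePreserving (fun x : Config (n + 1) => (x m, m.removeNth x))
      volume ((volume : Measure Space).prod (volume : Measure (Config n))) :=
  volume_preserving_piFinSuccAbove (fun _ => Space) m

theorem measurePreserving_insertNth (m : Fin (n + 1)) :
    MeasurePreserving (fun p : Space × Config n => (m.insertNth p.1 p.2 : Config (n + 1)))
      ((volume : Measure Space).prod (volume : Measure (Config n))) volume :=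
  (volume_preserving_piFinSuccAbove (fun _ => Space) m).symm

theorem measurableEmbedding_insertNth (m : Fin (n + 1)) :
    MeasurableEmbedding (fun p : Space × Config n => (m.insertNth p.1 p.2 : Config (n + 1))) :=
  (MeasurableEquiv.piFinSuccAbove (fun _ => Space) m).symm.measurableEmbedding

theorem integral_insertNth {F : Type*} [NormedAddCommGroup F] [NormedSpace ℝ F] (m : Fin (n + 1))
    (f : Config (n + 1) → F) :
    ∫ p : Space × Config n, f (m.insertNth p.1 p.2) ∂(volume.prod volume) = ∫ x, f x :=
  (measurePreserving_insertNth m).integral_comp (measurableEmbedding_insertNth m) f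

theorem integrable_insertNth_iff {F : Type*} [NormedAddCommGroup F] (m : Fin (n + 1))
    {f : Config (n + 1) → F} :
    Integrable (fun p : Space × Config n => f (m.insertNth p.1 p.2)) (volume.prod volume) ↔
      Integrable f :=
  (measurePreserving_insertNth m).integrable_comp_emb (measurableEmbedding_insertNth m)

theorem quasiMeasurePreserving_removeNth (m : Fin (n + 1)) :
    Measure.QuasiMeasurePreserving (fun x : Config (n + 1) => (m.removeNth x : Config n))
      volume volume :=
  Measure.quasiMeasurePreserving_snd.comp (measurePreserving_split m).quasiMeasurePreserving

theorem quasiMeasurePreserving_coord (m : Fin N) :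
    Measure.QuasiMeasurePreserving (fun x : Config N => x m) volume volume :=
  Measure.quasiMeasurePreserving_eval (fun _ : Fin N => (volume : Measure Space)) m

theorem memLp_insert (m : Fin (n + 1)) (f : OneParticle) (h : NParticle n) :
    MemLp (fun x : Config (n + 1) => f (x m) * h (m.removeNth x)) 2 volume := by
  have hm : AEStronglyMeasurable (fun x : Config (n + 1) => f (x m) * h (m.removeNth x)) volume :=
    ((Lp.aestronglyMeasurable f).comp_quasiMeasurePreserving (quasiMeasurePreserving_coord m)).mul
      ((Lp.aestronglyMeasurable h).comp_quasiMeasurePreserving (quasiMeasurePreserving_removeNth m))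
  rw [memLp_two_iff_integrable_sq_norm hm]
  have h1 := ((memLp_two_iff_integrable_sq_norm (Lp.aestronglyMeasurable f)).1 (Lp.memLp f)).mul_prod
    ((memLp_two_iff_integrable_sq_norm (Lp.aestronglyMeasurable h)).1 (Lp.memLp h))
  have := (measurePreserving_split m).integrable_comp_of_integrable h1
  simpa only [Function.comp_def, norm_mul, mul_pow] using this

theorem inner_toLp_insert (m : Fin (n + 1)) (f f' : OneParticle) (h h' : NParticle n) :
    inner ℂ ((memLp_insert m f h).toLp _) ((memLp_insert m f' h').toLp _) =
      inner ℂ f f' * inner ℂ h h' := by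
  have e : inner ℂ ((memLp_insert m f h).toLp _) ((memLp_insert m f' h').toLp _) =
      ∫ x : Config (n + 1), (conj (f (x m)) * f' (x m)) *
        (conj (h (m.removeNth x)) * h' (m.removeNth x)) := by
    rw [inner_eq_integral]
    refine integral_congr_ae ?_
    filter_upwards [(memLp_insert m f h).coeFn_toLp, (memLp_insert m f' h').coeFn_toLp] with x h1 h2
    rw [h1, h2, map_mul]
    ring
  rw [e, ← integral_insertNth m]
  simp only [Fin.insertNth_apply_same, Fin.removeNth_insertNth]
  rw [integral_prod_mul (fun y => conj (f y) * f' y) fun x => conj (h x) * h' x,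
    inner_eq_integral, inner_eq_integral]

/-- `f, h ↦ f(x_m) h(x without x_m)`. -/
def insertL (m : Fin (n + 1)) : OneParticle →L[ℂ] NParticle n →L[ℂ] NParticle (n + 1) :=
  LinearMap.mkContinuous₂ (LinearMap.mk₂ ℂ (fun f h => (memLp_insert m f h).toLp _)
    (fun f f' h => by
      rw [← MemLp.toLp_add]
      refine MemLp.toLp_congr _ _ ?_
      filter_upwards [(quasiMeasurePreserving_coord m).ae (Lp.coeFn_add f f')] with x hx
      rw [hx, Pi.add_apply, Pi.add_apply, add_mul])
    (fun c f h => by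
      rw [← MemLp.toLp_const_smul]
      refine MemLp.toLp_congr _ _ ?_
      filter_upwards [(quasiMeasurePreserving_coord m).ae (Lp.coeFn_smul c f)] with x hx
      rw [hx, Pi.smul_apply, Pi.smul_apply, smul_eq_mul, smul_eq_mul, mul_assoc])
    (fun f h h' => by
      rw [← MemLp.toLp_add]
      refine MemLp.toLp_congr _ _ ?_
      filter_upwards [(quasiMeasurePreserving_removeNth m).ae (Lp.coeFn_add h h')] with x hx
      rw [hx, Pi.add_apply, Pi.add_apply, mul_add])
    (fun c f h => by
      rw [← MemLp.toLp_const_smul]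
      refine MemLp.toLp_congr _ _ ?_
      filter_upwards [(quasiMeasurePreserving_removeNth m).ae (Lp.coeFn_smul c h)] with x hx
      rw [hx, Pi.smul_apply, Pi.smul_apply, smul_eq_mul, smul_eq_mul, mul_left_comm])) 1
    (fun f h => by
      rw [one_mul]
      apply le_of_sq_le_sq _ (by positivity)
      have := congrArg Complex.re (inner_toLp_insert m f f h h)
      rw [inner_self_eq_norm_sq_to_K, inner_self_eq_norm_sq_to_K, inner_self_eq_norm_sq_to_K] at this
      norm_cast at this
      rw [mul_pow]
      exact this.le)

theorem coeFn_insertL (m : Fin (n + 1)) (f : OneParticle) (h : NParticle n) :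
    insertL m f h =ᵐ[volume] fun x => f (x m) * h (m.removeNth x) :=
  (memLp_insert m f h).coeFn_toLp

theorem inner_insertL (m : Fin (n + 1)) (f f' : OneParticle) (h h' : NParticle n) :
    inner ℂ (insertL m f h) (insertL m f' h') = inner ℂ f f' * inner ℂ h h' :=
  inner_toLp_insert m f f' h h'

theorem norm_insertL (m : Fin (n + 1)) (f : OneParticle) (h : NParticle n) :
    ‖insertL m f h‖ = ‖f‖ * ‖h‖ := by
  have := congrArg Complex.re (inner_insertL m f f h h)
  rw [inner_self_eq_norm_sq_to_K, inner_self_eq_norm_sq_to_K, inner_self_eq_norm_sq_to_K] at this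
  norm_cast at this
  rw [← mul_pow] at this
  exact (sq_eq_sq₀ (norm_nonneg _) (by positivity)).1 this

/-- `(partialInner m f ψ)(x without x_m) = ∫ f(x_m)* ψ(x) dx_m`. -/
def partialInner (m : Fin (n + 1)) (f : OneParticle) : NParticle (n + 1) →L[ℂ] NParticle n :=
  (insertL m f).adjoint

theorem inner_partialInner_right (m : Fin (n + 1)) (f : OneParticle) (h : NParticle n)
    (ψ : NParticle (n + 1)) : inner ℂ h (partialInner m f ψ) = inner ℂ (insertL m f h) ψ :=
  ContinuousLinearMap.adjoint_inner_right _ _ _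

theorem inner_partialInner_left (m : Fin (n + 1)) (f : OneParticle) (h : NParticle n)
    (ψ : NParticle (n + 1)) : inner ℂ (partialInner m f ψ) h = inner ℂ ψ (insertL m f h) :=
  ContinuousLinearMap.adjoint_inner_left _ _ _

theorem partialInner_insertL (m : Fin (n + 1)) (f g : OneParticle) (h : NParticle n) :
    partialInner m f (insertL m g h) = inner ℂ f g • h := by
  refine ext_inner_left ℂ fun k => ?_
  rw [inner_partialInner_right, inner_insertL, inner_smul_right]

theorem norm_partialInner_le (m : Fin (n + 1)) (f : OneParticle) (ψ : NParticle (n + 1)) :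
    ‖partialInner m f ψ‖ ≤ ‖f‖ * ‖ψ‖ := by
  have h : ‖partialInner m f‖ ≤ ‖f‖ := by
    rw [partialInner, LinearIsometryEquiv.norm_map]
    exact ContinuousLinearMap.opNorm_le_bound _ (norm_nonneg _) fun h => (norm_insertL m f h).le
  exact (partialInner m f).le_of_opNorm_le h ψ

theorem partialInner_sub (m : Fin (n + 1)) (f g : OneParticle) (ψ : NParticle (n + 1)) :
    partialInner m (f - g) ψ = partialInner m f ψ - partialInner m g ψ := by
  simp [partialInner]

theorem partialInner_smul (m : Fin (n + 1)) (c : ℂ) (f : OneParticle) (ψ : NParticle (n + 1)) :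
    partialInner m (c • f) ψ = conj c • partialInner m f ψ := by
  refine ext_inner_left ℂ fun h => ?_
  rw [inner_smul_right, inner_partialInner_right, inner_partialInner_right, map_smul,
    smul_apply, inner_smul_left]

theorem partialInner_sum {ι : Type*} (s : Finset ι) (m : Fin (n + 1)) (f : ι → OneParticle)
    (ψ : NParticle (n + 1)) :
    partialInner m (∑ i ∈ s, f i) ψ = ∑ i ∈ s, partialInner m (f i) ψ := by
  simp [partialInner]

theorem integrable_insertNth_inner (m : Fin (n + 1)) (f : OneParticle) (h : NParticle n)
    (ψ : NParticle (n + 1)) :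
    Integrable (fun p : Space × Config n =>
      conj (f p.1) * conj (h p.2) * ψ (m.insertNth p.1 p.2)) (volume.prod volume) := by
  have h1 : Integrable (fun x : Config (n + 1) =>
      conj (f (x m)) * conj (h (m.removeNth x)) * ψ x) := by
    refine (integrable_conj_mul (insertL m f h) ψ).congr ?_
    filter_upwards [coeFn_insertL m f h] with x hx
    rw [hx, map_mul]
  simpa using (integrable_insertNth_iff m).2 h1

theorem inner_insertL_left (m : Fin (n + 1)) (f : OneParticle) (h : NParticle n)
    (ψ : NParticle (n + 1)) :
    inner ℂ (insertL m f h) ψ =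
      ∫ x, conj (h x) * ∫ y, conj (f y) * ψ (m.insertNth y x) := by
  have e : inner ℂ (insertL m f h) ψ =
      ∫ x : Config (n + 1), conj (f (x m)) * conj (h (m.removeNth x)) * ψ x := by
    rw [inner_eq_integral]
    refine integral_congr_ae ?_
    filter_upwards [coeFn_insertL m f h] with x hx
    rw [hx, map_mul]
  rw [e, ← integral_insertNth m]
  simp only [Fin.insertNth_apply_same, Fin.removeNth_insertNth]
  rw [integral_prod_symm _ (integrable_insertNth_inner m f h ψ)]
  refine integral_congr_ae (Eventually.of_forall fun x => ?_)
  simp only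
  rw [← integral_const_mul]
  refine integral_congr_ae (Eventually.of_forall fun y => ?_)
  simp only
  ring

/-- Defined as an adjoint, the contraction is identified with the pointwise integral by pairing with
indicators of sets of finite measure, since functions with equal integrals over all such sets agree
almost everywhere. -/
theorem coeFn_partialInner (m : Fin (n + 1)) (f : OneParticle) (ψ : NParticle (n + 1)) :
    partialInner m f ψ =ᵐ[volume] fun x => ∫ y, conj (f y) * ψ (m.insertNth y x) := by
  have hind : ∀ (s : Set (Config n)) (hs : MeasurableSet s) (hμ : volume s < ⊤),
      (fun x => conj ((indicatorConstLp 2 hs hμ.ne (1 : ℂ)) x) *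
        ∫ y, conj (f y) * ψ (m.insertNth y x)) =ᵐ[volume]
        s.indicator fun x => ∫ y, conj (f y) * ψ (m.insertNth y x) := by
    intro s hs hμ
    filter_upwards [indicatorConstLp_coeFn (p := 2) (hs := hs) (hμs := hμ.ne) (c := (1 : ℂ))]
      with x hx
    rw [hx]
    by_cases h : x ∈ s <;> simp [h]
  refine ae_eq_of_forall_setIntegral_eq_of_sigmaFinite (fun s hs hμ => ?_) (fun s hs hμ => ?_)
    fun s hs hμ => ?_
  · exact integrableOn_Lp_of_measure_ne_top _ one_le_two hμ.ne
  · rw [← integrable_indicator_iff hs]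
    refine Integrable.congr ?_ (hind s hs hμ)
    refine (integrable_insertNth_inner m f (indicatorConstLp 2 hs hμ.ne (1 : ℂ)) ψ).integral_prod_right.congr ?_
    refine Eventually.of_forall fun x => ?_
    simp only
    rw [← integral_const_mul]
    refine integral_congr_ae (Eventually.of_forall fun y => ?_)
    simp only
    ring
  · rw [← L2.inner_indicatorConstLp_one hs hμ.ne, inner_partialInner_right, inner_insertL_left,
      ← integral_indicator hs]
    exact integral_congr_ae (hind s hs hμ)

end

/-! ### Product vectors, operators on one particle, and permutations. -/

section

variable {n N : ℕ}

/-! ### Product vectors -/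

theorem coeFn_tensor (u : Fin N → OneParticle) :
    tensor u =ᵐ[volume] fun x => ∏ i, u i (x i) := (memLp_prod u).coeFn_toLp

theorem insertL_tensor (m : Fin (n + 1)) (f : OneParticle) (u : Fin n → OneParticle) :
    insertL m f (tensor u) = tensor (m.insertNth f u) := by
  refine Lp.ext ?_
  filter_upwards [coeFn_insertL m f (tensor u), coeFn_tensor (m.insertNth f u),
    (quasiMeasurePreserving_removeNth m).ae (coeFn_tensor u)] with x h1 h2 h3
  rw [h1, h2, h3, Fin.prod_univ_succAbove _ m]
  simp [Fin.removeNth]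

theorem tensor_eq_insertL (m : Fin (n + 1)) (u : Fin (n + 1) → OneParticle) :
    tensor u = insertL m (u m) (tensor (m.removeNth u)) := by
  rw [insertL_tensor, Fin.insertNth_self_removeNth]

theorem partialInner_tensor (m : Fin (n + 1)) (f : OneParticle) (u : Fin (n + 1) → OneParticle) :
    partialInner m f (tensor u) = inner ℂ f (u m) • tensor (m.removeNth u) := by
  rw [tensor_eq_insertL m u, partialInner_insertL]

theorem continuous_tensor : Continuous (tensor : (Fin N → OneParticle) → NParticle N) := by
  induction N with
  | zero => exact continuous_of_const fun x y => by rw [Subsingleton.elim x y]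
  | succ n ih =>
    have : (tensor : (Fin (n + 1) → OneParticle) → NParticle (n + 1)) =
        fun u => insertL 0 (u 0) (tensor ((0 : Fin (n + 1)).removeNth u)) :=
      funext fun u => tensor_eq_insertL 0 u
    rw [this]
    refine ((insertL 0).continuous.comp (continuous_apply 0)).clm_apply (ih.comp ?_)
    exact continuous_pi fun i => continuous_apply _

theorem inner_tensor (u w : Fin N → OneParticle) :
    inner ℂ (tensor u) (tensor w) = ∏ i, inner ℂ (u i) (w i) := by
  induction N with
  | zero =>
    rw [inner_eq_integral]
    have : ∀ᵐ x : Config 0, conj (tensor u x) * tensor w x = 1 := by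
      filter_upwards [coeFn_tensor u, coeFn_tensor w] with x h1 h2
      rw [h1, h2]; simp
    rw [integral_congr_ae this]
    simp [Measure.real, volume_pi]
  | succ n ih =>
    rw [tensor_eq_insertL 0, tensor_eq_insertL 0 w, inner_insertL, ih, Fin.prod_univ_succ]
    rfl

/-- Indicators of bounded boxes are product vectors, so w integrates to zero over every box inside
the bounded set `B k`. The π-λ theorem extends this to all measurable subsets, and the sets `B k`
exhaust the space. -/
theorem eq_zero_of_forall_inner_tensor {w : NParticle N}
    (h : ∀ u : Fin N → OneParticle, inner ℂ (tensor u) w = 0) : w = 0 := by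
  let B : ℕ → Set (Config N) := fun k => univ.pi fun _ => Metric.closedBall 0 k
  have hB : ∀ k, MeasurableSet (B k) := fun k =>
    MeasurableSet.univ_pi fun _ => Metric.isClosed_closedBall.measurableSet
  have hBfin : ∀ k, volume (B k) ≠ ⊤ := fun k => by
    rw [volume_pi_pi]
    exact (ENNReal.prod_lt_top fun i _ => measure_closedBall_lt_top).ne
  have hbox : ∀ (k : ℕ) (s : Fin N → Set Space), (∀ i, MeasurableSet (s i)) →
      ∫ x in (univ.pi s) ∩ B k, w x = 0 := by
    intro k s hs
    have hs' : ∀ i, MeasurableSet (s i ∩ Metric.closedBall 0 k) := fun i =>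
      (hs i).inter Metric.isClosed_closedBall.measurableSet
    have hfin : ∀ i, volume (s i ∩ Metric.closedBall (0 : Space) k) ≠ ⊤ := fun i =>
      ((measure_mono inter_subset_right).trans_lt measure_closedBall_lt_top).ne
    have := h fun i => indicatorConstLp 2 (hs' i) (hfin i) 1
    rw [inner_eq_integral] at this
    rw [← integral_indicator ((MeasurableSet.univ_pi hs).inter (hB k)), ← this]
    refine integral_congr_ae ?_
    have hcoord : ∀ i : Fin N, ∀ᵐ x : Config N,
        (indicatorConstLp 2 (hs' i) (hfin i) (1 : ℂ)) (x i) =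
          (s i ∩ Metric.closedBall 0 k).indicator (fun _ => 1) (x i) := fun i =>
      (quasiMeasurePreserving_coord i).ae indicatorConstLp_coeFn
    filter_upwards [coeFn_tensor fun i => indicatorConstLp 2 (hs' i) (hfin i) (1 : ℂ),
      ae_all_iff.2 hcoord] with x h1 h2
    rw [h1]
    simp only [h2]
    by_cases hx : x ∈ univ.pi s ∩ B k
    · rw [indicator_of_mem hx, Finset.prod_eq_one, map_one, one_mul]
      intro i _
      exact indicator_of_mem (show x i ∈ s i ∩ Metric.closedBall 0 (k : ℝ) from
        ⟨hx.1 i trivial, hx.2 i trivial⟩) _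
    · rw [indicator_of_notMem hx]
      have : ∃ i, x i ∉ s i ∩ Metric.closedBall 0 k := by
        by_contra! hc
        exact hx ⟨fun i _ => (hc i).1, fun i _ => (hc i).2⟩
      obtain ⟨i, hi⟩ := this
      rw [Finset.prod_eq_zero (Finset.mem_univ i) (indicator_of_notMem hi _), map_zero, zero_mul]
  have hall : ∀ (k : ℕ) (s : Set (Config N)), MeasurableSet s → ∫ x in s ∩ B k, w x = 0 := by
    intro k
    have hint : ∀ s, IntegrableOn w (s ∩ B k) := fun s =>
      (integrableOn_Lp_of_measure_ne_top w one_le_two (hBfin k)).mono_set inter_subset_right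
    refine MeasurableSpace.induction_on_inter generateFrom_pi.symm isPiSystem_pi ?_ ?_ ?_ ?_
    · simp
    · rintro _ ⟨s, hs, rfl⟩
      exact hbox k s fun i => hs i trivial
    · intro s hs h0
      have hu := hbox k (fun _ => univ) fun _ => MeasurableSet.univ
      rw [pi_univ, ← union_compl_self s, union_inter_distrib_right, setIntegral_union
        ((disjoint_compl_right (a := s)).mono inter_subset_left inter_subset_left)
        (hs.compl.inter (hB k)) (hint _) (hint _), h0, zero_add] at hu
      exact hu
    · intro f hd hm h0
      rw [iUnion_inter]
      have := hasSum_integral_iUnion (f := fun x => w x) (μ := volume) (fun i => (hm i).inter (hB k))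
        (fun i j hij => (hd hij).mono inter_subset_left inter_subset_left)
        (by rw [← iUnion_inter]; exact hint _)
      simp only [h0] at this
      exact this.unique hasSum_zero
  have hae : ∀ k, ∀ᵐ x ∂(volume.restrict (B k)), w x = 0 := fun k => by
    refine Integrable.ae_eq_zero_of_forall_setIntegral_eq_zero
      (integrableOn_Lp_of_measure_ne_top w one_le_two (hBfin k)) fun s hs _ => ?_
    rw [Measure.restrict_restrict hs]
    exact hall k s hs
  have hun : ⋃ k, B k = univ := by
    refine eq_univ_of_forall fun x => ?_
    obtain ⟨k, hk⟩ := exists_nat_ge ‖x‖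
    refine mem_iUnion.2 ⟨k, fun i _ => ?_⟩
    rw [mem_closedBall_zero_iff]
    exact (norm_le_pi_norm x i).trans hk
  have := (ae_restrict_iUnion_iff B fun x => w x = 0).2 hae
  rw [hun, Measure.restrict_univ] at this
  refine Lp.ext ?_
  filter_upwards [this, Lp.coeFn_zero ℂ 2 (volume : Measure (Config N))] with x h1 h2
  rw [h1, h2, Pi.zero_apply]

/-- Orthogonality to the products of vectors from D passes to all product vectors because `tensor`
is continuous. The domain of H^0 is the D that matters later. -/
theorem dense_span_tensor_of_dense {D : Set OneParticle} (hD : Dense D) :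
    Dense (Submodule.span ℂ (tensor '' {u : Fin N → OneParticle | ∀ i, u i ∈ D}) :
      Set (NParticle N)) := by
  rw [Submodule.dense_iff_topologicalClosure_eq_top, Submodule.topologicalClosure_eq_top_iff,
    Submodule.eq_bot_iff]
  intro w hw
  rw [Submodule.mem_orthogonal] at hw
  refine eq_zero_of_forall_inner_tensor fun u => ?_
  have hd : Dense {u : Fin N → OneParticle | ∀ i, u i ∈ D} := by
    have := dense_pi (s := fun _ : Fin N => D) univ fun _ _ => hD
    simpa [Set.pi] using this
  have hcl : IsClosed {u : Fin N → OneParticle | inner ℂ (tensor u) w = 0} :=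
    isClosed_eq (continuous_tensor.inner continuous_const) continuous_const
  have := hcl.closure_subset_iff.2 (fun u hu => hw _ (Submodule.subset_span ⟨u, hu, rfl⟩))
  exact this (hd u)

/-- Bounded operators which agree on product vectors are equal. -/
theorem ext_tensor {F : Type*} [NormedAddCommGroup F] [NormedSpace ℂ F] {S S' : NParticle N →L[ℂ] F}
    (h : ∀ u, S (tensor u) = S' (tensor u)) : S = S' := by
  refine ContinuousLinearMap.ext_on (dense_span_tensor_of_dense (dense_univ)) ?_
  rintro _ ⟨u, -, rfl⟩
  exact h u

/-! ### Rank-one operators in one variable -/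

/-- `|f⟩⟨g|` acting on the particle `m`. -/
def rankOneAt (m : Fin (n + 1)) (f g : OneParticle) : NParticle (n + 1) →L[ℂ] NParticle (n + 1) :=
  (insertL m f).comp (partialInner m g)

theorem rankOneAt_apply (m : Fin (n + 1)) (f g : OneParticle) (ψ : NParticle (n + 1)) :
    rankOneAt m f g ψ = insertL m f (partialInner m g ψ) := rfl

theorem rankOneAt_tensor (m : Fin (n + 1)) (f g : OneParticle) (u : Fin (n + 1) → OneParticle) :
    rankOneAt m f g (tensor u) = inner ℂ g (u m) • tensor (Function.update u m f) := by
  rw [rankOneAt_apply, partialInner_tensor, map_smul, insertL_tensor, Fin.insertNth_removeNth]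

theorem inner_rankOneAt (m : Fin (n + 1)) (f g : OneParticle) (ψ χ : NParticle (n + 1)) :
    inner ℂ (rankOneAt m f g ψ) χ = inner ℂ ψ (rankOneAt m g f χ) := by
  rw [rankOneAt_apply, rankOneAt_apply, ← inner_partialInner_right, ← inner_partialInner_left]

theorem inner_rankOneAt_right (m : Fin (n + 1)) (f g : OneParticle) (ψ χ : NParticle (n + 1)) :
    inner ℂ ψ (rankOneAt m f g χ) = inner ℂ (partialInner m f ψ) (partialInner m g χ) := by
  rw [rankOneAt_apply, ← inner_partialInner_left]

theorem rankOneAt_rankOneAt (m : Fin (n + 1)) (f g h k : OneParticle) (ψ : NParticle (n + 1)) :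
    rankOneAt m f g (rankOneAt m h k ψ) = inner ℂ g h • rankOneAt m f k ψ := by
  rw [rankOneAt_apply, rankOneAt_apply, partialInner_insertL, map_smul]
  rfl

theorem rankOneAt_comm {m m' : Fin (n + 1)} (hm : m ≠ m') (f g h k : OneParticle)
    (ψ : NParticle (n + 1)) :
    rankOneAt m f g (rankOneAt m' h k ψ) = rankOneAt m' h k (rankOneAt m f g ψ) := by
  have : (rankOneAt m f g).comp (rankOneAt m' h k) = (rankOneAt m' h k).comp (rankOneAt m f g) := by
    refine ext_tensor fun u => ?_
    simp only [ContinuousLinearMap.comp_apply, rankOneAt_tensor, map_smul,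
      Function.update_of_ne hm, Function.update_of_ne hm.symm, Function.update_comm hm]
    rw [smul_comm]
  exact DFunLike.congr_fun this ψ

/-! ### Permutations of the particles -/

theorem measurePreserving_comp_perm (σ : Equiv.Perm (Fin N)) :
    MeasurePreserving (fun x : Config N => x ∘ σ) volume volume := by
  have := volume_measurePreserving_piCongrLeft (fun _ : Fin N => Space) σ.symm
  convert! this using 1
  ext x i
  simp [MeasurableEquiv.piCongrLeft, Equiv.piCongrLeft, Equiv.piCongrLeft']

/-- `(permL σ ψ)(x) = ψ(x ∘ σ)`. -/
def permL (σ : Equiv.Perm (Fin N)) : NParticle N →ₗᵢ[ℂ] NParticle N :=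
  Lp.compMeasurePreservingₗᵢ ℂ (fun x : Config N => x ∘ σ) (measurePreserving_comp_perm σ)

theorem coeFn_permL (σ : Equiv.Perm (Fin N)) (ψ : NParticle N) :
    permL σ ψ =ᵐ[volume] fun x => ψ (x ∘ σ) :=
  Lp.coeFn_compMeasurePreserving ψ (measurePreserving_comp_perm σ)

theorem permL_tensor (σ : Equiv.Perm (Fin N)) (u : Fin N → OneParticle) :
    permL σ (tensor u) = tensor (u ∘ σ.symm) := by
  refine Lp.ext ?_
  filter_upwards [coeFn_permL σ (tensor u), coeFn_tensor (u ∘ σ.symm),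
    (measurePreserving_comp_perm σ).quasiMeasurePreserving.ae (coeFn_tensor u)] with x h1 h2 h3
  rw [h1, h2, h3]
  conv_rhs => rw [← Equiv.prod_comp σ]
  simp

theorem permL_mul (σ τ : Equiv.Perm (Fin N)) (ψ : NParticle N) :
    permL (σ * τ) ψ = permL σ (permL τ ψ) := by
  refine Lp.ext ?_
  filter_upwards [coeFn_permL (σ * τ) ψ, coeFn_permL σ (permL τ ψ),
    (measurePreserving_comp_perm σ).quasiMeasurePreserving.ae (coeFn_permL τ ψ)] with x h1 h2 h3
  rw [h1, h2, h3]
  rfl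

theorem permL_one (ψ : NParticle N) : permL 1 ψ = ψ := by
  refine Lp.ext ?_
  filter_upwards [coeFn_permL 1 ψ] with x h1
  rw [h1]
  rfl

theorem isAntisymmetric_iff {ψ : NParticle N} :
    IsAntisymmetric ψ ↔ ∀ j k : Fin N, j ≠ k → permL (Equiv.swap j k) ψ = -ψ := by
  refine forall₃_congr fun j k _ => ⟨fun h => Lp.ext ?_, fun h => ?_⟩
  · filter_upwards [h, coeFn_permL (Equiv.swap j k) ψ, Lp.coeFn_neg ψ] with x h1 h2 h3
    rw [h2, h1, h3, Pi.neg_apply]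
  · have h' := coeFn_permL (Equiv.swap j k) ψ
    rw [h] at h'
    filter_upwards [h', Lp.coeFn_neg ψ] with x h2 h3
    rw [← h2, h3, Pi.neg_apply]

theorem permL_eq_sign_smul {ψ : NParticle N} (h : IsAntisymmetric ψ) (σ : Equiv.Perm (Fin N)) :
    permL σ ψ = ((Equiv.Perm.sign σ : ℤ) : ℂ) • ψ := by
  rw [isAntisymmetric_iff] at h
  induction σ using Equiv.Perm.swap_induction_on with
  | one => simp [permL_one]
  | swap_mul σ j k hjk ih =>
    rw [permL_mul, ih, map_smul, h j k hjk, Equiv.Perm.sign_mul, Equiv.Perm.sign_swap hjk]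
    simp

theorem permL_rankOneAt (j k : Fin (n + 1)) (m : Fin (n + 1)) (f g : OneParticle)
    (ψ : NParticle (n + 1)) :
    permL (Equiv.swap j k) (rankOneAt m f g ψ) =
      rankOneAt (Equiv.swap j k m) f g (permL (Equiv.swap j k) ψ) := by
  have : (permL (Equiv.swap j k)).toContinuousLinearMap.comp (rankOneAt m f g) =
      (rankOneAt (Equiv.swap j k m) f g).comp (permL (Equiv.swap j k)).toContinuousLinearMap := by
    refine ext_tensor fun u => ?_
    simp only [ContinuousLinearMap.comp_apply, LinearIsometry.coe_toContinuousLinearMap,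
      rankOneAt_tensor, map_smul, permL_tensor, Equiv.symm_swap, Function.comp_apply,
      Equiv.swap_apply_self]
    congr 2
    rw [← Equiv.symm_swap, Function.update_comp_equiv]
    simp
  exact DFunLike.congr_fun this ψ

/-- The exclusion principle: an orbital can only be occupied by one particle. -/
theorem rankOneAt_rankOneAt_of_isAntisymmetric {ψ : NParticle (n + 1)} (h : IsAntisymmetric ψ)
    {j k : Fin (n + 1)} (hjk : j ≠ k) (g : OneParticle) :
    rankOneAt j g g (rankOneAt k g g ψ) = 0 := by
  -- Both slots are overwritten by g and the scalar ⟨g, u_j⟩⟨g, u_k⟩ is symmetric, so exchanging j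
  -- and k beforehand changes nothing. On an antisymmetric vector the result then equals its own
  -- negative.
  have h1 : ((rankOneAt j g g).comp (rankOneAt k g g)).comp
      (permL (Equiv.swap j k)).toContinuousLinearMap = (rankOneAt j g g).comp (rankOneAt k g g) := by
    refine ext_tensor fun u => ?_
    simp only [ContinuousLinearMap.comp_apply, LinearIsometry.coe_toContinuousLinearMap,
      rankOneAt_tensor, map_smul, permL_tensor, Equiv.symm_swap, Function.comp_apply,
      Function.update_of_ne hjk, Equiv.swap_apply_left, Equiv.swap_apply_right]
    rw [smul_comm]
    congr 3
    funext i
    by_cases hi : i = j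
    · subst hi; simp
    · by_cases hi' : i = k
      · subst hi'; simp [Function.update_of_ne hi]
      · simp [Function.update_of_ne hi, Function.update_of_ne hi', Equiv.swap_apply_of_ne_of_ne hi hi']
  have h2 := DFunLike.congr_fun h1 ψ
  simp only [ContinuousLinearMap.comp_apply, LinearIsometry.coe_toContinuousLinearMap,
    isAntisymmetric_iff.1 h j k hjk, map_neg] at h2
  have h3 : (2 : ℂ) • rankOneAt j g g (rankOneAt k g g ψ) = 0 := by
    rw [two_smul]
    nth_rewrite 1 [← h2]
    exact neg_add_cancel _
  exact (smul_eq_zero.1 h3).resolve_left two_ne_zero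

end

/-! ### The projections as bounded operators and the counting functional. -/

section

variable {n N : ℕ}

/-! ### Bounded multiplication operators -/

/-- Bounded measurable functions. -/
def IsBddMeas {α : Type*} [MeasurableSpace α] (F : α → ℝ) : Prop :=
  Measurable F ∧ ∃ C, ∀ x, |F x| ≤ C

theorem IsBddMeas.comp {α β : Type*} [MeasurableSpace α] [MeasurableSpace β] {F : β → ℝ}
    (hF : IsBddMeas F) {f : α → β} (hf : Measurable f) : IsBddMeas fun x => F (f x) :=
  ⟨hF.1.comp hf, hF.2.imp fun _ h x => h (f x)⟩

theorem IsBddMeas.mul {α : Type*} [MeasurableSpace α] {F G : α → ℝ} (hF : IsBddMeas F)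
    (hG : IsBddMeas G) : IsBddMeas fun x => F x * G x := by
  obtain ⟨C, hC⟩ := hF.2
  obtain ⟨C', hC'⟩ := hG.2
  refine ⟨hF.1.mul hG.1, C * C', fun x => ?_⟩
  rw [abs_mul]
  exact mul_le_mul (hC x) (hC' x) (abs_nonneg _) ((abs_nonneg _).trans (hC x))

variable {F G : Config N → ℝ}

theorem memLp_mul_of_isBddMeas (hF : IsBddMeas F) (ψ : NParticle N) :
    MemLp (fun x => (F x : ℂ) * ψ x) 2 volume := by
  obtain ⟨hm, C, hC⟩ := hF
  refine (Lp.memLp ψ).of_le_mul (c := C)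
    ((Complex.measurable_ofReal.comp hm).aestronglyMeasurable.mul (Lp.aestronglyMeasurable ψ)) ?_
  refine Eventually.of_forall fun x => ?_
  rw [norm_mul, Complex.norm_real]
  exact mul_le_mul_of_nonneg_right (hC x) (norm_nonneg _)

/-- Multiplication by a bounded real function. -/
def mulL (F : Config N → ℝ) (hF : IsBddMeas F) : NParticle N →L[ℂ] NParticle N :=
  LinearMap.mkContinuousOfExistsBound
    { toFun := fun ψ => (memLp_mul_of_isBddMeas hF ψ).toLp _
      map_add' := fun a b => by
        rw [← MemLp.toLp_add]
        refine MemLp.toLp_congr _ _ ?_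
        filter_upwards [Lp.coeFn_add a b] with x hx
        rw [hx, Pi.add_apply, Pi.add_apply, mul_add]
      map_smul' := fun c a => by
        rw [RingHom.id_apply, ← MemLp.toLp_const_smul]
        refine MemLp.toLp_congr _ _ ?_
        filter_upwards [Lp.coeFn_smul c a] with x hx
        rw [hx, Pi.smul_apply, Pi.smul_apply, smul_eq_mul, smul_eq_mul, mul_left_comm] }
    (by
      obtain ⟨C, hC⟩ := hF.2
      refine ⟨C, fun ψ => Lp.norm_le_mul_norm_of_ae_le_mul ?_⟩
      filter_upwards [(memLp_mul_of_isBddMeas hF ψ).coeFn_toLp] with x hx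
      refine (congrArg norm hx).trans_le ?_
      rw [norm_mul, Complex.norm_real]
      exact mul_le_mul_of_nonneg_right (hC x) (norm_nonneg _))

theorem coeFn_mulL (hF : IsBddMeas F) (ψ : NParticle N) :
    mulL F hF ψ =ᵐ[volume] fun x => (F x : ℂ) * ψ x :=
  (memLp_mul_of_isBddMeas hF ψ).coeFn_toLp

theorem inner_mulL_right (hF : IsBddMeas F) (ψ χ : NParticle N) :
    inner ℂ ψ (mulL F hF χ) = ∫ x, (F x : ℂ) * (conj (ψ x) * χ x) := by
  rw [inner_eq_integral]
  refine integral_congr_ae ?_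
  filter_upwards [coeFn_mulL hF χ] with x hx
  rw [hx]
  ring

theorem inner_mulL_left (hF : IsBddMeas F) (ψ χ : NParticle N) :
    inner ℂ (mulL F hF ψ) χ = inner ℂ ψ (mulL F hF χ) := by
  rw [inner_mulL_right, inner_eq_integral]
  refine integral_congr_ae ?_
  filter_upwards [coeFn_mulL hF ψ] with x hx
  rw [hx, map_mul, Complex.conj_ofReal]
  ring

theorem mulL_mulL (hF : IsBddMeas F) (hG : IsBddMeas G) (ψ : NParticle N) :
    mulL F hF (mulL G hG ψ) = mulL (fun x => F x * G x) (hF.mul hG) ψ := by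
  refine Lp.ext ?_
  filter_upwards [coeFn_mulL hF (mulL G hG ψ), coeFn_mulL hG ψ, coeFn_mulL (hF.mul hG) ψ]
    with x h1 h2 h3
  rw [h1, h2, h3]
  push_cast
  ring

theorem norm_sq_eq_integral {α : Type*} {_ : MeasurableSpace α} {μ : Measure α} (f : Lp ℂ 2 μ) :
    ‖f‖ ^ 2 = ∫ x, ‖f x‖ ^ 2 ∂μ := by
  have h : ((‖f‖ ^ 2 : ℝ) : ℂ) = ((∫ x, ‖f x‖ ^ 2 ∂μ : ℝ) : ℂ) := by
    have := inner_eq_integral f f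
    rw [inner_self_eq_norm_sq_to_K] at this
    refine (Complex.ofReal_pow _ _).trans (this.trans ?_)
    refine Eq.trans ?_ integral_ofReal
    refine integral_congr_ae (Eventually.of_forall fun x => ?_)
    simp only
    rw [← Complex.normSq_eq_conj_mul_self, Complex.normSq_eq_norm_sq]
    rfl
  exact_mod_cast h

theorem integrable_norm_sq {α : Type*} {_ : MeasurableSpace α} {μ : Measure α} (f : Lp ℂ 2 μ) :
    Integrable (fun x => ‖f x‖ ^ 2) μ :=
  (memLp_two_iff_integrable_sq_norm (Lp.aestronglyMeasurable f)).1 (Lp.memLp f)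

theorem permL_mulL (hF : IsBddMeas F) (hG : IsBddMeas G) (σ : Equiv.Perm (Fin N))
    (h : ∀ x, F (x ∘ σ) = G x) (ψ : NParticle N) :
    permL σ (mulL F hF ψ) = mulL G hG (permL σ ψ) := by
  refine Lp.ext ?_
  filter_upwards [coeFn_permL σ (mulL F hF ψ), coeFn_permL σ ψ, coeFn_mulL hG (permL σ ψ),
    (measurePreserving_comp_perm σ).quasiMeasurePreserving.ae (coeFn_mulL hF ψ)] with x h1 h2 h3 h4
  rw [h1, h3, h2, h4, h]

theorem mulL_insertL {F : Config (n + 1) → ℝ} {G : Config n → ℝ} (hF : IsBddMeas F)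
    (hG : IsBddMeas G) (m : Fin (n + 1)) (h : ∀ x, F x = G (m.removeNth x)) (f : OneParticle)
    (k : NParticle n) : mulL F hF (insertL m f k) = insertL m f (mulL G hG k) := by
  refine Lp.ext ?_
  filter_upwards [coeFn_mulL hF (insertL m f k), coeFn_insertL m f k,
    coeFn_insertL m f (mulL G hG k), (quasiMeasurePreserving_removeNth m).ae (coeFn_mulL hG k)]
    with x h1 h2 h3 h4
  rw [h1, h2, h3, h4, h]
  ring

theorem mulL_partialInner {F : Config (n + 1) → ℝ} {G : Config n → ℝ} (hF : IsBddMeas F)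
    (hG : IsBddMeas G) (m : Fin (n + 1)) (h : ∀ x, F x = G (m.removeNth x)) (f : OneParticle)
    (ψ : NParticle (n + 1)) :
    partialInner m f (mulL F hF ψ) = mulL G hG (partialInner m f ψ) := by
  refine ext_inner_left ℂ fun k => ?_
  rw [inner_partialInner_right, ← inner_mulL_left, ← inner_mulL_left, inner_partialInner_right,
    mulL_insertL hF hG m h]

theorem mulL_rankOneAt {F : Config (n + 1) → ℝ} {G : Config n → ℝ} (hF : IsBddMeas F)
    (hG : IsBddMeas G) (m : Fin (n + 1)) (h : ∀ x, F x = G (m.removeNth x)) (f g : OneParticle)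
    (ψ : NParticle (n + 1)) :
    mulL F hF (rankOneAt m f g ψ) = rankOneAt m f g (mulL F hF ψ) := by
  rw [rankOneAt_apply, rankOneAt_apply, mulL_insertL hF hG m h, mulL_partialInner hF hG m h]

/-! ### The projections `p_m` and `q_m` -/

variable {ι : Type*} [Fintype ι] {φ : ι → OneParticle}

/-- The projection `p_m` as a bounded operator. -/
def projAt (φ : ι → OneParticle) (m : Fin (n + 1)) : NParticle (n + 1) →L[ℂ] NParticle (n + 1) :=
  ∑ j, rankOneAt m (φ j) (φ j)

theorem projAt_apply (φ : ι → OneParticle) (m : Fin (n + 1)) (ψ : NParticle (n + 1)) :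
    projAt φ m ψ = ∑ j, rankOneAt m (φ j) (φ j) ψ := by
  simp [projAt]

theorem inner_projAt (m : Fin (n + 1)) (ψ χ : NParticle (n + 1)) :
    inner ℂ (projAt φ m ψ) χ = inner ℂ ψ (projAt φ m χ) := by
  simp only [projAt_apply, sum_inner, inner_sum, inner_rankOneAt]

theorem projAt_rankOneAt_comm {m m' : Fin (n + 1)} (hm : m ≠ m') (f g : OneParticle)
    (ψ : NParticle (n + 1)) :
    projAt φ m (rankOneAt m' f g ψ) = rankOneAt m' f g (projAt φ m ψ) := by
  simp only [projAt_apply, map_sum, rankOneAt_comm hm]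

theorem projAt_comm (m m' : Fin (n + 1)) (ψ : NParticle (n + 1)) :
    projAt φ m (projAt φ m' ψ) = projAt φ m' (projAt φ m ψ) := by
  by_cases hm : m = m'
  · rw [hm]
  · rw [projAt_apply φ m', map_sum, projAt_apply φ m']
    exact Finset.sum_congr rfl fun j _ => projAt_rankOneAt_comm hm _ _ _

theorem projAt_projAt (hφ : Orthonormal ℂ φ) (m : Fin (n + 1)) (ψ : NParticle (n + 1)) :
    projAt φ m (projAt φ m ψ) = projAt φ m ψ := by
  classical
  rw [projAt_apply, projAt_apply]
  refine Finset.sum_congr rfl fun j _ => ?_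
  rw [map_sum, Finset.sum_eq_single j]
  · rw [rankOneAt_rankOneAt, inner_self_eq_norm_sq_to_K, hφ.1 j]
    simp
  · intro i _ hij
    rw [rankOneAt_rankOneAt, hφ.2 hij.symm, zero_smul]
  · simp

theorem permL_projAt (j k m : Fin (n + 1)) (ψ : NParticle (n + 1)) :
    permL (Equiv.swap j k) (projAt φ m ψ) =
      projAt φ (Equiv.swap j k m) (permL (Equiv.swap j k) ψ) := by
  simp only [projAt_apply, map_sum, permL_rankOneAt]

theorem mulL_projAt {F : Config (n + 1) → ℝ} {G : Config n → ℝ} (hF : IsBddMeas F)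
    (hG : IsBddMeas G) (m : Fin (n + 1)) (h : ∀ x, F x = G (m.removeNth x))
    (ψ : NParticle (n + 1)) : mulL F hF (projAt φ m ψ) = projAt φ m (mulL F hF ψ) := by
  simp only [projAt_apply, map_sum, mulL_rankOneAt hF hG m h]

/-- The formula defining `pProj` integrates over a fibre, a null set of the configuration space. By
Fubini almost every fibre meets the exceptional set of g = ψ in a null set, so the formula is
compatible with almost everywhere equality and can be iterated. -/
theorem coeFn_projAt (φ : Fin (n + 1) → OneParticle) (m : Fin (n + 1)) {g : Config (n + 1) → ℂ}
    {ψ : NParticle (n + 1)} (hg : g =ᵐ[volume] ψ) :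
    pProj φ m g =ᵐ[volume] projAt φ m ψ := by
  have h1 : ∀ᵐ x : Config n, ∀ᵐ y : Space, g (m.insertNth y x) = ψ (m.insertNth y x) := by
    have := (measurePreserving_insertNth m).quasiMeasurePreserving.ae hg
    exact Measure.ae_ae_of_ae_prod
      ((Measure.measurePreserving_swap (μ := (volume : Measure (Config n)))
        (ν := (volume : Measure Space))).quasiMeasurePreserving.ae this)
  have h2 : ∀ j, ∀ᵐ x : Config (n + 1), insertL m (φ j) (partialInner m (φ j) ψ) x =
      φ j (x m) * ∫ y, conj (φ j y) * g (Function.update x m y) := by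
    intro j
    filter_upwards [coeFn_insertL m (φ j) (partialInner m (φ j) ψ),
      (quasiMeasurePreserving_removeNth m).ae (coeFn_partialInner m (φ j) ψ),
      (quasiMeasurePreserving_removeNth m).ae h1] with x e1 e2 e3
    rw [e1, e2]
    congr 1
    refine integral_congr_ae ?_
    filter_upwards [e3] with y hy
    rw [← hy, Fin.insertNth_removeNth]
  have h3 : projAt φ m ψ =ᵐ[volume] fun x => ∑ j, insertL m (φ j) (partialInner m (φ j) ψ) x := by
    rw [projAt_apply]
    filter_upwards [Lp.coeFn_finsetSum Finset.univ fun j => rankOneAt m (φ j) (φ j) ψ] with x hx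
    rw [hx, Finset.sum_apply]
    rfl
  filter_upwards [h3, ae_all_iff.2 h2] with x e1 e2
  rw [e1, pProj]
  exact Finset.sum_congr rfl fun j _ => (e2 j).symm

theorem coeFn_one_sub_projAt (φ : Fin (n + 1) → OneParticle) (m : Fin (n + 1))
    {g : Config (n + 1) → ℂ} {ψ : NParticle (n + 1)} (hg : g =ᵐ[volume] ψ) :
    qProj φ m g =ᵐ[volume] (1 - projAt φ m : NParticle (n + 1) →L[ℂ] NParticle (n + 1)) ψ := by
  have : (1 - projAt φ m : NParticle (n + 1) →L[ℂ] NParticle (n + 1)) ψ = ψ - projAt φ m ψ := rfl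
  rw [this]
  filter_upwards [hg, coeFn_projAt φ m hg, Lp.coeFn_sub ψ (projAt φ m ψ)] with x h1 h2 h3
  rw [h3, qProj, h1, h2, Pi.sub_apply]

/-! ### The counting functional -/

section Counting

variable {R : Type*}

/-- Expand the product of the factors (1 - p_m) + p_m = 1. -/
theorem sum_prod_ite_eq_one [CommRing R] (p : Fin N → R) :
    ∑ k ∈ Finset.range (N + 1), ∑ s ∈ Finset.powersetCard k (Finset.univ : Finset (Fin N)),
      ∏ m, (if m ∈ s then 1 - p m else p m) = 1 := by
  have h := Finset.sum_powerset (Finset.univ : Finset (Fin N))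
    (fun s => ∏ m, (if m ∈ s then 1 - p m else p m))
  rw [Finset.card_univ, Fintype.card_fin] at h
  rw [← h]
  have h2 := Finset.prod_add (fun m => 1 - p m) p (Finset.univ : Finset (Fin N))
  simp only [sub_add_cancel, Finset.prod_const_one] at h2
  refine Eq.trans ?_ h2.symm
  refine Finset.sum_congr rfl fun s _ => ?_
  rw [Finset.prod_ite]
  congr 1
  · refine Finset.prod_congr ?_ fun _ _ => rfl
    ext; simp
  · refine Finset.prod_congr ?_ fun _ _ => rfl
    ext; simp

/-- By idempotency the factor 1 - p_m is absorbed by the product when m ∈ s and annihilates it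
otherwise, so exactly `s.card` terms survive. -/
theorem sum_mul_prod_ite [CommRing R] (p : Fin N → R) (hp : ∀ m, p m * p m = p m)
    (s : Finset (Fin N)) :
    (∑ m, (1 - p m)) * ∏ m, (if m ∈ s then 1 - p m else p m) =
      (s.card : R) * ∏ m, (if m ∈ s then 1 - p m else p m) := by
  have h : ∀ m, (1 - p m) * ∏ i, (if i ∈ s then 1 - p i else p i) =
      if m ∈ s then ∏ i, (if i ∈ s then 1 - p i else p i) else 0 := by
    intro m
    rw [← Finset.mul_prod_erase _ _ (Finset.mem_univ m), ← mul_assoc]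
    split_ifs with hm
    · rw [show (1 - p m) * (1 - p m) = 1 - p m by linear_combination hp m]
    · rw [show (1 - p m) * p m = 0 by linear_combination -hp m, zero_mul]
  rw [Finset.sum_mul, Finset.sum_congr rfl fun m _ => h m, Finset.sum_ite_mem, Finset.univ_inter,
    Finset.sum_const, nsmul_eq_mul]

/-- The part of the identity in which exactly `k` of the projections `1 - p_m` occur. -/
def countingSector [Ring R] (p : Fin N → R) (k : ℕ) : R :=
  ∑ s ∈ Finset.powersetCard k (Finset.univ : Finset (Fin N)),
    ((List.finRange N).map fun m => if m ∈ s then 1 - p m else p m).prod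

-- The ordered products are evaluated in the commutative subalgebra generated by the p_m, where the
-- two preceding identities apply.
open scoped IsMulCommutative in
theorem countingSector_spec [Ring R] [Algebra ℂ R] (p : Fin N → R) (hp : ∀ m, p m * p m = p m)
    (hc : ∀ m m', p m * p m' = p m' * p m) :
    ∑ k ∈ Finset.range (N + 1), countingSector p k = 1 ∧
      ∀ k, (∑ m, (1 - p m)) * countingSector p k = (k : R) * countingSector p k := by
  let B := Algebra.adjoin ℂ (range p)
  have : IsMulCommutative B := Algebra.isMulCommutative_adjoin ℂ (by
    rintro _ ⟨i, rfl⟩ _ ⟨j, rfl⟩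
    exact hc i j)
  let p' : Fin N → B := fun m => ⟨p m, Algebra.subset_adjoin ⟨m, rfl⟩⟩
  have hp' : ∀ m, p' m * p' m = p' m := fun m => Subtype.ext (hp m)
  let v : B →+* R := B.val.toRingHom
  have hv : ∀ m, v (p' m) = p m := fun m => rfl
  have hprod : ∀ s : Finset (Fin N), v (∏ m, (if m ∈ s then 1 - p' m else p' m)) =
      ((List.finRange N).map fun m => if m ∈ s then 1 - p m else p m).prod := by
    intro s
    rw [Fin.prod_univ_def, map_list_prod, List.map_map]
    congr 2
    funext m
    simp only [Function.comp_apply]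
    split_ifs
    · rw [map_sub, map_one, hv]
    · rw [hv]
  constructor
  · have := congrArg v (sum_prod_ite_eq_one p')
    simp only [map_sum, hprod, map_one] at this
    exact this
  · intro k
    rw [countingSector, Finset.mul_sum, Finset.mul_sum]
    refine Finset.sum_congr rfl fun s hs => ?_
    have := congrArg v (sum_mul_prod_ite p' hp' s)
    rw [map_mul, map_mul, hprod, map_natCast, map_sum, (Finset.mem_powersetCard.1 hs).2] at this
    simpa only [map_sub, map_one, hv] using this

end Counting

theorem coeFn_foldr (φ : Fin (n + 1) → OneParticle) (s : Finset (Fin (n + 1)))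
    (l : List (Fin (n + 1))) (ψ : NParticle (n + 1)) :
    l.foldr (fun m g => if m ∈ s then qProj φ m g else pProj φ m g) ψ =ᵐ[volume]
      (l.map fun m => if m ∈ s then 1 - projAt φ m else projAt φ m).prod ψ := by
  induction l with
  | nil => rfl
  | cons m l ih =>
    rw [List.foldr_cons, List.map_cons, List.prod_cons, mul_apply_eq_comp]
    split_ifs
    · exact coeFn_one_sub_projAt φ m ih
    · exact coeFn_projAt φ m ih

theorem coeFn_PProj (φ : Fin (n + 1) → OneParticle) (k : ℕ) (ψ : NParticle (n + 1)) :
    PProj φ k ψ =ᵐ[volume] countingSector (projAt φ) k ψ := by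
  have h : countingSector (projAt φ) k ψ =
      ∑ s ∈ Finset.powersetCard k (Finset.univ : Finset (Fin (n + 1))),
        ((List.finRange (n + 1)).map
          fun m => if m ∈ s then 1 - projAt φ m else projAt φ m).prod ψ := by
    rw [countingSector, sum_apply]
  rw [h]
  have h2 : ∀ s : Finset (Fin (n + 1)), ∀ᵐ x, (List.finRange (n + 1)).foldr
      (fun m g => if m ∈ s then qProj φ m g else pProj φ m g) ψ x =
      ((List.finRange (n + 1)).map
        fun m => if m ∈ s then 1 - projAt φ m else projAt φ m).prod ψ x :=
    fun s => coeFn_foldr φ s _ ψ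
  filter_upwards [Lp.coeFn_finsetSum (Finset.powersetCard k (Finset.univ : Finset (Fin (n + 1))))
    fun s => ((List.finRange (n + 1)).map
      fun m => if m ∈ s then 1 - projAt φ m else projAt φ m).prod ψ, ae_all_iff.2 h2] with x h3 h4
  rw [h3, Finset.sum_apply, PProj]
  refine Finset.sum_congr rfl fun s _ => ?_
  rw [← h4]

theorem countingSector_projAt (hφ : Orthonormal ℂ φ) :
    ∑ k ∈ Finset.range (n + 1 + 1), countingSector (projAt (n := n) φ) k = 1 ∧
      ∀ k, (∑ m, (1 - projAt φ m)) * countingSector (projAt (n := n) φ) k =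
        (k : NParticle (n + 1) →L[ℂ] NParticle (n + 1)) * countingSector (projAt φ) k :=
  countingSector_spec _ (fun m => ContinuousLinearMap.ext fun ψ => projAt_projAt hφ m ψ)
    fun m m' => ContinuousLinearMap.ext fun ψ => projAt_comm m m' ψ

theorem scp_eq_inner {ψ χ : NParticle N} {f g : Config N → ℂ} (hf : f =ᵐ[volume] ψ)
    (hg : g =ᵐ[volume] χ) : scp f g = inner ℂ ψ χ := by
  rw [scp, inner_eq_integral]
  refine integral_congr_ae ?_
  filter_upwards [hf, hg] with x h1 h2
  rw [h1, h2]

/-- `⟨ψ, q_m ψ⟩`, where `m` is the first particle. -/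
def excitation (φ : ι → OneParticle) (ψ : NParticle (n + 1)) : ℝ :=
  ‖ψ - projAt φ 0 ψ‖ ^ 2

theorem inner_sub_projAt (hφ : Orthonormal ℂ φ) (m : Fin (n + 1)) (ψ : NParticle (n + 1)) :
    inner ℂ ψ (ψ - projAt φ m ψ) = ((‖ψ - projAt φ m ψ‖ ^ 2 : ℝ) : ℂ) := by
  have h : inner ℂ (projAt φ m ψ) (ψ - projAt φ m ψ) = 0 := by
    rw [inner_projAt, map_sub, projAt_projAt hφ, sub_self, inner_zero_right]
  have h2 : inner ℂ (ψ - projAt φ m ψ) (ψ - projAt φ m ψ) = inner ℂ ψ (ψ - projAt φ m ψ) := by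
    rw [inner_sub_left, h, sub_zero]
  rw [← h2, inner_self_eq_norm_sq_to_K]
  norm_cast

theorem norm_sub_projAt_of_isAntisymmetric {ψ : NParticle (n + 1)} (h : IsAntisymmetric ψ)
    (m : Fin (n + 1)) : ‖ψ - projAt φ m ψ‖ = ‖ψ - projAt φ 0 ψ‖ := by
  by_cases hm : m = 0
  · rw [hm]
  · rw [← (permL (Equiv.swap m 0)).norm_map, map_sub, permL_projAt, Equiv.swap_apply_left,
      isAntisymmetric_iff.1 h m 0 hm, map_neg, neg_sub_neg, norm_sub_rev]

theorem inner_sub_projAt_of_isAntisymmetric (hφ : Orthonormal ℂ φ) {ψ : NParticle (n + 1)}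
    (h : IsAntisymmetric ψ) (m : Fin (n + 1)) :
    inner ℂ ψ (ψ - projAt φ m ψ) = (excitation φ ψ : ℂ) := by
  rw [inner_sub_projAt hφ, norm_sub_projAt_of_isAntisymmetric h]
  rfl

theorem scp_qProj {φ : Fin (n + 1) → OneParticle} (hφ : Orthonormal ℂ φ) {ψ : NParticle (n + 1)}
    (h : IsAntisymmetric ψ) (m : Fin (n + 1)) :
    scp (fun x => ψ x) (qProj φ m fun x => ψ x) = (excitation φ ψ : ℂ) := by
  rw [scp_eq_inner (ψ := ψ) EventuallyEq.rfl (coeFn_one_sub_projAt φ m EventuallyEq.rfl)]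
  exact inner_sub_projAt_of_isAntisymmetric hφ h m

/-- The sectors are eigenspaces of ∑ q_m with eigenvalue k, so the weighted operator is N⁻¹ ∑ q_m;
by antisymmetry its N terms have equal expectation. -/
theorem alphaN_eq_excitation {φ : Fin (n + 1) → OneParticle} (hφ : Orthonormal ℂ φ)
    {ψ : NParticle (n + 1)} (h : IsAntisymmetric ψ) : alphaN ψ φ = excitation φ ψ := by
  have h1 : weightOp (fun k => (k : ℝ) / (n + 1 : ℕ)) φ (fun x => ψ x) =ᵐ[volume]
      ((((n + 1 : ℕ) : ℂ)⁻¹ • ∑ m, (1 - projAt φ m)) :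
        NParticle (n + 1) →L[ℂ] NParticle (n + 1)) ψ := by
    have e : ((((n + 1 : ℕ) : ℂ)⁻¹ • ∑ m, (1 - projAt φ m)) :
        NParticle (n + 1) →L[ℂ] NParticle (n + 1)) ψ = ∑ k ∈ Finset.range (n + 1 + 1),
          (((k : ℝ) / (n + 1 : ℕ) : ℝ) : ℂ) • countingSector (projAt φ) k ψ := by
      have hs := countingSector_projAt (n := n) hφ
      have e0 : ∑ m, (1 - projAt φ m) = ∑ k ∈ Finset.range (n + 1 + 1),
          (k : NParticle (n + 1) →L[ℂ] NParticle (n + 1)) * countingSector (projAt φ) k := by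
        rw [← Finset.sum_congr rfl fun k _ => hs.2 k, ← Finset.mul_sum, hs.1, mul_one]
      rw [e0, smul_apply, sum_apply, Finset.smul_sum]
      refine Finset.sum_congr rfl fun k _ => ?_
      rw [← nsmul_eq_mul, smul_apply, ← Nat.cast_smul_eq_nsmul ℂ, smul_smul]
      congr 1
      push_cast
      field_simp
    rw [e]
    filter_upwards [Lp.coeFn_finsetSum (Finset.range (n + 1 + 1))
      fun k => (((k : ℝ) / (n + 1 : ℕ) : ℝ) : ℂ) • countingSector (projAt φ) k ψ,
      ae_all_iff.2 fun k => coeFn_PProj φ k ψ,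
      ae_all_iff.2 fun k : ℕ => Lp.coeFn_smul (((k : ℝ) / (n + 1 : ℕ) : ℝ) : ℂ)
        (countingSector (projAt φ) k ψ)] with x e1 e2 e3
    rw [e1, Finset.sum_apply, weightOp]
    refine Finset.sum_congr rfl fun k _ => ?_
    rw [e3, Pi.smul_apply, ← e2, smul_eq_mul]
  have h2 : ∀ m, inner ℂ ψ ((1 - projAt φ m : NParticle (n + 1) →L[ℂ] NParticle (n + 1)) ψ) =
      (excitation φ ψ : ℂ) := inner_sub_projAt_of_isAntisymmetric hφ h
  rw [alphaN, countingFunctional, scp_eq_inner (ψ := ψ) EventuallyEq.rfl h1, smul_apply, sum_apply,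
    inner_smul_right, inner_sum]
  simp only [h2]
  rw [Finset.sum_const, Finset.card_univ, Fintype.card_fin, nsmul_eq_mul,
    inv_mul_cancel_left₀ (Nat.cast_ne_zero.2 (Nat.succ_ne_zero n)), Complex.ofReal_re]

end

/-! ### Pair interactions as averages over occupations, and the exclusion principle. -/

section

variable {n N : ℕ} {ι : Type*} [Fintype ι] {φ : ι → OneParticle}

/-! ### The kernel of the projection onto the orbitals -/

/-- The vector `g_y = ∑ⱼ φⱼ(y)* φⱼ`, so that `(p f)(y) = ⟨g_y, f⟩`. -/
def kernelAt (φ : ι → OneParticle) (y : Space) : OneParticle := ∑ j, conj (φ j y) • φ j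

theorem partialInner_kernelAt (m : Fin (n + 1)) (y : Space) (ψ : NParticle (n + 1)) :
    partialInner m (kernelAt φ y) ψ = ∑ j, φ j y • partialInner m (φ j) ψ := by
  simp only [kernelAt, partialInner_sum, partialInner_smul, Complex.conj_conj]

theorem inner_kernelAt_self (hφ : Orthonormal ℂ φ) (y : Space) :
    inner ℂ (kernelAt φ y) (kernelAt φ y) = ((∑ j, ‖φ j y‖ ^ 2 : ℝ) : ℂ) := by
  rw [kernelAt, hφ.inner_sum]
  push_cast
  refine Finset.sum_congr rfl fun j _ => ?_
  rw [Complex.conj_conj, Complex.mul_conj, Complex.normSq_eq_norm_sq]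
  push_cast
  rfl

theorem coeFn_projAt_eq (m : Fin (n + 1)) (ψ : NParticle (n + 1)) :
    projAt φ m ψ =ᵐ[volume] fun x => ∑ j, φ j (x m) * partialInner m (φ j) ψ (m.removeNth x) := by
  rw [projAt_apply]
  filter_upwards [Lp.coeFn_finsetSum Finset.univ fun j => rankOneAt m (φ j) (φ j) ψ,
    ae_all_iff.2 fun j => coeFn_insertL m (φ j) (partialInner m (φ j) ψ)] with x hx h2
  rw [hx, Finset.sum_apply]
  exact Finset.sum_congr rfl fun j _ => h2 j

theorem coeFn_partialInner_kernelAt (m : Fin (n + 1)) (y : Space) (ψ : NParticle (n + 1)) :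
    partialInner m (kernelAt φ y) ψ =ᵐ[volume] fun x => ∑ j, φ j y * partialInner m (φ j) ψ x := by
  rw [partialInner_kernelAt]
  filter_upwards [Lp.coeFn_finsetSum Finset.univ fun j => φ j y • partialInner m (φ j) ψ,
    ae_all_iff.2 fun j => Lp.coeFn_smul (φ j y) (partialInner m (φ j) ψ)] with x hx h2
  rw [hx, Finset.sum_apply]
  exact Finset.sum_congr rfl fun j _ => h2 j

theorem integrable_mul_of_isBddMeas {α : Type*} [MeasurableSpace α] {μ : Measure α} {F : α → ℝ}
    (hF : IsBddMeas F) {f : α → ℂ} (hf : Integrable f μ) :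
    Integrable (fun x => (F x : ℂ) * f x) μ := by
  obtain ⟨hm, C, hC⟩ := hF
  exact hf.bdd_mul (c := C) (Complex.measurable_ofReal.comp hm).aestronglyMeasurable
    (Eventually.of_forall fun x => by rw [Complex.norm_real]; exact hC x)

/-- Matrix elements of `p_m u p_m` as an integral over the position of the particle `m`. -/
theorem inner_projAt_mulL_projAt (m : Fin (n + 1)) {F : Config (n + 1) → ℝ} (hF : IsBddMeas F)
    {G : Space → Config (n + 1) → ℝ} (hG : ∀ y, IsBddMeas (G y))
    {G' : Space → Config n → ℝ} (hG' : ∀ y, IsBddMeas (G' y))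
    (hFG : ∀ y x, F (m.insertNth y x) = G' y x) (hGG : ∀ y x, G y x = G' y (m.removeNth x))
    (a b : NParticle (n + 1)) :
    Integrable (fun y => inner ℂ a
      (mulL (G y) (hG y) (rankOneAt m (kernelAt φ y) (kernelAt φ y) b))) ∧
    inner ℂ (projAt φ m a) (mulL F hF (projAt φ m b)) =
      ∫ y, inner ℂ a (mulL (G y) (hG y) (rankOneAt m (kernelAt φ y) (kernelAt φ y) b)) := by
  -- The value of p_m b at x is the contraction of b with g_y at y = x_m. Both sides are therefore
  -- integrals of this one kernel, in different orders; Fubini is justified by the integrability of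
  -- the left-hand integrand.
  let H : Space × Config n → ℂ := fun p => (G' p.1 p.2 : ℂ) *
    (conj (∑ j, φ j p.1 * partialInner m (φ j) a p.2) *
      ∑ j, φ j p.1 * partialInner m (φ j) b p.2)
  have hae : ∀ᵐ x : Config (n + 1), (F x : ℂ) * (conj (projAt φ m a x) * projAt φ m b x) =
      (F x : ℂ) * (conj (∑ j, φ j (x m) * partialInner m (φ j) a (m.removeNth x)) *
        ∑ j, φ j (x m) * partialInner m (φ j) b (m.removeNth x)) := by
    filter_upwards [coeFn_projAt_eq (φ := φ) m a, coeFn_projAt_eq (φ := φ) m b] with x h1 h2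
    rw [h1, h2]
  have hH : Integrable H (volume.prod volume) := by
    have h1 := (integrable_mul_of_isBddMeas hF
      (integrable_conj_mul (projAt φ m a) (projAt φ m b))).congr hae
    have h2 := (integrable_insertNth_iff m).2 h1
    simpa only [Fin.insertNth_apply_same, Fin.removeNth_insertNth, hFG] using h2
  have hin : ∀ y, inner ℂ a (mulL (G y) (hG y) (rankOneAt m (kernelAt φ y) (kernelAt φ y) b)) =
      ∫ x, H (y, x) := by
    intro y
    rw [rankOneAt_apply, mulL_insertL (hG y) (hG' y) m (hGG y), ← inner_partialInner_left,
      inner_mulL_right]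
    refine integral_congr_ae ?_
    filter_upwards [coeFn_partialInner_kernelAt (φ := φ) m y a,
      coeFn_partialInner_kernelAt (φ := φ) m y b] with x h1 h2
    rw [h1, h2]
  simp only [hin]
  refine ⟨hH.integral_prod_left, ?_⟩
  rw [inner_mulL_right, integral_congr_ae hae, ← integral_insertNth m, ← integral_prod _ hH]
  simp only [Fin.insertNth_apply_same, Fin.removeNth_insertNth, hFG]
  rfl

theorem exists_isBddMeas_removeNth {u : Space → ℝ} (hu : IsBddMeas u) {m : Fin (n + 1)}
    (hm : m ≠ 0) : ∃ G' : Space → Config n → ℝ, (∀ y, IsBddMeas (G' y)) ∧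
      (∀ y x, u ((m.insertNth y x : Config (n + 1)) 0 - (m.insertNth y x : Config (n + 1)) m) = G' y x) ∧
      ∀ y (x : Config (n + 1)), u (x 0 - y) = G' y (m.removeNth x) := by
  obtain ⟨i, hi⟩ := Fin.exists_succAbove_eq hm.symm
  refine ⟨fun y x => u (x i - y), fun y => hu.comp ((measurable_pi_apply i).sub measurable_const),
    fun y x => ?_, fun y x => ?_⟩
  · rw [Fin.insertNth_apply_same, ← hi, Fin.insertNth_apply_succAbove]
  · rw [← hi]; rfl

theorem isBddMeas_pair {u : Space → ℝ} (hu : IsBddMeas u) (i j : Fin N) :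
    IsBddMeas fun x : Config N => u (x i - x j) :=
  hu.comp ((measurable_pi_apply i).sub (measurable_pi_apply j))

theorem isBddMeas_coord_sub {u : Space → ℝ} (hu : IsBddMeas u) (i : Fin N) (y : Space) :
    IsBddMeas fun x : Config N => u (x i - y) :=
  hu.comp ((measurable_pi_apply i).sub measurable_const)

/-- Multiplication by `u(x₁ - x_m)`. -/
def pairL (u : Space → ℝ) (hu : IsBddMeas u) (m : Fin (n + 1)) :
    NParticle (n + 1) →L[ℂ] NParticle (n + 1) :=
  mulL (fun x => u (x 0 - x m)) (isBddMeas_pair hu 0 m)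

/-- Multiplication by `u(x₁ - y)`. -/
def shiftL (u : Space → ℝ) (hu : IsBddMeas u) (y : Space) :
    NParticle (n + 1) →L[ℂ] NParticle (n + 1) :=
  mulL (fun x => u (x 0 - y)) (isBddMeas_coord_sub hu 0 y)

/-- The number of particles other than the first one in the (unnormalised) orbital `g`. -/
def occupation (g : OneParticle) : NParticle (n + 1) →L[ℂ] NParticle (n + 1) :=
  ∑ m ∈ Finset.univ.erase 0, rankOneAt m g g

theorem occupation_apply (g : OneParticle) (b : NParticle (n + 1)) :
    occupation g b = ∑ m ∈ Finset.univ.erase 0, rankOneAt m g g b := by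
  simp [occupation]

variable {u : Space → ℝ} (hu : IsBddMeas u)

/-- Freezing x_m at y and summing over m turns the pair interaction into the external potential
u(x_0 - y) weighted by the occupation of g_y. In `inner_shiftL` the mean field has the same form
with ρ(y) in place of the occupation, so the two can be compared pointwise in y. -/
theorem sum_inner_pairL (a b : NParticle (n + 1)) :
    Integrable (fun y => inner ℂ a (shiftL u hu y (occupation (kernelAt φ y) b))) ∧
    ∑ m ∈ Finset.univ.erase 0, inner ℂ (projAt φ m a) (pairL u hu m (projAt φ m b)) =
      ∫ y, inner ℂ a (shiftL u hu y (occupation (kernelAt φ y) b)) := by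
  have h : ∀ m ∈ (Finset.univ : Finset (Fin (n + 1))).erase 0,
      Integrable (fun y => inner ℂ a
        (shiftL u hu y (rankOneAt m (kernelAt φ y) (kernelAt φ y) b))) ∧
      inner ℂ (projAt φ m a) (pairL u hu m (projAt φ m b)) =
        ∫ y, inner ℂ a (shiftL u hu y (rankOneAt m (kernelAt φ y) (kernelAt φ y) b)) := by
    intro m hm
    obtain ⟨G', h1, h2, h3⟩ := exists_isBddMeas_removeNth hu (Finset.ne_of_mem_erase hm)
    exact inner_projAt_mulL_projAt m (isBddMeas_pair hu 0 m) (isBddMeas_coord_sub hu 0) h1 h2 h3 a b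
  simp only [occupation_apply, map_sum, inner_sum]
  refine ⟨integrable_finsetSum _ fun m hm => (h m hm).1, ?_⟩
  rw [integral_finsetSum _ fun m hm => (h m hm).1]
  exact Finset.sum_congr rfl fun m hm => (h m hm).2

theorem integrable_sum_norm_sq (φ : ι → OneParticle) :
    Integrable fun y : Space => ∑ j, ‖φ j y‖ ^ 2 :=
  integrable_finsetSum _ fun j _ => integrable_norm_sq (φ j)

theorem integral_sum_norm_sq (φ : ι → OneParticle) :
    ∫ y : Space, ∑ j, ‖φ j y‖ ^ 2 = ∑ j, ‖φ j‖ ^ 2 := by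
  rw [integral_finsetSum _ fun j _ => integrable_norm_sq (φ j)]
  exact Finset.sum_congr rfl fun j _ => (norm_sq_eq_integral _).symm

theorem inner_shiftL (a b : NParticle (n + 1)) :
    Integrable (fun y => ((∑ j, ‖φ j y‖ ^ 2 : ℝ) : ℂ) * inner ℂ a (shiftL u hu y b)) ∧
    ∫ y, ((∑ j, ‖φ j y‖ ^ 2 : ℝ) : ℂ) * inner ℂ a (shiftL u hu y b) =
      ∫ x : Config (n + 1), ((∫ y, u (x 0 - y) * ∑ j, ‖φ j y‖ ^ 2 : ℝ) : ℂ) * (conj (a x) * b x) := by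
  let H : Space × Config (n + 1) → ℂ := fun p => ((u (p.2 0 - p.1) : ℝ) : ℂ) *
    (((∑ j, ‖φ j p.1‖ ^ 2 : ℝ) : ℂ) * (conj (a p.2) * b p.2))
  have hH : Integrable H (volume.prod volume) := by
    refine integrable_mul_of_isBddMeas (F := fun p : Space × Config (n + 1) => u (p.2 0 - p.1))
      (hu.comp (((measurable_pi_apply 0).comp measurable_snd).sub measurable_fst)) ?_
    exact (integrable_sum_norm_sq φ).ofReal.mul_prod (integrable_conj_mul a b)
  have h1 : ∀ y, ((∑ j, ‖φ j y‖ ^ 2 : ℝ) : ℂ) * inner ℂ a (shiftL u hu y b) = ∫ x, H (y, x) := by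
    intro y
    rw [shiftL, inner_mulL_right, ← integral_const_mul]
    refine integral_congr_ae (Eventually.of_forall fun x => ?_)
    simp only [H]
    ring
  simp only [h1]
  refine ⟨hH.integral_prod_left, ?_⟩
  rw [← integral_prod _ hH, integral_prod_symm _ hH]
  refine integral_congr_ae (Eventually.of_forall fun x => ?_)
  simp only [H]
  rw [← integral_complex_ofReal, ← integral_mul_const]
  refine integral_congr_ae (Eventually.of_forall fun y => ?_)
  simp only [Complex.ofReal_mul]
  ring

/-! ### Consequences of the exclusion principle -/

/-- No orbital is occupied by two of the particles other than the first one. -/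
def Exclusive (b : NParticle (n + 1)) : Prop :=
  ∀ (g : OneParticle) (j k : Fin (n + 1)), j ≠ 0 → k ≠ 0 → j ≠ k →
    rankOneAt j g g (rankOneAt k g g b) = 0

theorem IsAntisymmetric.exclusive {ψ : NParticle (n + 1)} (h : IsAntisymmetric ψ) : Exclusive ψ :=
  fun g _ _ _ _ hjk => rankOneAt_rankOneAt_of_isAntisymmetric h hjk g

/-- The vector p_0 b need not be antisymmetric even when b is. Exclusion among the other particles
survives because p_0 commutes with operators acting on them; this is why `Exclusive` omits particle
0. -/
theorem Exclusive.projAt {b : NParticle (n + 1)} (h : Exclusive b) : Exclusive (projAt φ 0 b) :=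
  fun g j k hj hk hjk => by
    rw [← projAt_rankOneAt_comm hk.symm, ← projAt_rankOneAt_comm hj.symm, h g j k hj hk hjk, map_zero]

theorem Exclusive.sub_projAt {b : NParticle (n + 1)} (h : Exclusive b) :
    Exclusive (b - FermionMF.projAt φ 0 b) := fun g j k hj hk hjk => by
  rw [map_sub, map_sub, h g j k hj hk hjk, h.projAt g j k hj hk hjk, sub_zero]

theorem shiftL_rankOneAt {m : Fin (n + 1)} (hm : m ≠ 0) (f g : OneParticle) (y : Space)
    (b : NParticle (n + 1)) :
    shiftL u hu y (rankOneAt m f g b) = rankOneAt m f g (shiftL u hu y b) := by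
  obtain ⟨G', h1, -, h3⟩ := exists_isBddMeas_removeNth hu hm
  exact mulL_rankOneAt _ (h1 y) m (h3 y) f g b

theorem Exclusive.shiftL {b : NParticle (n + 1)} (h : Exclusive b) (y : Space) :
    Exclusive (shiftL u hu y b) := fun g j k hj hk hjk => by
  rw [← shiftL_rankOneAt hu hk, ← shiftL_rankOneAt hu hj, h g j k hj hk hjk, map_zero]

theorem shiftL_occupation (g : OneParticle) (y : Space) (b : NParticle (n + 1)) :
    shiftL u hu y (occupation g b) = occupation g (shiftL u hu y b) := by
  rw [occupation_apply, occupation_apply, map_sum]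
  exact Finset.sum_congr rfl fun m hm => shiftL_rankOneAt hu (Finset.ne_of_mem_erase hm) _ _ _ _

theorem inner_occupation (g : OneParticle) (a b : NParticle (n + 1)) :
    inner ℂ (occupation g a) b = inner ℂ a (occupation g b) := by
  simp only [occupation_apply, sum_inner, inner_sum, inner_rankOneAt]

/-- Exclusion kills the products over distinct particles and the diagonal ones give ⟨g, g⟩. On such
vectors the occupation divided by r, when r ≠ 0, thus behaves as a projection. -/
theorem occupation_occupation {b : NParticle (n + 1)} (h : Exclusive b) {g : OneParticle} {r : ℝ}
    (hg : inner ℂ g g = (r : ℂ)) : occupation g (occupation g b) = (r : ℂ) • occupation g b := by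
  simp only [occupation_apply, map_sum, Finset.smul_sum]
  refine Finset.sum_congr rfl fun m hm => ?_
  rw [Finset.sum_eq_single m, rankOneAt_rankOneAt, hg]
  · intro k hk hkm
    exact h g k m (Finset.ne_of_mem_erase hk) (Finset.ne_of_mem_erase hm) hkm
  · exact fun h => (h hm).elim

/-- The occupation annihilates (r - occupation) b, so the hole operator r - occupation squares to r
times itself on b. This converts norms of hole vectors into expectations, which can be integrated
exactly. -/
theorem norm_smul_sub_occupation_sq {b : NParticle (n + 1)} (h : Exclusive b) {g : OneParticle}
    {r : ℝ} (hg : inner ℂ g g = (r : ℂ)) :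
    ‖(r : ℂ) • b - occupation g b‖ ^ 2 = r * (inner ℂ b ((r : ℂ) • b - occupation g b)).re := by
  have h1 : occupation g ((r : ℂ) • b - occupation g b) = 0 := by
    rw [map_sub, map_smul, occupation_occupation h hg, sub_self]
  have h2 : inner ℂ ((r : ℂ) • b - occupation g b) ((r : ℂ) • b - occupation g b) =
      (r : ℂ) * inner ℂ b ((r : ℂ) • b - occupation g b) := by
    conv_lhs => rw [inner_sub_left, inner_occupation, h1, inner_zero_right, sub_zero,
      inner_smul_left, Complex.conj_ofReal]
  rw [inner_self_eq_norm_sq_to_K] at h2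
  have := congrArg Complex.re h2
  rw [Complex.re_ofReal_mul] at this
  rw [← this]
  norm_cast

theorem re_inner_smul_sub_occupation_nonneg {b : NParticle (n + 1)} (h : Exclusive b)
    {g : OneParticle} {r : ℝ} (hg : inner ℂ g g = (r : ℂ)) :
    0 ≤ (inner ℂ b ((r : ℂ) • b - occupation g b)).re := by
  have hr : 0 ≤ r := by
    have : r = ‖g‖ ^ 2 := by rw [← inner_self_eq_norm_sq (𝕜 := ℂ), hg]; simp
    rw [this]; positivity
  rcases hr.eq_or_lt with h0 | h0
  · have : g = 0 := by
      rw [← inner_self_eq_zero (𝕜 := ℂ), hg, ← h0]; simp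
    subst this
    rw [occupation_apply, ← h0]
    simp [rankOneAt_apply]
  · have := norm_smul_sub_occupation_sq h hg
    nlinarith [sq_nonneg ‖(r : ℂ) • b - occupation g b‖]

end

/-! ### Summed estimates with the constant of a single pair. -/

section

variable {n N : ℕ} {ι : Type*} [Fintype ι] {φ : ι → OneParticle} {u : Space → ℝ}

/-! ### Bounds for the pair interaction -/

theorem mulL_one (h : IsBddMeas fun _ : Config N => (1 : ℝ)) (b : NParticle N) :
    mulL (fun _ => 1) h b = b := by
  refine Lp.ext ?_
  filter_upwards [coeFn_mulL h b] with x hx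
  rw [hx]; simp

theorem isBddMeas_one {α : Type*} [MeasurableSpace α] : IsBddMeas fun _ : α => (1 : ℝ) :=
  ⟨measurable_const, 1, fun _ => by simp⟩

theorem norm_mulL_sq_eq_re {F : Config N → ℝ} (hF : IsBddMeas F) (b : NParticle N) :
    ‖mulL F hF b‖ ^ 2 = (inner ℂ b (mulL (fun x => F x * F x) (hF.mul hF) b)).re := by
  rw [← mulL_mulL hF hF, ← inner_mulL_left, inner_self_eq_norm_sq_to_K]
  norm_cast

theorem norm_shiftL_sq (hu : IsBddMeas u) (y : Space) (a : NParticle (n + 1)) :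
    ‖shiftL u hu y a‖ ^ 2 = (inner ℂ a (shiftL (fun z => u z * u z) (hu.mul hu) y a)).re :=
  norm_mulL_sq_eq_re _ a

theorem norm_pairL_sq (hu : IsBddMeas u) (m : Fin (n + 1)) (a : NParticle (n + 1)) :
    ‖pairL u hu m a‖ ^ 2 = (inner ℂ a (pairL (fun z => u z * u z) (hu.mul hu) m a)).re :=
  norm_mulL_sq_eq_re _ a

theorem integral_norm_shiftL_sq_le (hu : IsBddMeas u) {K : ℝ}
    (hK : ∀ z, ∫ y, u (z - y) ^ 2 * ∑ j, ‖φ j y‖ ^ 2 ≤ K) (a : NParticle (n + 1)) :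
    Integrable (fun y => (∑ j, ‖φ j y‖ ^ 2) * ‖shiftL u hu y a‖ ^ 2) ∧
      ∫ y, (∑ j, ‖φ j y‖ ^ 2) * ‖shiftL u hu y a‖ ^ 2 ≤ K * ‖a‖ ^ 2 := by
  obtain ⟨h1, h2⟩ := inner_shiftL (φ := φ) (hu.mul hu) a a
  have e : ∀ y, (∑ j, ‖φ j y‖ ^ 2) * ‖shiftL u hu y a‖ ^ 2 =
      RCLike.re (((∑ j, ‖φ j y‖ ^ 2 : ℝ) : ℂ) *
        inner ℂ a (shiftL (fun z => u z * u z) (hu.mul hu) y a)) := fun y => by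
    rw [norm_shiftL_sq]; exact (Complex.re_ofReal_mul _ _).symm
  simp only [e]
  refine ⟨h1.re, ?_⟩
  rw [integral_re h1, h2]
  have e2 : ∀ x : Config (n + 1), ((∫ y, u (x 0 - y) * u (x 0 - y) * ∑ j, ‖φ j y‖ ^ 2 : ℝ) : ℂ) *
      (conj (a x) * a x) =
      (((∫ y, u (x 0 - y) ^ 2 * ∑ j, ‖φ j y‖ ^ 2) * ‖a x‖ ^ 2 : ℝ) : ℂ) := fun x => by
    rw [← Complex.normSq_eq_conj_mul_self, Complex.normSq_eq_norm_sq]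
    simp only [← sq]
    push_cast
    rfl
  simp only [e2]
  rw [integral_complex_ofReal]
  change ∫ x : Config (n + 1), (∫ y, u (x 0 - y) ^ 2 * ∑ j, ‖φ j y‖ ^ 2) * ‖a x‖ ^ 2 ≤ _
  rw [norm_sq_eq_integral a, ← integral_const_mul]
  refine integral_mono_of_nonneg (Eventually.of_forall fun x => ?_)
    ((integrable_norm_sq a).const_mul _) (Eventually.of_forall fun x => ?_)
  · exact mul_nonneg (integral_nonneg fun y => by positivity) (sq_nonneg _)
  · exact mul_le_mul_of_nonneg_right (hK _) (sq_nonneg _)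

/-- The sum is the integral over y of the occupation of g_y in the state u(x_0 - y) b, and exclusion
bounds that occupation by ρ(y). The whole sum over m thus obeys the bound that one would expect for
a single m. -/
theorem sum_norm_pairL_sq_le (hφ : Orthonormal ℂ φ) (hu : IsBddMeas u) {K : ℝ}
    (hK : ∀ z, ∫ y, u (z - y) ^ 2 * ∑ j, ‖φ j y‖ ^ 2 ≤ K) {b : NParticle (n + 1)}
    (hb : Exclusive b) :
    ∑ m ∈ Finset.univ.erase 0, ‖pairL u hu m (projAt φ m b)‖ ^ 2 ≤ K * ‖b‖ ^ 2 := by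
  obtain ⟨h1, h2⟩ := sum_inner_pairL (φ := φ) (hu.mul hu) b b
  obtain ⟨h3, h4⟩ := integral_norm_shiftL_sq_le hu hK b
  have e : ∑ m ∈ Finset.univ.erase 0, ‖pairL u hu m (projAt φ m b)‖ ^ 2 =
      RCLike.re (∑ m ∈ Finset.univ.erase 0,
        inner ℂ (projAt φ m b) (pairL (fun z => u z * u z) (hu.mul hu) m (projAt φ m b))) := by
    rw [map_sum]
    exact Finset.sum_congr rfl fun m _ => norm_pairL_sq hu m _
  rw [e, h2, ← integral_re h1]
  refine le_trans (integral_mono h1.re h3 fun y => ?_) h4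
  have hb' : Exclusive (shiftL u hu y b) := hb.shiftL hu y
  have := re_inner_smul_sub_occupation_nonneg hb' (inner_kernelAt_self hφ y)
  have e1 : (inner ℂ (shiftL u hu y b) (shiftL u hu y b)).re = ‖shiftL u hu y b‖ ^ 2 :=
    inner_self_eq_norm_sq (𝕜 := ℂ) _
  rw [inner_sub_right, inner_smul_right, Complex.sub_re, Complex.re_ofReal_mul, e1] at this
  have e2 : inner ℂ b (shiftL (fun z => u z * u z) (hu.mul hu) y (occupation (kernelAt φ y) b)) =
      inner ℂ (shiftL u hu y b) (occupation (kernelAt φ y) (shiftL u hu y b)) := by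
    rw [← shiftL_occupation]
    unfold shiftL
    rw [inner_mulL_left, mulL_mulL]
  simp only
  rw [e2]
  change (inner ℂ (shiftL u hu y b) (occupation (kernelAt φ y) (shiftL u hu y b))).re ≤ _
  linarith

/-- This is the total number of holes: the case u = 1 of `sum_inner_pairL`, together with the total
integral of ρ. -/
theorem integral_re_inner_smul_sub_occupation (hφ : Orthonormal ℂ φ) (b : NParticle (n + 1)) :
    Integrable (fun y => (inner ℂ b (((∑ j, ‖φ j y‖ ^ 2 : ℝ) : ℂ) • b -
        occupation (kernelAt φ y) b)).re) ∧
    ∫ y, (inner ℂ b (((∑ j, ‖φ j y‖ ^ 2 : ℝ) : ℂ) • b - occupation (kernelAt φ y) b)).re =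
      Fintype.card ι * ‖b‖ ^ 2 -
        ∑ m ∈ Finset.univ.erase 0, (inner ℂ b (projAt φ m b)).re := by
  obtain ⟨h1, h2⟩ := sum_inner_pairL (φ := φ) isBddMeas_one b b
  have e1 : ∀ y (c : NParticle (n + 1)), shiftL (fun _ => 1) isBddMeas_one y c = c :=
    fun y c => mulL_one _ c
  have e2 : ∀ m (c : NParticle (n + 1)), pairL (fun _ => 1) isBddMeas_one m c = c :=
    fun m c => mulL_one _ c
  simp only [e1, e2, inner_projAt, projAt_projAt hφ] at h1 h2
  have h3 : Integrable fun y => (∑ j, ‖φ j y‖ ^ 2) * ‖b‖ ^ 2 :=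
    (integrable_sum_norm_sq φ).mul_const _
  have e3 : ∀ y, (inner ℂ b (((∑ j, ‖φ j y‖ ^ 2 : ℝ) : ℂ) • b -
      occupation (kernelAt φ y) b)).re = (∑ j, ‖φ j y‖ ^ 2) * ‖b‖ ^ 2 -
        RCLike.re (inner ℂ b (occupation (kernelAt φ y) b)) := fun y => by
    rw [inner_sub_right, inner_smul_right, Complex.sub_re, Complex.re_ofReal_mul]
    congr 2
    exact inner_self_eq_norm_sq (𝕜 := ℂ) b
  simp only [e3]
  refine ⟨h3.sub h1.re, ?_⟩
  rw [integral_sub h3 h1.re, integral_mul_const, integral_sum_norm_sq, integral_re h1, ← h2]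
  simp [hφ.1]

/-- Weighted Young inequality arranged so that the density r ends up on X² while s stays bare: (XY)²
= (τ r X²)(τ⁻¹ s). -/
theorem mul_le_of_sq_eq_mul {X Y r s τ : ℝ} (hτ : 0 < τ) (hr : 0 ≤ r) (hs : 0 ≤ s)
    (hY : Y ^ 2 = r * s) : X * Y ≤ (τ * (r * X ^ 2) + τ⁻¹ * s) / 2 := by
  refine le_of_sq_le_sq ?_ (by positivity)
  have h : (τ * (r * X ^ 2)) * (τ⁻¹ * s) = (X * Y) ^ 2 := by
    rw [mul_pow, hY]; field_simp
  nlinarith [sq_nonneg (τ * (r * X ^ 2) - τ⁻¹ * s)]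

/-- The direct interaction is cancelled by the mean field up to excitations. -/
theorem norm_sum_inner_pairL_sub_le (hφ : Orthonormal ℂ φ) (hu : IsBddMeas u) {K : ℝ}
    (hK : ∀ z, ∫ y, u (z - y) ^ 2 * ∑ j, ‖φ j y‖ ^ 2 ≤ K)
    (hV : IsBddMeas fun x : Config (n + 1) => ∫ y, u (x 0 - y) * ∑ j, ‖φ j y‖ ^ 2)
    (a : NParticle (n + 1)) {b : NParticle (n + 1)} (hb : Exclusive b) {τ : ℝ} (hτ : 0 < τ) :
    ‖∑ m ∈ Finset.univ.erase 0, inner ℂ (projAt φ m a) (pairL u hu m (projAt φ m b)) -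
      inner ℂ a (mulL _ hV b)‖ ≤ (τ * (K * ‖a‖ ^ 2) + τ⁻¹ * (Fintype.card ι * ‖b‖ ^ 2 -
        ∑ m ∈ Finset.univ.erase 0, (inner ℂ b (projAt φ m b)).re)) / 2 := by
  obtain ⟨h1, h2⟩ := sum_inner_pairL (φ := φ) hu a b
  obtain ⟨h3, h4⟩ := inner_shiftL (φ := φ) hu a b
  obtain ⟨h5, h6⟩ := integral_norm_shiftL_sq_le hu hK a
  obtain ⟨h7, h8⟩ := integral_re_inner_smul_sub_occupation (n := n) hφ b
  -- The pair term and the mean field combine into minus the integral of ⟨u(x_0 - y) a, (ρ(y) - n_y)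
  -- b⟩. Young's inequality under the integral then separates the potential, acting on a, from the
  -- holes in b.
  rw [h2, inner_mulL_right, ← h4, ← integral_sub h1 h3, ← h8]
  have hint : Integrable (fun y => (τ * ((∑ j, ‖φ j y‖ ^ 2) * ‖shiftL u hu y a‖ ^ 2) +
      τ⁻¹ * (inner ℂ b (((∑ j, ‖φ j y‖ ^ 2 : ℝ) : ℂ) • b - occupation (kernelAt φ y) b)).re) / 2) :=
    ((h5.const_mul τ).add (h7.const_mul τ⁻¹)).div_const 2
  refine (norm_integral_le_of_norm_le hint (Eventually.of_forall fun y => ?_)).trans ?_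
  · have e : inner ℂ a (shiftL u hu y (occupation (kernelAt φ y) b)) -
        ((∑ j, ‖φ j y‖ ^ 2 : ℝ) : ℂ) * inner ℂ a (shiftL u hu y b) =
        -inner ℂ (shiftL u hu y a)
          (((∑ j, ‖φ j y‖ ^ 2 : ℝ) : ℂ) • b - occupation (kernelAt φ y) b) := by
      have : ∀ c, inner ℂ (shiftL u hu y a) c = inner ℂ a (shiftL u hu y c) := fun c =>
        inner_mulL_left _ _ _
      rw [inner_sub_right, inner_smul_right, this, this]
      ring
    rw [e, norm_neg]
    refine (norm_inner_le_norm _ _).trans ?_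
    exact mul_le_of_sq_eq_mul hτ (Finset.sum_nonneg fun j _ => sq_nonneg _)
      (re_inner_smul_sub_occupation_nonneg hb (inner_kernelAt_self hφ y))
      (norm_smul_sub_occupation_sq hb (inner_kernelAt_self hφ y))
  · rw [integral_div, integral_add (h5.const_mul τ) (h7.const_mul τ⁻¹), integral_const_mul,
      integral_const_mul]
    have := mul_le_mul_of_nonneg_left h6 hτ.le
    linarith

end

/-! ### Decomposition by the number of excitations. -/

section

variable {n N : ℕ} {ι : Type*} [Fintype ι] {φ : ι → OneParticle} {u : Space → ℝ}

/-! ### Sectors of fixed excitation number -/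

/-- The projection `q_m` as a bounded operator. -/
def coprojAt (φ : ι → OneParticle) (m : Fin (n + 1)) : NParticle (n + 1) →L[ℂ] NParticle (n + 1) :=
  1 - projAt φ m

theorem coprojAt_apply (m : Fin (n + 1)) (ψ : NParticle (n + 1)) :
    coprojAt φ m ψ = ψ - projAt φ m ψ := rfl

theorem projAt_add_coprojAt (m : Fin (n + 1)) (ψ : NParticle (n + 1)) :
    projAt φ m ψ + coprojAt φ m ψ = ψ := by rw [coprojAt_apply, add_sub_cancel]

theorem inner_coprojAt (m : Fin (n + 1)) (ψ χ : NParticle (n + 1)) :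
    inner ℂ (coprojAt φ m ψ) χ = inner ℂ ψ (coprojAt φ m χ) := by
  rw [coprojAt_apply, coprojAt_apply, inner_sub_left, inner_sub_right, inner_projAt]

theorem projAt_coprojAt_comm (m m' : Fin (n + 1)) (ψ : NParticle (n + 1)) :
    projAt φ m (coprojAt φ m' ψ) = coprojAt φ m' (projAt φ m ψ) := by
  rw [coprojAt_apply, coprojAt_apply, map_sub, projAt_comm]

theorem coprojAt_comm (m m' : Fin (n + 1)) (ψ : NParticle (n + 1)) :
    coprojAt φ m (coprojAt φ m' ψ) = coprojAt φ m' (coprojAt φ m ψ) := by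
  rw [coprojAt_apply m, coprojAt_apply m, map_sub, projAt_coprojAt_comm]

theorem projAt_coprojAt_self (hφ : Orthonormal ℂ φ) (m : Fin (n + 1)) (ψ : NParticle (n + 1)) :
    projAt φ m (coprojAt φ m ψ) = 0 := by
  rw [coprojAt_apply, map_sub, projAt_projAt hφ, sub_self]

theorem coprojAt_projAt_self (hφ : Orthonormal ℂ φ) (m : Fin (n + 1)) (ψ : NParticle (n + 1)) :
    coprojAt φ m (projAt φ m ψ) = 0 := by
  rw [← projAt_coprojAt_comm, projAt_coprojAt_self hφ]

theorem coprojAt_coprojAt (hφ : Orthonormal ℂ φ) (m : Fin (n + 1)) (ψ : NParticle (n + 1)) :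
    coprojAt φ m (coprojAt φ m ψ) = coprojAt φ m ψ := by
  rw [coprojAt_apply, projAt_coprojAt_self hφ, sub_zero]

theorem norm_projAt_sq_add (hφ : Orthonormal ℂ φ) (m : Fin (n + 1)) (ψ : NParticle (n + 1)) :
    ‖projAt φ m ψ‖ ^ 2 + ‖coprojAt φ m ψ‖ ^ 2 = ‖ψ‖ ^ 2 := by
  have h : inner ℂ (projAt φ m ψ) (coprojAt φ m ψ) = 0 := by
    rw [inner_projAt, projAt_coprojAt_self hφ, inner_zero_right]
  have := norm_add_sq_eq_norm_sq_add_norm_sq_of_inner_eq_zero _ _ h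
  rw [projAt_add_coprojAt] at this
  rw [sq, sq, sq, this]

theorem norm_projAt_le (hφ : Orthonormal ℂ φ) (m : Fin (n + 1)) (ψ : NParticle (n + 1)) :
    ‖projAt φ m ψ‖ ≤ ‖ψ‖ :=
  le_of_sq_le_sq (by nlinarith [norm_projAt_sq_add hφ m ψ, sq_nonneg ‖coprojAt φ m ψ‖])
    (norm_nonneg _)

theorem norm_coprojAt_le (hφ : Orthonormal ℂ φ) (m : Fin (n + 1)) (ψ : NParticle (n + 1)) :
    ‖coprojAt φ m ψ‖ ≤ ‖ψ‖ :=
  le_of_sq_le_sq (by nlinarith [norm_projAt_sq_add hφ m ψ, sq_nonneg ‖projAt φ m ψ‖])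
    (norm_nonneg _)

theorem permL_coprojAt (j k m : Fin (n + 1)) (ψ : NParticle (n + 1)) :
    permL (Equiv.swap j k) (coprojAt φ m ψ) =
      coprojAt φ (Equiv.swap j k m) (permL (Equiv.swap j k) ψ) := by
  rw [coprojAt_apply, coprojAt_apply, map_sub, permL_projAt]

/-- The operator `∑ q_m`, which counts the particles outside of the orbitals. -/
def numberL (n : ℕ) (φ : ι → OneParticle) : NParticle (n + 1) →L[ℂ] NParticle (n + 1) :=
  ∑ m, coprojAt φ m

theorem numberL_apply (ψ : NParticle (n + 1)) : numberL n φ ψ = ∑ m, coprojAt φ m ψ := by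
  simp [numberL]

theorem inner_numberL (ψ χ : NParticle (n + 1)) :
    inner ℂ (numberL n φ ψ) χ = inner ℂ ψ (numberL n φ χ) := by
  simp only [numberL_apply, sum_inner, inner_sum, inner_coprojAt]

theorem permL_numberL (j k : Fin (n + 1)) (ψ : NParticle (n + 1)) :
    permL (Equiv.swap j k) (numberL n φ ψ) = numberL n φ (permL (Equiv.swap j k) ψ) := by
  simp only [numberL_apply, map_sum, permL_coprojAt]
  exact Equiv.sum_comp (Equiv.swap j k) fun m => coprojAt φ m (permL (Equiv.swap j k) ψ)

theorem numberL_coprojAt (m : Fin (n + 1)) (ψ : NParticle (n + 1)) :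
    numberL n φ (coprojAt φ m ψ) = coprojAt φ m (numberL n φ ψ) := by
  simp only [numberL_apply, map_sum, coprojAt_comm m]

theorem numberL_projAt (m : Fin (n + 1)) (ψ : NParticle (n + 1)) :
    numberL n φ (projAt φ m ψ) = projAt φ m (numberL n φ ψ) := by
  simp only [numberL_apply, map_sum, projAt_coprojAt_comm m]

/-- The component of `ψ` with exactly `k` particles outside of the orbitals. -/
def sector (φ : ι → OneParticle) (k : ℕ) (ψ : NParticle (n + 1)) : NParticle (n + 1) :=
  countingSector (projAt φ) k ψ

theorem sum_sector (hφ : Orthonormal ℂ φ) (ψ : NParticle (n + 1)) :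
    ∑ k ∈ Finset.range (n + 2), sector φ k ψ = ψ := by
  have := DFunLike.congr_fun (countingSector_projAt (n := n) hφ).1 ψ
  rwa [sum_apply] at this

theorem numberL_sector (hφ : Orthonormal ℂ φ) (k : ℕ) (ψ : NParticle (n + 1)) :
    numberL n φ (sector φ k ψ) = (k : ℂ) • sector φ k ψ := by
  have := DFunLike.congr_fun ((countingSector_projAt (n := n) hφ).2 k) ψ
  rw [← nsmul_eq_mul, smul_apply, ← Nat.cast_smul_eq_nsmul ℂ] at this
  exact this

theorem inner_eq_zero_of_numberL {k l : ℕ} (hkl : k ≠ l) {x y : NParticle (n + 1)}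
    (hx : numberL n φ x = (k : ℂ) • x) (hy : numberL n φ y = (l : ℂ) • y) : inner ℂ x y = 0 := by
  have h := inner_numberL (φ := φ) x y
  rw [hx, hy, inner_smul_left, inner_smul_right, Complex.conj_natCast, ← sub_eq_zero, ← sub_mul,
    mul_eq_zero, sub_eq_zero] at h
  exact h.resolve_left fun h => hkl (by exact_mod_cast h)

theorem norm_sum_sq_of_numberL {x : ℕ → NParticle (n + 1)}
    (hx : ∀ k, numberL n φ (x k) = (k : ℂ) • x k) (s : Finset ℕ) :
    ‖∑ k ∈ s, x k‖ ^ 2 = ∑ k ∈ s, ‖x k‖ ^ 2 := by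
  have h : inner ℂ (∑ k ∈ s, x k) (∑ k ∈ s, x k) = ((∑ k ∈ s, ‖x k‖ ^ 2 : ℝ) : ℂ) := by
    rw [sum_inner]
    push_cast
    refine Finset.sum_congr rfl fun k hk => ?_
    rw [inner_sum, Finset.sum_eq_single k]
    · exact inner_self_eq_norm_sq_to_K _
    · exact fun l _ hlk => inner_eq_zero_of_numberL hlk.symm (hx k) (hx l)
    · exact fun h => (h hk).elim
  have := congrArg Complex.re h
  rw [Complex.ofReal_re] at this
  rw [← this]
  exact (inner_self_eq_norm_sq (𝕜 := ℂ) _).symm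

/-- Transpositions commute with the number operator, so each sum of a sector component and its
transposed copy is again an eigenvector with eigenvalue k. These vectors are mutually orthogonal and
add up to zero, hence each vanishes. -/
theorem isAntisymmetric_sector (hφ : Orthonormal ℂ φ) {ψ : NParticle (n + 1)}
    (h : IsAntisymmetric ψ) (k : ℕ) (hk : k ∈ Finset.range (n + 2)) :
    IsAntisymmetric (sector φ k ψ) := by
  rw [isAntisymmetric_iff] at h ⊢
  intro i j hij
  have h1 : ∑ k ∈ Finset.range (n + 2),
      (permL (Equiv.swap i j) (sector φ k ψ) + sector φ k ψ) = 0 := by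
    rw [Finset.sum_add_distrib, ← map_sum, sum_sector hφ, h i j hij, neg_add_cancel]
  have h2 := norm_sum_sq_of_numberL (φ := φ)
    (x := fun k => permL (Equiv.swap i j) (sector φ k ψ) + sector φ k ψ) (fun k => by
      rw [map_add, ← permL_numberL, numberL_sector hφ, map_smul, smul_add]) (Finset.range (n + 2))
  rw [h1, norm_zero, zero_pow two_ne_zero] at h2
  have h3 := (Finset.sum_eq_zero_iff_of_nonneg fun k _ => sq_nonneg _).1 h2.symm k hk
  exact eq_neg_of_add_eq_zero_left (norm_eq_zero.1 (pow_eq_zero_iff two_ne_zero |>.1 h3))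

theorem sum_norm_sector_sq (hφ : Orthonormal ℂ φ) (ψ : NParticle (n + 1)) :
    ∑ k ∈ Finset.range (n + 2), ‖sector φ k ψ‖ ^ 2 = ‖ψ‖ ^ 2 := by
  rw [← norm_sum_sq_of_numberL (fun k => numberL_sector hφ k ψ), sum_sector hφ]

theorem sum_norm_coprojAt_sector_sq (hφ : Orthonormal ℂ φ) (m : Fin (n + 1))
    (ψ : NParticle (n + 1)) :
    ∑ k ∈ Finset.range (n + 2), ‖coprojAt φ m (sector φ k ψ)‖ ^ 2 = ‖coprojAt φ m ψ‖ ^ 2 := by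
  rw [← norm_sum_sq_of_numberL (φ := φ) (fun k => by
    rw [numberL_coprojAt, numberL_sector hφ, map_smul]), ← map_sum, sum_sector hφ]

theorem norm_coprojAt_sq (hφ : Orthonormal ℂ φ) (m : Fin (n + 1)) (ψ : NParticle (n + 1)) :
    ((‖coprojAt φ m ψ‖ ^ 2 : ℝ) : ℂ) = inner ℂ ψ (coprojAt φ m ψ) := (inner_sub_projAt hφ m ψ).symm

theorem sum_norm_coprojAt_sq (hφ : Orthonormal ℂ φ) {k : ℕ} {x : NParticle (n + 1)}
    (hx : numberL n φ x = (k : ℂ) • x) : ∑ m, ‖coprojAt φ m x‖ ^ 2 = k * ‖x‖ ^ 2 := by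
  have h : ((∑ m : Fin (n + 1), ‖coprojAt φ m x‖ ^ 2 : ℝ) : ℂ) = ((k * ‖x‖ ^ 2 : ℝ) : ℂ) := by
    rw [Complex.ofReal_sum, Finset.sum_congr rfl fun m _ => norm_coprojAt_sq hφ m x, ← inner_sum,
      ← numberL_apply, hx, inner_smul_right, inner_self_eq_norm_sq_to_K]
    push_cast
    rfl
  exact_mod_cast h

theorem sum_mul_norm_sector_sq (hφ : Orthonormal ℂ φ) (ψ : NParticle (n + 1)) :
    ∑ k ∈ Finset.range (n + 2), (k : ℝ) * ‖sector φ k ψ‖ ^ 2 = ∑ m, ‖coprojAt φ m ψ‖ ^ 2 := by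
  rw [Finset.sum_congr rfl fun k _ => (sum_norm_coprojAt_sq hφ (numberL_sector hφ k ψ)).symm,
    Finset.sum_comm]
  exact Finset.sum_congr rfl fun m _ => sum_norm_coprojAt_sector_sq hφ m ψ

/-! ### The pair interaction and the projections -/

variable (hu : IsBddMeas u)

theorem inner_pairL (m : Fin (n + 1)) (a b : NParticle (n + 1)) :
    inner ℂ (pairL u hu m a) b = inner ℂ a (pairL u hu m b) := inner_mulL_left _ _ _

theorem pairL_projAt {j m : Fin (n + 1)} (hj0 : j ≠ 0) (hjm : j ≠ m) (a : NParticle (n + 1)) :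
    pairL u hu m (projAt φ j a) = projAt φ j (pairL u hu m a) := by
  obtain ⟨i, hi⟩ := Fin.exists_succAbove_eq hj0.symm
  obtain ⟨k, hk⟩ := Fin.exists_succAbove_eq hjm.symm
  refine mulL_projAt _ (isBddMeas_pair hu i k) j (fun x => ?_) a
  rw [← hi, ← hk]
  rfl

theorem pairL_coprojAt {j m : Fin (n + 1)} (hj0 : j ≠ 0) (hjm : j ≠ m) (a : NParticle (n + 1)) :
    pairL u hu m (coprojAt φ j a) = coprojAt φ j (pairL u hu m a) := by
  rw [coprojAt_apply, coprojAt_apply, map_sub, pairL_projAt hu hj0 hjm]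

theorem permL_pairL (he : ∀ x, u (-x) = u x) (m : Fin (n + 1)) (a : NParticle (n + 1)) :
    permL (Equiv.swap 0 m) (pairL u hu m a) = pairL u hu m (permL (Equiv.swap 0 m) a) := by
  refine permL_mulL _ _ _ (fun x => ?_) a
  rw [Function.comp_apply, Function.comp_apply, Equiv.swap_apply_left, Equiv.swap_apply_right,
    ← he, neg_sub]

/-- The pair interaction changes the number of excitations only in the two variables it acts on. -/
theorem inner_coprojAt_pairL_projAt_eq_zero (hφ : Orthonormal ℂ φ) {m : Fin (n + 1)} (hm : m ≠ 0)
    {k l : ℕ} (hkl : l ≠ k + 2) {x y : NParticle (n + 1)} (hx : numberL n φ x = (l : ℂ) • x)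
    (hy : numberL n φ y = (k : ℂ) • y) :
    inner ℂ (coprojAt φ m (coprojAt φ 0 x)) (pairL u hu m (projAt φ m (projAt φ 0 y))) = 0 := by
  set X := coprojAt φ m (coprojAt φ 0 x) with hX
  set Y := projAt φ m (projAt φ 0 y) with hY
  have hNX : numberL n φ X = (l : ℂ) • X := by
    rw [hX, numberL_coprojAt, numberL_coprojAt, hx, map_smul, map_smul]
  have hNY : numberL n φ Y = (k : ℂ) • Y := by
    rw [hY, numberL_projAt, numberL_projAt, hy, map_smul, map_smul]
  -- The excitations among the particles other than 0 and m are counted by an operator commuting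
  -- with the interaction. It has eigenvalue l - 2 on `X`, where both 0 and m are excited, and k on
  -- `Y`, where neither is.
  let s : Finset (Fin (n + 1)) := (Finset.univ.erase 0).erase m
  have hm' : m ∈ (Finset.univ : Finset (Fin (n + 1))).erase 0 :=
    Finset.mem_erase.2 ⟨hm, Finset.mem_univ _⟩
  have hsum : ∀ z : NParticle (n + 1), numberL n φ z =
      coprojAt φ 0 z + (coprojAt φ m z + ∑ j ∈ s, coprojAt φ j z) := fun z => by
    rw [numberL_apply, ← Finset.add_sum_erase _ _ (Finset.mem_univ 0), ← Finset.add_sum_erase _ _ hm']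
  have h1 : ∑ j ∈ s, coprojAt φ j X = ((l : ℂ) - 2) • X := by
    have h := hsum X
    rw [hNX, hX, coprojAt_coprojAt hφ, coprojAt_comm m 0, coprojAt_coprojAt hφ,
      ← coprojAt_comm m 0, ← hX] at h
    rw [sub_smul, two_smul, h]
    abel
  have h2 : ∑ j ∈ s, coprojAt φ j Y = (k : ℂ) • Y := by
    have h := hsum Y
    rw [hNY, hY, coprojAt_projAt_self hφ, projAt_comm m 0, coprojAt_projAt_self hφ,
      ← projAt_comm m 0, ← hY, zero_add, zero_add] at h
    exact h.symm
  have h3 : inner ℂ (∑ j ∈ s, coprojAt φ j X) (pairL u hu m Y) =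
      inner ℂ X (pairL u hu m (∑ j ∈ s, coprojAt φ j Y)) := by
    rw [sum_inner, map_sum, inner_sum]
    refine Finset.sum_congr rfl fun j hj => ?_
    rw [inner_coprojAt, pairL_coprojAt hu (Finset.ne_of_mem_erase (Finset.mem_of_mem_erase hj))
      (Finset.ne_of_mem_erase hj)]
  rw [h1, h2, inner_smul_left, map_smul, inner_smul_right, map_sub, Complex.conj_natCast,
    Complex.conj_ofNat, ← sub_eq_zero, ← sub_mul, mul_eq_zero] at h3
  refine h3.resolve_left fun h => hkl ?_
  have : (l : ℂ) = ((k + 2 : ℕ) : ℂ) := by push_cast; linear_combination h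
  exact_mod_cast this

end

/-! ### The four terms of the derivative, for bounded interactions. -/

section

variable {n : ℕ} {φ : Fin (n + 1) → OneParticle} {u : Space → ℝ}

/-! ### The estimate of the time derivative for bounded interactions -/

theorem excitation_eq (φ : Fin (n + 1) → OneParticle) (ψ : NParticle (n + 1)) :
    excitation φ ψ = ‖coprojAt φ 0 ψ‖ ^ 2 := rfl

theorem mul_le_young {X Y τ : ℝ} (hτ : 0 < τ) : X * Y ≤ (τ * X ^ 2 + τ⁻¹ * Y ^ 2) / 2 := by
  have h : τ * (τ⁻¹ * Y ^ 2) = Y ^ 2 := by field_simp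
  have h2 : 0 ≤ τ⁻¹ * (τ * X - Y) ^ 2 := by positivity
  have h3 : τ⁻¹ * (τ * X - Y) ^ 2 = τ * X ^ 2 + τ⁻¹ * Y ^ 2 - 2 * (X * Y) := by field_simp; ring
  linarith

theorem sum_norm_coprojAt_sq_of_isAntisymmetric {ψ : NParticle (n + 1)}
    (h : IsAntisymmetric ψ) : ∑ m, ‖coprojAt φ m ψ‖ ^ 2 = ((n : ℝ) + 1) * excitation φ ψ := by
  rw [Finset.sum_congr rfl fun m _ => by
    rw [coprojAt_apply, norm_sub_projAt_of_isAntisymmetric h m], Finset.sum_const,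
    Finset.card_univ, Fintype.card_fin, nsmul_eq_mul]
  push_cast
  rfl

/-- Exchanging particles 0 and m interchanges the two entries, with signs that cancel, and preserves
the even interaction. The matrix element therefore equals its conjugate. -/
theorem im_inner_projAt_coprojAt_eq_zero (hu : IsBddMeas u)
    {ψ : NParticle (n + 1)} (hψ : IsAntisymmetric ψ) (he : ∀ x, u (-x) = u x) {m : Fin (n + 1)}
    (hm : m ≠ 0) :
    (inner ℂ (projAt φ m (coprojAt φ 0 ψ)) (pairL u hu m (coprojAt φ m (projAt φ 0 ψ)))).im = 0 := by
  rw [← Complex.conj_eq_iff_im, inner_conj_symm, inner_pairL]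
  rw [← (permL (Equiv.swap 0 m)).inner_map_map, permL_pairL hu he, permL_coprojAt, permL_projAt,
    permL_projAt, permL_coprojAt, Equiv.swap_apply_left, Equiv.swap_apply_right,
    isAntisymmetric_iff.1 hψ 0 m hm.symm]
  simp only [map_neg, inner_neg_left, inner_neg_right, neg_neg, projAt_coprojAt_comm]

section

variable (hφ : Orthonormal ℂ φ) (hu : IsBddMeas u) {κ : ℝ} (hκ : 0 < κ)
  (hK : ∀ z, ∫ y, u (z - y) ^ 2 * ∑ j, ‖φ j y‖ ^ 2 ≤ κ ^ 2 / (n + 1))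
  {ψ : NParticle (n + 1)} (hψ : IsAntisymmetric ψ)
include hφ hu hκ hK hψ

theorem norm_sum_inner_proj_proj_le
    (hV : IsBddMeas fun x : Config (n + 1) => ∫ y, u (x 0 - y) * ∑ j, ‖φ j y‖ ^ 2) :
    ‖∑ m ∈ Finset.univ.erase 0, inner ℂ (projAt φ m (coprojAt φ 0 ψ))
        (pairL u hu m (projAt φ m (projAt φ 0 ψ))) -
      inner ℂ (coprojAt φ 0 ψ) (mulL _ hV (projAt φ 0 ψ))‖ ≤
      κ * (excitation φ ψ + ‖ψ‖ ^ 2 / (2 * (n + 1))) := by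
  have hN : (0 : ℝ) < n + 1 := by positivity
  -- The choice τ = N/κ balances τ K α = κ α against the hole term, which is κ/N times at most ‖ψ‖²
  -- + N α.
  refine (norm_sum_inner_pairL_sub_le hφ hu hK hV (coprojAt φ 0 ψ) hψ.exclusive.projAt
    (show (0 : ℝ) < (n + 1) / κ by positivity)).trans ?_
  rw [← excitation_eq, Fintype.card_fin]
  have h1 : ∀ m, (inner ℂ (projAt φ 0 ψ) (projAt φ m (projAt φ 0 ψ))).re =
      ‖projAt φ 0 ψ‖ ^ 2 - ‖coprojAt φ m (projAt φ 0 ψ)‖ ^ 2 := fun m => by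
    have e := congrArg Complex.re (norm_coprojAt_sq hφ m (projAt φ 0 ψ))
    rw [Complex.ofReal_re, coprojAt_apply m, inner_sub_right, Complex.sub_re,
      ← coprojAt_apply] at e
    have e2 : (inner ℂ (projAt φ 0 ψ) (projAt φ 0 ψ)).re = ‖projAt φ 0 ψ‖ ^ 2 :=
      inner_self_eq_norm_sq (𝕜 := ℂ) _
    linarith
  have h2 : ∑ m ∈ (Finset.univ : Finset (Fin (n + 1))).erase 0,
      ‖coprojAt φ m (projAt φ 0 ψ)‖ ^ 2 ≤ n * excitation φ ψ := by
    have : ∀ m ∈ (Finset.univ : Finset (Fin (n + 1))).erase 0,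
        ‖coprojAt φ m (projAt φ 0 ψ)‖ ^ 2 ≤ excitation φ ψ := fun m _ => by
      rw [← projAt_coprojAt_comm, excitation, ← norm_sub_projAt_of_isAntisymmetric hψ m]
      exact pow_le_pow_left₀ (norm_nonneg _) (norm_projAt_le hφ 0 _) 2
    refine (Finset.sum_le_card_nsmul _ _ _ this).trans ?_
    rw [Finset.card_erase_of_mem (Finset.mem_univ _), Finset.card_univ, Fintype.card_fin,
      Nat.add_sub_cancel, nsmul_eq_mul]
  have h3 : ‖projAt φ 0 ψ‖ ^ 2 ≤ ‖ψ‖ ^ 2 :=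
    pow_le_pow_left₀ (norm_nonneg _) (norm_projAt_le hφ 0 ψ) 2
  -- There are N orbitals but only n = N - 1 other particles. The surplus ‖p_0 ψ‖² is the
  -- unavoidable hole and produces the error of order 1/N; the remaining holes are excitations of
  -- the other particles.
  have h4 : ((n + 1 : ℕ) : ℝ) * ‖projAt φ 0 ψ‖ ^ 2 - ∑ m ∈ Finset.univ.erase 0,
      (inner ℂ (projAt φ 0 ψ) (projAt φ m (projAt φ 0 ψ))).re ≤ ‖ψ‖ ^ 2 + n * excitation φ ψ := by
    rw [Finset.sum_congr rfl fun m _ => h1 m, Finset.sum_sub_distrib, Finset.sum_const,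
      Finset.card_erase_of_mem (Finset.mem_univ _), Finset.card_univ, Fintype.card_fin,
      Nat.add_sub_cancel, nsmul_eq_mul]
    push_cast
    linarith
  have hα : 0 ≤ excitation φ ψ := sq_nonneg _
  calc _ ≤ ((n + 1) / κ * (κ ^ 2 / (n + 1) * excitation φ ψ) +
        ((n + 1) / κ)⁻¹ * (‖ψ‖ ^ 2 + n * excitation φ ψ)) / 2 := by gcongr
    _ ≤ ((n + 1) / κ * (κ ^ 2 / (n + 1) * excitation φ ψ) +
        ((n + 1) / κ)⁻¹ * (‖ψ‖ ^ 2 + (n + 1) * excitation φ ψ)) / 2 := by gcongr; linarith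
    _ = _ := by field_simp; ring

/-- No p_m stands next to the interaction, but exchanging 0 and m replaces q_m p_0 ψ by p_m q_0 ψ
without changing the norm. The summed bound then applies to q_0 ψ, whose squared norm is the
excitation. -/
theorem norm_sum_inner_coproj_coproj_le (he : ∀ x, u (-x) = u x) :
    ‖∑ m ∈ Finset.univ.erase 0, inner ℂ (coprojAt φ m (coprojAt φ 0 ψ))
        (pairL u hu m (coprojAt φ m (projAt φ 0 ψ)))‖ ≤ κ * excitation φ ψ := by
  have hN : (0 : ℝ) < n + 1 := by positivity
  have hα : 0 ≤ excitation φ ψ := sq_nonneg _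
  have h0 : ∀ m ∈ (Finset.univ : Finset (Fin (n + 1))).erase 0,
      ‖pairL u hu m (coprojAt φ m (projAt φ 0 ψ))‖ = ‖pairL u hu m (projAt φ m (coprojAt φ 0 ψ))‖ := by
    intro m hm
    rw [← (permL (Equiv.swap 0 m)).norm_map, permL_pairL hu he, permL_coprojAt, permL_projAt,
      Equiv.swap_apply_left, Equiv.swap_apply_right,
      isAntisymmetric_iff.1 hψ 0 m (Finset.ne_of_mem_erase hm).symm, map_neg, map_neg, map_neg,
      norm_neg, projAt_coprojAt_comm]
  have h1 : ∀ m ∈ (Finset.univ : Finset (Fin (n + 1))).erase 0,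
      ‖inner ℂ (coprojAt φ m (coprojAt φ 0 ψ)) (pairL u hu m (coprojAt φ m (projAt φ 0 ψ)))‖ ≤
        (κ / (n + 1) * excitation φ ψ +
          (κ / (n + 1))⁻¹ * ‖pairL u hu m (projAt φ m (coprojAt φ 0 ψ))‖ ^ 2) / 2 := by
    intro m hm
    refine (norm_inner_le_norm _ _).trans ?_
    rw [h0 m hm]
    refine (mul_le_young (show (0 : ℝ) < κ / (n + 1) by positivity)).trans ?_
    have : ‖coprojAt φ m (coprojAt φ 0 ψ)‖ ^ 2 ≤ excitation φ ψ :=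
      pow_le_pow_left₀ (norm_nonneg _) (norm_coprojAt_le hφ m _) 2
    gcongr
  refine (norm_sum_le_of_le _ h1).trans ?_
  have h2 := sum_norm_pairL_sq_le hφ hu hK (Exclusive.sub_projAt (φ := φ) hψ.exclusive)
  rw [← excitation, ← coprojAt_apply] at h2
  rw [← Finset.sum_div, Finset.sum_add_distrib, Finset.sum_const, ← Finset.mul_sum,
    Finset.card_erase_of_mem (Finset.mem_univ _), Finset.card_univ, Fintype.card_fin,
    Nat.add_sub_cancel, nsmul_eq_mul]
  calc _ ≤ (n * (κ / (n + 1) * excitation φ ψ) +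
        (κ / (n + 1))⁻¹ * (κ ^ 2 / (n + 1) * excitation φ ψ)) / 2 := by gcongr
    _ ≤ ((n + 1) * (κ / (n + 1) * excitation φ ψ) +
        (κ / (n + 1))⁻¹ * (κ ^ 2 / (n + 1) * excitation φ ψ)) / 2 := by gcongr; linarith
    _ = _ := by field_simp; ring

/-- The Young weight κ/(k + 1) depends on the sector. Of the k + 2 excitations on the left one is
particle 0, so summing ‖q_m q_0 ·‖² over m ≠ 0 gives a factor k + 1, which the weight cancels; on
the right it reappears as (k + 1)/N. -/
theorem sum_norm_inner_sector_le {k : ℕ} (hk : k ∈ Finset.range (n + 2)) :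
    ∑ m ∈ Finset.univ.erase 0, ‖inner ℂ (coprojAt φ m (coprojAt φ 0 (sector φ (k + 2) ψ)))
        (pairL u hu m (projAt φ m (projAt φ 0 (sector φ k ψ))))‖ ≤
      κ / 2 * ‖coprojAt φ 0 (sector φ (k + 2) ψ)‖ ^ 2 +
        κ / 2 * ((k + 1) / (n + 1) * ‖sector φ k ψ‖ ^ 2) := by
  have hN : (0 : ℝ) < n + 1 := by positivity
  have h1 : ∀ m ∈ (Finset.univ : Finset (Fin (n + 1))).erase 0,
      ‖inner ℂ (coprojAt φ m (coprojAt φ 0 (sector φ (k + 2) ψ)))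
        (pairL u hu m (projAt φ m (projAt φ 0 (sector φ k ψ))))‖ ≤
      (κ / (k + 1) * ‖coprojAt φ m (coprojAt φ 0 (sector φ (k + 2) ψ))‖ ^ 2 +
        (κ / (k + 1))⁻¹ * ‖pairL u hu m (projAt φ m (projAt φ 0 (sector φ k ψ)))‖ ^ 2) / 2 :=
    fun m _ => (norm_inner_le_norm _ _).trans (mul_le_young (by positivity))
  refine (Finset.sum_le_sum h1).trans ?_
  rw [← Finset.sum_div, Finset.sum_add_distrib, ← Finset.mul_sum, ← Finset.mul_sum]
  have h2 : ∑ m ∈ (Finset.univ : Finset (Fin (n + 1))).erase 0,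
      ‖coprojAt φ m (coprojAt φ 0 (sector φ (k + 2) ψ))‖ ^ 2 =
        (k + 1) * ‖coprojAt φ 0 (sector φ (k + 2) ψ)‖ ^ 2 := by
    have h := sum_norm_coprojAt_sq hφ (k := k + 2) (x := coprojAt φ 0 (sector φ (k + 2) ψ)) (by
      rw [numberL_coprojAt, numberL_sector hφ, map_smul])
    rw [← Finset.add_sum_erase _ _ (Finset.mem_univ 0), coprojAt_coprojAt hφ] at h
    push_cast at h
    linarith
  have h3 := sum_norm_pairL_sq_le hφ hu hK
    (Exclusive.projAt (φ := φ) (isAntisymmetric_sector hφ hψ k hk).exclusive)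
  have h4 : ‖projAt φ 0 (sector φ k ψ)‖ ^ 2 ≤ ‖sector φ k ψ‖ ^ 2 :=
    pow_le_pow_left₀ (norm_nonneg _) (norm_projAt_le hφ 0 _) 2
  rw [h2]
  calc _ ≤ (κ / (k + 1) * ((k + 1) * ‖coprojAt φ 0 (sector φ (k + 2) ψ)‖ ^ 2) +
        (κ / (k + 1))⁻¹ * (κ ^ 2 / (n + 1) * ‖sector φ k ψ‖ ^ 2)) / 2 := by
        gcongr
        exact h3.trans (by gcongr)
    _ = _ := by field_simp

/-- The right-hand side contains no excitation, so a direct Cauchy–Schwarz bound would only give √α.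
Splitting into sectors, only k → k + 2 contributes, and the factor (k + 1)/N on the right sums to α
+ ‖ψ‖²/N because the sum of k ‖ψ_k‖² is N α. -/
theorem norm_sum_inner_coproj_proj_le :
    ‖∑ m ∈ Finset.univ.erase 0, inner ℂ (coprojAt φ m (coprojAt φ 0 ψ))
        (pairL u hu m (projAt φ m (projAt φ 0 ψ)))‖ ≤
      κ * (excitation φ ψ + ‖ψ‖ ^ 2 / (2 * (n + 1))) := by
  have hN : (0 : ℝ) < n + 1 := by positivity
  let B : ℕ → ℕ → Fin (n + 1) → ℂ := fun k l m =>
    inner ℂ (coprojAt φ m (coprojAt φ 0 (sector φ l ψ)))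
      (pairL u hu m (projAt φ m (projAt φ 0 (sector φ k ψ))))
  let R := Finset.range (n + 2)
  have e : ∑ m ∈ Finset.univ.erase 0, inner ℂ (coprojAt φ m (coprojAt φ 0 ψ))
      (pairL u hu m (projAt φ m (projAt φ 0 ψ))) =
      ∑ k ∈ R, ∑ l ∈ R, ∑ m ∈ Finset.univ.erase 0, B k l m := by
    have : ∀ m, inner ℂ (coprojAt φ m (coprojAt φ 0 ψ))
        (pairL u hu m (projAt φ m (projAt φ 0 ψ))) = ∑ k ∈ R, ∑ l ∈ R, B k l m := fun m => by
      conv_lhs => rw [← sum_sector hφ ψ]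
      simp only [map_sum, inner_sum, sum_inner]
      rfl
    simp only [this]
    rw [Finset.sum_comm]
    exact Finset.sum_congr rfl fun k _ => Finset.sum_comm
  -- The condition `k = l - 2` uses truncated subtraction: every l meets at most one k, and the
  -- spurious cases l < 2 only add nonnegative terms.
  have hb : ∀ k ∈ R, ∀ l ∈ R, ‖∑ m ∈ Finset.univ.erase 0, B k l m‖ ≤
      (if k = l - 2 then κ / 2 * ‖coprojAt φ 0 (sector φ l ψ)‖ ^ 2 else 0) +
        (if l = k + 2 then κ / 2 * ((k + 1) / (n + 1) * ‖sector φ k ψ‖ ^ 2) else 0) := by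
    intro k hk l _
    by_cases hl : l = k + 2
    · subst hl
      rw [if_pos (by simp), if_pos rfl]
      exact (norm_sum_le _ _).trans (sum_norm_inner_sector_le hφ hu hκ hK hψ hk)
    · rw [Finset.sum_eq_zero fun m hm => inner_coprojAt_pairL_projAt_eq_zero hu hφ
        (Finset.ne_of_mem_erase hm) hl (numberL_sector hφ l ψ) (numberL_sector hφ k ψ), norm_zero]
      exact add_nonneg (by split_ifs <;> positivity) (by rw [if_neg hl])
  rw [e]
  refine (norm_sum_le_of_le _ fun k hk => norm_sum_le_of_le _ (hb k hk)).trans ?_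
  simp only [Finset.sum_add_distrib]
  have h1 : ∑ k ∈ R, ∑ l ∈ R, (if k = l - 2 then κ / 2 * ‖coprojAt φ 0 (sector φ l ψ)‖ ^ 2 else 0) ≤
      κ / 2 * excitation φ ψ := by
    rw [Finset.sum_comm, excitation_eq, ← sum_norm_coprojAt_sector_sq hφ, Finset.mul_sum]
    refine Finset.sum_le_sum fun l _ => ?_
    rw [Finset.sum_ite_eq']
    split_ifs
    · exact le_rfl
    · positivity
  have h2 : ∑ k ∈ R, ∑ l ∈ R,
      (if l = k + 2 then κ / 2 * ((k + 1) / (n + 1) * ‖sector φ k ψ‖ ^ 2) else 0) ≤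
      κ / 2 * (excitation φ ψ + ‖ψ‖ ^ 2 / (n + 1)) := by
    have h3 : ∀ k ∈ R, ∑ l ∈ R,
        (if l = k + 2 then κ / 2 * ((k + 1) / (n + 1) * ‖sector φ k ψ‖ ^ 2) else 0) ≤
        κ / 2 * (((k : ℝ) * ‖sector φ k ψ‖ ^ 2 + ‖sector φ k ψ‖ ^ 2) / (n + 1)) := fun k _ => by
      rw [Finset.sum_ite_eq']
      have : κ / 2 * (((k : ℝ) + 1) / (n + 1) * ‖sector φ k ψ‖ ^ 2) =
        κ / 2 * (((k : ℝ) * ‖sector φ k ψ‖ ^ 2 + ‖sector φ k ψ‖ ^ 2) / (n + 1)) := by ring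
      rw [← this]
      split_ifs
      · exact le_rfl
      · positivity
    refine (Finset.sum_le_sum h3).trans ?_
    rw [← Finset.mul_sum, ← Finset.sum_div, Finset.sum_add_distrib, sum_norm_sector_sq hφ,
      sum_mul_norm_sector_sq hφ, sum_norm_coprojAt_sq_of_isAntisymmetric hψ]
    refine le_of_eq ?_
    field_simp
  refine (add_le_add h1 h2).trans (le_of_eq ?_)
  field_simp
  ring

/-- The estimate of the time derivative of the number of excitations, for bounded interactions. -/
theorem abs_im_inner_pairL_sub_le (he : ∀ x, u (-x) = u x)
    (hV : IsBddMeas fun x : Config (n + 1) => ∫ y, u (x 0 - y) * ∑ j, ‖φ j y‖ ^ 2) :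
    |(∑ m ∈ Finset.univ.erase 0, inner ℂ ψ (pairL u hu m (projAt φ 0 ψ)) -
      inner ℂ ψ (mulL _ hV (projAt φ 0 ψ))).im| ≤
      3 * κ * (excitation φ ψ + ‖ψ‖ ^ 2 / (n + 1)) := by
  have hN : (0 : ℝ) < n + 1 := by positivity
  set a := coprojAt φ 0 ψ with ha
  set b := projAt φ 0 ψ with hb
  have hψab : ψ = b + a := (projAt_add_coprojAt 0 ψ).symm
  -- With ψ = p_0 ψ + q_0 ψ, the part ⟨p_0 ψ, S p_0 ψ⟩ is real for symmetric S, so only q_0 ψ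
  -- survives on the left.
  have hreal : ∀ (S : NParticle (n + 1) →L[ℂ] NParticle (n + 1)),
      (∀ x y, inner ℂ (S x) y = inner ℂ x (S y)) →
      (inner ℂ ψ (S b)).im = (inner ℂ a (S b)).im := fun S hS => by
    have h0 : (inner ℂ b (S b)).im = 0 := by
      rw [← Complex.conj_eq_iff_im, inner_conj_symm, hS]
    conv_lhs => rw [hψab, inner_add_left, Complex.add_im, h0, zero_add]
  have e1 : (∑ m ∈ Finset.univ.erase 0, inner ℂ ψ (pairL u hu m b) - inner ℂ ψ (mulL _ hV b)).im =
      (∑ m ∈ Finset.univ.erase 0, inner ℂ a (pairL u hu m b) - inner ℂ a (mulL _ hV b)).im := by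
    rw [Complex.sub_im, Complex.sub_im, Complex.im_sum, Complex.im_sum,
      hreal _ (fun x y => inner_mulL_left hV x y),
      Finset.sum_congr rfl fun m _ => hreal _ (inner_pairL hu m)]
  -- Insert p_m + q_m on both sides; the mean field is subtracted from the term with p_m on both
  -- sides, the only one it has to cancel.
  have e2 : ∑ m ∈ Finset.univ.erase 0, inner ℂ a (pairL u hu m b) - inner ℂ a (mulL _ hV b) =
      (∑ m ∈ Finset.univ.erase 0, inner ℂ (projAt φ m a) (pairL u hu m (projAt φ m b)) -
        inner ℂ a (mulL _ hV b)) +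
      ∑ m ∈ Finset.univ.erase 0, inner ℂ (coprojAt φ m a) (pairL u hu m (coprojAt φ m b)) +
      ∑ m ∈ Finset.univ.erase 0, inner ℂ (coprojAt φ m a) (pairL u hu m (projAt φ m b)) +
      ∑ m ∈ Finset.univ.erase 0, inner ℂ (projAt φ m a) (pairL u hu m (coprojAt φ m b)) := by
    have : ∀ m, inner ℂ a (pairL u hu m b) =
        inner ℂ (projAt φ m a) (pairL u hu m (projAt φ m b)) +
        inner ℂ (coprojAt φ m a) (pairL u hu m (coprojAt φ m b)) +
        inner ℂ (coprojAt φ m a) (pairL u hu m (projAt φ m b)) +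
        inner ℂ (projAt φ m a) (pairL u hu m (coprojAt φ m b)) := fun m => by
      conv_lhs => rw [← projAt_add_coprojAt (φ := φ) m a, ← projAt_add_coprojAt (φ := φ) m b]
      simp only [map_add, inner_add_left, inner_add_right]
      ring
    simp only [this, Finset.sum_add_distrib]
    ring
  have e3 : (∑ m ∈ Finset.univ.erase 0,
      inner ℂ (projAt φ m a) (pairL u hu m (coprojAt φ m b))).im = 0 := by
    rw [Complex.im_sum]
    exact Finset.sum_eq_zero fun m hm =>
      im_inner_projAt_coprojAt_eq_zero hu hψ he (Finset.ne_of_mem_erase hm)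
  rw [e1, e2, Complex.add_im, e3, add_zero]
  refine (Complex.abs_im_le_norm _).trans ((norm_add₃_le).trans ?_)
  have h1 := norm_sum_inner_proj_proj_le hφ hu hκ hK hψ hV
  have h2 := norm_sum_inner_coproj_coproj_le hφ hu hκ hK hψ he
  have h3 := norm_sum_inner_coproj_proj_le hφ hu hκ hK hψ
  refine (add_le_add (add_le_add h1 h2) h3).trans ?_
  have h4 : κ * (excitation φ ψ + ‖ψ‖ ^ 2 / (2 * (n + 1))) + κ * excitation φ ψ +
      κ * (excitation φ ψ + ‖ψ‖ ^ 2 / (2 * (n + 1))) =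
      3 * κ * (excitation φ ψ + ‖ψ‖ ^ 2 / (n + 1)) - 2 * κ * (‖ψ‖ ^ 2 / (n + 1)) := by
    field_simp; ring
  have : 0 ≤ 2 * κ * (‖ψ‖ ^ 2 / (n + 1)) := by positivity
  linarith

end

end

/-! ### Truncation of the interaction, and bounds on the mean field. -/

section

/-! ### Cutting off unbounded functions -/

/-- The function `z ↦ z` cut off to `0` where `|z| > M`. -/
def clip (M : ℕ) (z : ℝ) : ℝ := if |z| ≤ M then z else 0

theorem measurable_clip (M : ℕ) : Measurable (clip M) :=
  Measurable.ite (measurableSet_le measurable_id.abs measurable_const) measurable_id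
    measurable_const

theorem abs_clip_le_abs (M : ℕ) (z : ℝ) : |clip M z| ≤ |z| := by
  unfold clip
  split_ifs
  · exact le_rfl
  · rw [abs_zero]; exact abs_nonneg z

theorem tendsto_clip (z : ℝ) : Tendsto (fun M => clip M z) atTop (𝓝 z) := by
  obtain ⟨k, hk⟩ := exists_nat_ge |z|
  refine tendsto_const_nhds.congr' ?_
  filter_upwards [eventually_ge_atTop k] with M hM
  rw [clip, if_pos (hk.trans (by exact_mod_cast hM))]

variable {α : Type*} [MeasurableSpace α]

theorem isBddMeas_clip (M : ℕ) {F : α → ℝ} (hF : Measurable F) :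
    IsBddMeas fun x => clip M (F x) := by
  refine ⟨(measurable_clip M).comp hF, M, fun x => ?_⟩
  change |if |F x| ≤ M then F x else 0| ≤ _
  split_ifs with h
  · exact h
  · rw [abs_zero]; positivity

theorem tendsto_integral_clip_mul {μ : Measure α} {F : α → ℝ} (hF : Measurable F) {f : α → ℂ}
    (hf : AEStronglyMeasurable f μ) (h : Integrable (fun x => (F x : ℂ) * f x) μ) :
    Tendsto (fun M => ∫ x, (clip M (F x) : ℂ) * f x ∂μ) atTop (𝓝 (∫ x, (F x : ℂ) * f x ∂μ)) := by
  refine tendsto_integral_of_dominated_convergence _ (fun M => ?_) h.norm (fun M => ?_) ?_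
  · exact (Complex.measurable_ofReal.comp ((measurable_clip M).comp hF)).aestronglyMeasurable.mul hf
  · refine Eventually.of_forall fun x => ?_
    rw [norm_mul, norm_mul, Complex.norm_real, Complex.norm_real]
    exact mul_le_mul_of_nonneg_right (abs_clip_le_abs M _) (norm_nonneg _)
  · refine Eventually.of_forall fun x => ?_
    exact ((Complex.continuous_ofReal.tendsto _).comp (tendsto_clip (F x))).mul_const _

/-! ### The mean field -/

section

variable {ι : Type*} [Fintype ι] {φ : ι → OneParticle} {v : Space → ℝ} {K : ℝ}

theorem measurable_sum_norm_sq (φ : ι → OneParticle) :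
    Measurable fun y : Space => ∑ j, ‖φ j y‖ ^ 2 :=
  Finset.measurable_fun_sum _ fun j _ =>
    ((Lp.stronglyMeasurable (φ j)).measurable.norm.pow_const 2)

variable (hv : Measurable v)
  (hi : ∀ z, Integrable fun y => v (z - y) ^ 2 * ∑ j, ‖φ j y‖ ^ 2)
  (hK : ∀ z, ∫ y, v (z - y) ^ 2 * ∑ j, ‖φ j y‖ ^ 2 ≤ K)

include hv in
theorem measurable_integral_mul_sum_norm_sq (φ : ι → OneParticle) :
    Measurable fun x => ∫ y, v (x - y) * ∑ j, ‖φ j y‖ ^ 2 := by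
  refine StronglyMeasurable.measurable ?_
  refine StronglyMeasurable.integral_prod_right'
    (f := fun p : Space × Space => v (p.1 - p.2) * ∑ j, ‖φ j p.2‖ ^ 2) ?_
  refine Measurable.stronglyMeasurable ?_
  exact (hv.comp (measurable_fst.sub measurable_snd)).mul
    ((measurable_sum_norm_sq φ).comp measurable_snd)

include hv hi

theorem integrable_mul_sum_norm_sq (z : Space) :
    Integrable fun y => v (z - y) * ∑ j, ‖φ j y‖ ^ 2 := by
  refine ((hi z).add (integrable_sum_norm_sq φ)).mono' ?_ (Eventually.of_forall fun y => ?_)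
  · exact ((hv.comp (measurable_const.sub measurable_id)).mul
      (measurable_sum_norm_sq φ)).aestronglyMeasurable
  · have h0 : 0 ≤ ∑ j, ‖φ j y‖ ^ 2 := by positivity
    rw [Real.norm_eq_abs, abs_mul, abs_of_nonneg h0, Pi.add_apply]
    nlinarith [sq_nonneg (|v (z - y)| - 1), sq_abs (v (z - y)), abs_nonneg (v (z - y))]

include hK

-- Integrate |v| ≤ (τ v² + τ⁻¹)/2 against ρ. The weight τ stays free so that the bound can later be
-- brought to order √D.
omit hv in
theorem abs_integral_mul_sum_norm_sq_le {τ : ℝ} (hτ : 0 < τ) (z : Space) :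
    |∫ y, v (z - y) * ∑ j, ‖φ j y‖ ^ 2| ≤ (τ * K + τ⁻¹ * ∑ j, ‖φ j‖ ^ 2) / 2 := by
  have h1 : |∫ y, v (z - y) * ∑ j, ‖φ j y‖ ^ 2| ≤
      ∫ y, (τ * (v (z - y) ^ 2 * ∑ j, ‖φ j y‖ ^ 2) + τ⁻¹ * ∑ j, ‖φ j y‖ ^ 2) / 2 := by
    rw [← Real.norm_eq_abs]
    refine norm_integral_le_of_norm_le (((hi z).const_mul τ).add
      ((integrable_sum_norm_sq φ).const_mul τ⁻¹) |>.div_const 2)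
      (Eventually.of_forall fun y => ?_)
    have h0 : 0 ≤ ∑ j, ‖φ j y‖ ^ 2 := by positivity
    rw [Real.norm_eq_abs, abs_mul, abs_of_nonneg h0]
    have h2 := mul_le_young (X := |v (z - y)|) (Y := 1) hτ
    rw [mul_one, sq_abs, one_pow, mul_one] at h2
    calc _ ≤ (τ * v (z - y) ^ 2 + τ⁻¹) / 2 * ∑ j, ‖φ j y‖ ^ 2 := by gcongr
      _ = _ := by ring
  refine h1.trans ?_
  rw [integral_div, integral_add ((hi z).const_mul τ) ((integrable_sum_norm_sq φ).const_mul τ⁻¹),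
    integral_const_mul, integral_const_mul, integral_sum_norm_sq]
  gcongr
  exact hK z

theorem isBddMeas_integral_mul_sum_norm_sq :
    IsBddMeas fun x => ∫ y, v (x - y) * ∑ j, ‖φ j y‖ ^ 2 :=
  ⟨measurable_integral_mul_sum_norm_sq hv φ, _,
    abs_integral_mul_sum_norm_sq_le hi hK one_pos⟩

omit hi hK in
theorem clip_bound (hi : ∀ z, Integrable fun y => v (z - y) ^ 2 * ∑ j, ‖φ j y‖ ^ 2)
    (hK : ∀ z, ∫ y, v (z - y) ^ 2 * ∑ j, ‖φ j y‖ ^ 2 ≤ K) (M : ℕ) :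
    (∀ z, Integrable fun y => clip M (v (z - y)) ^ 2 * ∑ j, ‖φ j y‖ ^ 2) ∧
      ∀ z, ∫ y, clip M (v (z - y)) ^ 2 * ∑ j, ‖φ j y‖ ^ 2 ≤ K := by
  have hle : ∀ z y, clip M (v (z - y)) ^ 2 * ∑ j, ‖φ j y‖ ^ 2 ≤
      v (z - y) ^ 2 * ∑ j, ‖φ j y‖ ^ 2 := fun z y =>
    mul_le_mul_of_nonneg_right (sq_le_sq.2 (abs_clip_le_abs M _)) (by positivity)
  have h1 : ∀ z, Integrable fun y => clip M (v (z - y)) ^ 2 * ∑ j, ‖φ j y‖ ^ 2 := fun z => by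
    refine (hi z).mono' ?_ (Eventually.of_forall fun y => ?_)
    · exact ((((measurable_clip M).comp (hv.comp (measurable_const.sub measurable_id))).pow_const
        2).mul (measurable_sum_norm_sq φ)).aestronglyMeasurable
    · rw [Real.norm_eq_abs, abs_of_nonneg (by positivity)]
      exact hle z y
  exact ⟨h1, fun z => (integral_mono (h1 z) (hi z) (hle z)).trans (hK z)⟩

end

end

/-! ### The derivative estimate for unbounded interactions. -/

section

variable {n N : ℕ} {v : Space → ℝ}

/-! ### The pair potential -/

theorem pairPotential_eq_sum (v : Space → ℝ) (x : Config N) :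
    pairPotential N v x = ∑ i, ∑ j, if i < j then v (x i - x j) else 0 := by
  rw [pairPotential, Finset.sum_filter, ← Finset.univ_product_univ, Finset.sum_product]

theorem measurable_pairPotential (hv : Measurable v) : Measurable (pairPotential N v) :=
  Finset.measurable_fun_sum _ fun p _ =>
    hv.comp ((measurable_pi_apply p.1).sub (measurable_pi_apply p.2))

/-- The terms without particle 0 form a function of the other coordinates, which commutes with p_0
and hence drops out of the derivative. -/
theorem pairPotential_succ (v : Space → ℝ) (x : Config (n + 1)) :
    pairPotential (n + 1) v x = ∑ m ∈ Finset.univ.erase 0, v (x 0 - x m) +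
      pairPotential n v ((0 : Fin (n + 1)).removeNth x) := by
  rw [pairPotential_eq_sum, pairPotential_eq_sum, Fin.sum_univ_succ]
  congr 1
  · rw [Fin.sum_univ_succ, if_neg (lt_irrefl _), zero_add,
      Finset.sum_erase_eq_sub (Finset.mem_univ 0), Fin.sum_univ_succ, add_sub_cancel_left]
    exact Finset.sum_congr rfl fun j _ => if_pos (Fin.succ_pos j)
  · refine Finset.sum_congr rfl fun i _ => ?_
    rw [Fin.sum_univ_succ, if_neg (Fin.not_lt_zero _), zero_add]
    exact Finset.sum_congr rfl fun j _ => by simp only [Fin.succ_lt_succ_iff]; rfl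

section

variable {φ : Fin (n + 1) → OneParticle} (hv : Measurable v) {K : ℝ}
  (hi : ∀ z, Integrable fun y => v (z - y) ^ 2 * ∑ j, ‖φ j y‖ ^ 2)
  (hK : ∀ z, ∫ y, v (z - y) ^ 2 * ∑ j, ‖φ j y‖ ^ 2 ≤ K) (he : ∀ x, v (-x) = v x)
include hv hi hK he

/-- Integrate over x_0 first: by evenness, for fixed x_m the integral of v(x_m - x_0)² |φ_j(x_0)|²
is at most K, and what remains is K |h|². -/
theorem memLp_pair_mul_insertL {m : Fin (n + 1)} (hm : m ≠ 0) (j : Fin (n + 1))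
    (h : NParticle n) :
    MemLp (fun x : Config (n + 1) => (v (x 0 - x m) : ℂ) *
      (φ j (x 0) * h ((0 : Fin (n + 1)).removeNth x))) 2 volume := by
  have hf : AEStronglyMeasurable (fun x : Config (n + 1) =>
      φ j (x 0) * h ((0 : Fin (n + 1)).removeNth x)) volume :=
    (Lp.aestronglyMeasurable (insertL 0 (φ j) h)).congr (coeFn_insertL 0 (φ j) h)
  have hvm : Measurable fun x : Config (n + 1) => (v (x 0 - x m) : ℂ) :=
    Complex.measurable_ofReal.comp (hv.comp ((measurable_pi_apply 0).sub (measurable_pi_apply m)))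
  refine (memLp_two_iff_integrable_sq_norm (hvm.aestronglyMeasurable.mul hf)).2 ?_
  rw [← integrable_insertNth_iff 0]
  obtain ⟨i, hi'⟩ := Fin.exists_succAbove_eq hm
  simp only [Pi.mul_apply, Fin.insertNth_apply_same, Fin.removeNth_insertNth]
  have e : ∀ p : Space × Config n, ‖(v (p.1 - (Fin.insertNth (α := fun _ => Space) 0 p.1 p.2 : Config (n + 1)) m) : ℂ) *
      (φ j p.1 * h p.2)‖ ^ 2 = (v (p.2 i - p.1) ^ 2 * ‖φ j p.1‖ ^ 2) * ‖h p.2‖ ^ 2 := fun p => by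
    rw [← hi', Fin.insertNth_apply_succAbove, norm_mul, norm_mul, Complex.norm_real,
      ← neg_sub (p.2 i) p.1, he, mul_pow, mul_pow, Real.norm_eq_abs, sq_abs, mul_assoc]
  simp only [e]
  have hle : ∀ z y, v (z - y) ^ 2 * ‖φ j y‖ ^ 2 ≤ v (z - y) ^ 2 * ∑ j, ‖φ j y‖ ^ 2 := fun z y =>
    mul_le_mul_of_nonneg_left (Finset.single_le_sum (f := fun j => ‖φ j y‖ ^ 2)
      (fun _ _ => sq_nonneg _) (Finset.mem_univ j)) (sq_nonneg _)
  have hφm : Measurable fun y => ‖φ j y‖ ^ 2 :=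
    (Lp.stronglyMeasurable (φ j)).measurable.norm.pow_const 2
  have h1 : ∀ z, Integrable fun y => v (z - y) ^ 2 * ‖φ j y‖ ^ 2 := fun z => by
    refine (hi z).mono' ?_ (Eventually.of_forall fun y => ?_)
    · exact (((hv.comp (measurable_const.sub measurable_id)).pow_const 2).mul
        hφm).aestronglyMeasurable
    · rw [Real.norm_eq_abs, abs_of_nonneg (by positivity)]
      exact hle z y
  have hmeas : Measurable fun p : Space × Config n =>
      (v (p.2 i - p.1) ^ 2 * ‖φ j p.1‖ ^ 2) * ‖h p.2‖ ^ 2 := by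
    refine Measurable.mul (Measurable.mul ?_ (hφm.comp measurable_fst))
      (((Lp.stronglyMeasurable h).measurable.norm.pow_const 2).comp measurable_snd)
    have : Measurable fun p : Space × Config n => p.2 i - p.1 :=
      ((measurable_pi_apply i).comp measurable_snd).sub measurable_fst
    exact (hv.comp this).pow_const 2
  rw [integrable_prod_iff' hmeas.aestronglyMeasurable]
  refine ⟨Eventually.of_forall fun x => (h1 (x i)).mul_const (‖h x‖ ^ 2), ?_⟩
  refine ((integrable_norm_sq h).const_mul K).mono'
    hmeas.stronglyMeasurable.norm.integral_prod_left'.aestronglyMeasurable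
    (Eventually.of_forall fun x => ?_)
  have e2 : ∀ y, ‖(v (x i - y) ^ 2 * ‖φ j y‖ ^ 2) * ‖h x‖ ^ 2‖ =
      (v (x i - y) ^ 2 * ‖φ j y‖ ^ 2) * ‖h x‖ ^ 2 := fun y => by
    rw [Real.norm_eq_abs, abs_of_nonneg (by positivity)]
  simp only [e2]
  rw [Real.norm_eq_abs, integral_mul_const,
    abs_of_nonneg (mul_nonneg (integral_nonneg fun y => by positivity) (sq_nonneg _))]
  exact mul_le_mul_of_nonneg_right
    ((integral_mono (h1 _) (hi _) (hle _)).trans (hK _)) (sq_nonneg _)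

theorem memLp_pair_mul_projAt {m : Fin (n + 1)} (hm : m ≠ 0) (ξ : NParticle (n + 1)) :
    MemLp (fun x : Config (n + 1) => (v (x 0 - x m) : ℂ) * projAt φ 0 ξ x) 2 volume := by
  have h := memLp_finsetSum (p := 2) (μ := (volume : Measure (Config (n + 1)))) Finset.univ
    fun j _ => memLp_pair_mul_insertL hv hi hK he hm j (partialInner 0 (φ j) ξ)
  refine (memLp_congr_ae ?_).1 h
  filter_upwards [coeFn_projAt_eq (φ := φ) 0 ξ] with x hx
  rw [hx, Finset.mul_sum]

end

/-- A function of the other particles commutes with p_0, so its product with p_0 is symmetric. -/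
theorem inner_mulL_projAt_im_eq_zero {φ : Fin (n + 1) → OneParticle}
    {F : Config (n + 1) → ℝ} {G : Config n → ℝ} (hF : IsBddMeas F) (hG : IsBddMeas G)
    (h : ∀ x, F x = G ((0 : Fin (n + 1)).removeNth x)) (ξ : NParticle (n + 1)) :
    (inner ℂ ξ (mulL F hF (projAt φ 0 ξ))).im = 0 := by
  rw [← Complex.conj_eq_iff_im, inner_conj_symm, mulL_projAt hF hG 0 h, inner_projAt,
    inner_mulL_left, mulL_projAt hF hG 0 h]

/-- Integrability of products of `L²` functions. -/
theorem integrable_conj_mul_of_memLp {α : Type*} [MeasurableSpace α] {μ : Measure α} {f g : α → ℂ}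
    (hf : MemLp f 2 μ) (hg : MemLp g 2 μ) : Integrable (fun x => conj (f x) * g x) μ := by
  refine (integrable_conj_mul (hf.toLp f) (hg.toLp g)).congr ?_
  filter_upwards [hf.coeFn_toLp, hg.coeFn_toLp] with x h1 h2
  rw [h1, h2]

/-- The estimate of the time derivative of the number of excitations for unbounded interactions. -/
theorem abs_im_inner_mulOp_sub_le {φ : Fin (n + 1) → OneParticle} (hφ : Orthonormal ℂ φ)
    (hv : Measurable v) (he : ∀ x, v (-x) = v x) {κ : ℝ} (hκ : 0 < κ)
    (hi : ∀ z, Integrable fun y => v (z - y) ^ 2 * ∑ j, ‖φ j y‖ ^ 2)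
    (hK : ∀ z, ∫ y, v (z - y) ^ 2 * ∑ j, ‖φ j y‖ ^ 2 ≤ κ ^ 2 / (n + 1))
    (hV : IsBddMeas fun x : Config (n + 1) => ∫ y, v (x 0 - y) * ∑ j, ‖φ j y‖ ^ 2)
    {ξ : NParticle (n + 1)} (hξ : IsAntisymmetric ξ)
    (hξV : ξ ∈ (mulOp (pairPotential (n + 1) v)).domain) :
    |(inner ℂ (mulOp (pairPotential (n + 1) v) ⟨ξ, hξV⟩) (projAt φ 0 ξ) -
      inner ℂ ξ (mulL _ hV (projAt φ 0 ξ))).im| ≤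
      3 * κ * (excitation φ ξ + ‖ξ‖ ^ 2 / (n + 1)) := by
  set η := projAt φ 0 ξ with hη
  have hf := integrable_conj_mul ξ η
  have hfm := hf.aestronglyMeasurable
  -- the interaction of the first particle with the others
  have hW : ∀ m ∈ (Finset.univ : Finset (Fin (n + 1))).erase 0, Integrable fun x : Config (n + 1) =>
      (v (x 0 - x m) : ℂ) * (conj (ξ x) * η x) := fun m hm => by
    refine (integrable_conj_mul_of_memLp (Lp.memLp ξ)
      (memLp_pair_mul_projAt hv hi hK he (Finset.ne_of_mem_erase hm) ξ)).congr
      (Eventually.of_forall fun x => ?_)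
    simp only [← hη]
    ring
  have hWs := integrable_finsetSum _ hW
  have hVi : Integrable fun x : Config (n + 1) =>
      (pairPotential (n + 1) v x : ℂ) * (conj (ξ x) * η x) := by
    refine (integrable_conj_mul_of_memLp hξV (Lp.memLp η)).congr (Eventually.of_forall fun x => ?_)
    simp only [map_mul, Complex.conj_ofReal]
    ring
  let U : Config (n + 1) → ℝ := fun x => pairPotential n v ((0 : Fin (n + 1)).removeNth x)
  have hsplit : ∀ x, (U x : ℂ) * (conj (ξ x) * η x) =
      (pairPotential (n + 1) v x : ℂ) * (conj (ξ x) * η x) -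
        ∑ m ∈ Finset.univ.erase 0, (v (x 0 - x m) : ℂ) * (conj (ξ x) * η x) := fun x => by
    rw [pairPotential_succ, ← Finset.sum_mul]
    push_cast
    ring
  -- The interaction among the other particles need not map ξ into L². The integrand is integrable
  -- as a difference: the full potential is controlled by `hξV`, the pair terms with particle 0 by
  -- `memLp_pair_mul_projAt`.
  have hUi : Integrable fun x => (U x : ℂ) * (conj (ξ x) * η x) := by
    simp only [hsplit]
    exact hVi.sub hWs
  have hUm : Measurable U :=
    (measurable_pairPotential hv).comp (measurable_pi_lambda _ fun i => measurable_pi_apply _)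
  -- Truncating `U` as a whole, rather than each pair term, keeps it a bounded function of the other
  -- coordinates; the imaginary part vanishes for every cutoff.
  have hU0 : (∫ x, (U x : ℂ) * (conj (ξ x) * η x)).im = 0 := by
    refine tendsto_nhds_unique (((Complex.continuous_im.tendsto _).comp
      (tendsto_integral_clip_mul hUm hfm hUi))) ?_
    refine tendsto_const_nhds.congr fun M => ?_
    have := inner_mulL_projAt_im_eq_zero (φ := φ) (isBddMeas_clip M hUm)
      (isBddMeas_clip M (measurable_pairPotential hv)) (fun x => rfl) ξ
    rw [inner_mulL_right] at this
    exact this.symm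
  -- reduction to the interaction with the first particle
  have h1 : (inner ℂ (mulOp (pairPotential (n + 1) v) ⟨ξ, hξV⟩) η).im =
      (∑ m ∈ Finset.univ.erase 0, ∫ x : Config (n + 1), (v (x 0 - x m) : ℂ) *
        (conj (ξ x) * η x)).im := by
    have e1 : inner ℂ (mulOp (pairPotential (n + 1) v) ⟨ξ, hξV⟩) η =
        ∫ x, (pairPotential (n + 1) v x : ℂ) * (conj (ξ x) * η x) := by
      rw [inner_eq_integral]
      refine integral_congr_ae ?_
      filter_upwards [MemLp.coeFn_toLp (memLp_of_mulDomain ⟨ξ, hξV⟩)] with x hx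
      change conj ((memLp_of_mulDomain ⟨ξ, hξV⟩).toLp _ x) * _ = _
      rw [hx, map_mul, Complex.conj_ofReal]
      ring
    rw [← integral_finsetSum _ hW]
    have e2 : ∫ x, (U x : ℂ) * (conj (ξ x) * η x) =
        (∫ x, (pairPotential (n + 1) v x : ℂ) * (conj (ξ x) * η x)) -
        ∫ x : Config (n + 1), ∑ m ∈ Finset.univ.erase 0,
          (v (x 0 - x m) : ℂ) * (conj (ξ x) * η x) := by
      rw [← integral_sub hVi hWs]
      simp only [hsplit]
    rw [e2, Complex.sub_im] at hU0
    rw [e1]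
    linarith
  -- the limit of the bounded interactions
  have hVb : ∀ M, IsBddMeas fun x : Config (n + 1) =>
      ∫ y, clip M (v (x 0 - y)) * ∑ j, ‖φ j y‖ ^ 2 := fun M =>
    (isBddMeas_integral_mul_sum_norm_sq (v := fun z => clip M (v z)) ((measurable_clip M).comp hv)
      (clip_bound hv hi hK M).1 (clip_bound hv hi hK M).2).comp (measurable_pi_apply 0)
  have hlim1 : Tendsto (fun M => ∑ m ∈ Finset.univ.erase 0,
      inner ℂ ξ (pairL (fun z => clip M (v z)) (isBddMeas_clip M hv) m η)) atTop
      (𝓝 (∑ m ∈ Finset.univ.erase 0, ∫ x : Config (n + 1), (v (x 0 - x m) : ℂ) *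
        (conj (ξ x) * η x))) := by
    refine tendsto_finsetSum _ fun m hm => ?_
    refine (tendsto_integral_clip_mul (F := fun x : Config (n + 1) => v (x 0 - x m))
      (hv.comp ((measurable_pi_apply 0).sub (measurable_pi_apply m))) hfm (hW m hm)).congr
      fun M => ?_
    rw [pairL, inner_mulL_right]
  have hlim2 : Tendsto (fun M => inner ℂ ξ (mulL _ (hVb M) η)) atTop
      (𝓝 (inner ℂ ξ (mulL _ hV η))) := by
    simp only [inner_mulL_right]
    refine tendsto_integral_of_dominated_convergence
      (fun x => (κ ^ 2 / (n + 1) + ∑ j, ‖φ j‖ ^ 2) / 2 * ‖conj (ξ x) * η x‖) (fun M => ?_)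
      (hf.norm.const_mul _) (fun M => ?_) ?_
    · exact (Complex.measurable_ofReal.comp (hVb M).1).aestronglyMeasurable.mul hfm
    · refine Eventually.of_forall fun x => ?_
      rw [norm_mul, Complex.norm_real]
      refine mul_le_mul_of_nonneg_right ?_ (norm_nonneg _)
      have := abs_integral_mul_sum_norm_sq_le (v := fun z => clip M (v z))
        (clip_bound hv hi hK M).1 (clip_bound hv hi hK M).2 one_pos (x 0)
      simpa using this
    · refine Eventually.of_forall fun x => ?_
      refine ((Complex.continuous_ofReal.tendsto _).comp ?_).mul_const _
      refine tendsto_integral_of_dominated_convergence _ (fun M => ?_)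
        (integrable_mul_sum_norm_sq hv hi (x 0)).norm (fun M => ?_) ?_
      · exact (((measurable_clip M).comp (hv.comp (measurable_const.sub measurable_id))).mul
          (measurable_sum_norm_sq φ)).aestronglyMeasurable
      · refine Eventually.of_forall fun y => ?_
        rw [norm_mul, norm_mul]
        exact mul_le_mul_of_nonneg_right (abs_clip_le_abs M _) (norm_nonneg _)
      · exact Eventually.of_forall fun y => (tendsto_clip _).mul_const _
  rw [Complex.sub_im, h1, ← Complex.sub_im]
  refine le_of_tendsto ((continuous_abs.tendsto _).comp
    ((Complex.continuous_im.tendsto _).comp (hlim1.sub hlim2))) (Eventually.of_forall fun M => ?_)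
  exact abs_im_inner_pairL_sub_le hφ (isBddMeas_clip M hv) hκ (clip_bound hv hi hK M).2 hξ
    (fun x => by rw [he]) (hVb M)

end

/-! ### Graphs of the Hamiltonians and permutation symmetry. -/

section

/-! ### Closures of spans -/

section Abstract

variable {E : Type*} [NormedAddCommGroup E] [InnerProductSpace ℂ E]

/-- Both sides are continuous and sesquilinear in the graph elements. The identity extends first in
y and then, after conjugation, in x; this is how facts about product vectors reach the domain of the
free Hamiltonian. -/
theorem inner_eq_of_mem_closure_span {L₁ L₂ : E × E →L[ℂ] E} {Γ : Set (E × E)}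
    (h : ∀ x ∈ Γ, ∀ y ∈ Γ, inner ℂ x.1 (L₁ y) = inner ℂ x.2 (L₂ y)) {x y : E × E}
    (hx : x ∈ (Submodule.span ℂ Γ).topologicalClosure)
    (hy : y ∈ (Submodule.span ℂ Γ).topologicalClosure) :
    inner ℂ x.1 (L₁ y) = inner ℂ x.2 (L₂ y) := by
  have aux : ∀ (M : E × E →L[ℂ] ℂ), (∀ z ∈ Γ, M z = 0) →
      ∀ z ∈ (Submodule.span ℂ Γ).topologicalClosure, M z = 0 := fun M hM z hz => by
    have : (Submodule.span ℂ Γ).topologicalClosure ≤ LinearMap.ker M.toLinearMap :=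
      Submodule.topologicalClosure_minimal _ (Submodule.span_le.2 fun z hz => hM z hz)
        M.isClosed_ker
    exact this hz
  have h1 : ∀ x ∈ Γ, inner ℂ x.1 (L₁ y) = inner ℂ x.2 (L₂ y) := fun x hx => by
    have := aux ((innerSL ℂ x.1).comp L₁ - (innerSL ℂ x.2).comp L₂)
      (fun z hz => by simpa [sub_eq_zero] using h x hx z hz) y hy
    simpa [sub_eq_zero] using this
  have h2 := aux ((innerSL ℂ (L₁ y)).comp (ContinuousLinearMap.fst ℂ E E) -
      (innerSL ℂ (L₂ y)).comp (ContinuousLinearMap.snd ℂ E E)) (fun z hz => by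
    have := congrArg conj (h1 z hz)
    simp only [inner_conj_symm] at this
    simpa [sub_eq_zero] using this) x hx
  have h3 : inner ℂ (L₁ y) x.1 = inner ℂ (L₂ y) x.2 := by simpa [sub_eq_zero] using h2
  rw [← inner_conj_symm, h3, inner_conj_symm]

theorem map_mem_graph_closure {U : E →L[ℂ] E} {G : Submodule ℂ (E × E)}
    (h : ∀ z ∈ G, (U z.1, U z.2) ∈ G.topologicalClosure) {z : E × E}
    (hz : z ∈ G.topologicalClosure) : (U z.1, U z.2) ∈ G.topologicalClosure := by
  have : G.topologicalClosure ≤ G.topologicalClosure.comap (U.prodMap U).toLinearMap :=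
    Submodule.topologicalClosure_minimal _ (fun z hz => h z hz)
      (G.isClosed_topologicalClosure.preimage (U.prodMap U).continuous)
  exact this hz

theorem exists_apply_of_mem_graph {A : E →ₗ.[ℂ] E} {x y : E} (h : (x, y) ∈ A.graph) :
    ∃ hx : x ∈ A.domain, A ⟨x, hx⟩ = y := by
  obtain ⟨a, rfl, h2⟩ := A.mem_graph_iff.1 h
  exact ⟨a.2, h2⟩

variable [CompleteSpace E]

theorem graph_closure_of_isSelfAdjoint {A : E →ₗ.[ℂ] E} (hA : IsSelfAdjoint A.closure) :
    A.closure.graph = A.graph.topologicalClosure := by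
  by_cases h : A.IsClosable
  · exact h.graph_closure_eq_closure_graph.symm
  -- For a non-closable operator `LinearPMap.closure` is by default the operator itself, which would
  -- then be self-adjoint, hence closed and closable.
  · rw [LinearPMap.closure_def' h] at hA
    exact absurd hA.isClosed.isClosable h

end Abstract

/-! ### The free Hamiltonian -/

variable {N : ℕ} {H0 : OneParticle →ₗ.[ℂ] OneParticle} {v : Space → ℝ}

/-- The elements `(⊗ᵢ uᵢ, (∑ⱼ Hⱼ⁰) ⊗ᵢ uᵢ)` of the graph of the free Hamiltonian. -/
def freeGenerator (H0 : OneParticle →ₗ.[ℂ] OneParticle) (u : Fin N → H0.domain) :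
    NParticle N × NParticle N :=
  (tensor fun i => (u i : OneParticle),
    ∑ j, tensor (Function.update (fun i => (u i : OneParticle)) j (H0 (u j))))

theorem inner_freeGenerator (hH0 : IsSelfAdjoint H0) (u w : Fin N → H0.domain) :
    inner ℂ (freeGenerator H0 u).1 (freeGenerator H0 w).2 =
      inner ℂ (freeGenerator H0 u).2 (freeGenerator H0 w).1 := by
  simp only [freeGenerator, inner_sum, sum_inner, inner_tensor]
  refine Finset.sum_congr rfl fun j _ => Finset.prod_congr rfl fun i _ => ?_
  by_cases hij : i = j
  · subst hij
    rw [Function.update_self, Function.update_self, inner_map_eq_of_isSelfAdjoint hH0]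
  · rw [Function.update_of_ne hij, Function.update_of_ne hij]

theorem dense_span_domain_tensor (hH0 : IsSelfAdjoint H0) :
    Dense (Submodule.span ℂ (range fun u : Fin N → H0.domain =>
      tensor fun i => (u i : OneParticle)) : Set (NParticle N)) := by
  have h := dense_span_tensor_of_dense (N := N) hH0.dense_domain
  convert h using 3
  ext w
  constructor
  · rintro ⟨u, rfl⟩
    exact ⟨_, fun i => (u i).2, rfl⟩
  · rintro ⟨u, hu, rfl⟩
    exact ⟨fun i => ⟨u i, hu i⟩, rfl⟩

/-- `Submodule.toLinearPMap` returns the given graph only if it is single-valued. If (0, y) lies in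
the closure, symmetry of H^0 makes y orthogonal to all products of domain vectors, which are total.
-/
theorem graph_freeHamiltonian (hH0 : IsSelfAdjoint H0) : (freeHamiltonian N H0).graph =
    (Submodule.span ℂ (range (freeGenerator (N := N) H0))).topologicalClosure := by
  refine Submodule.toLinearPMap_graph_eq _ fun x hx hx0 => ?_
  change x ∈ (Submodule.span ℂ (range (freeGenerator (N := N) H0))).topologicalClosure at hx
  refine (dense_span_domain_tensor (N := N) hH0).eq_zero_of_inner_left ℂ fun w hw => ?_
  rw [← inner_conj_symm]
  refine Submodule.span_induction (p := fun w _ => conj (inner ℂ w x.2) = 0) ?_ (by simp) ?_ ?_ hw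
  · rintro _ ⟨u, rfl⟩
    have := inner_eq_of_mem_closure_span (L₁ := ContinuousLinearMap.snd ℂ _ _)
      (L₂ := ContinuousLinearMap.fst ℂ _ _) (Γ := range (freeGenerator (N := N) H0)) (by
        rintro _ ⟨u, rfl⟩ _ ⟨w, rfl⟩
        exact inner_freeGenerator hH0 u w) hx
      (Submodule.le_topologicalClosure _ (Submodule.subset_span (mem_range_self u)))
    rw [hx0, inner_zero_left] at this
    rw [inner_conj_symm]
    exact this.symm
  · intro a b _ _ ha hb
    rw [inner_add_left, map_add, ha, hb, add_zero]
  · intro c a _ ha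
    rw [inner_smul_left, map_mul, ha, mul_zero]

/-! ### Permutations of the particles -/

theorem inner_permL (σ : Equiv.Perm (Fin N)) (a b : NParticle N) :
    inner ℂ (permL σ a) b = inner ℂ a (permL σ⁻¹ b) := by
  rw [← (permL σ).inner_map_map a, ← permL_mul, mul_inv_cancel, permL_one]

theorem permL_mem_graph_freeHamiltonian (hH0 : IsSelfAdjoint H0) (σ : Equiv.Perm (Fin N))
    {z : NParticle N × NParticle N} (hz : z ∈ (freeHamiltonian N H0).graph) :
    (permL σ z.1, permL σ z.2) ∈ (freeHamiltonian N H0).graph := by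
  rw [graph_freeHamiltonian hH0] at hz ⊢
  refine map_mem_graph_closure (U := (permL σ).toContinuousLinearMap) (fun z hz => ?_) hz
  have : Submodule.span ℂ (range (freeGenerator (N := N) H0)) ≤
      (Submodule.span ℂ (range (freeGenerator (N := N) H0))).topologicalClosure.comap
        ((permL σ).toContinuousLinearMap.prodMap (permL σ).toContinuousLinearMap).toLinearMap := by
    rw [Submodule.span_le]
    rintro _ ⟨u, rfl⟩
    refine Submodule.le_topologicalClosure _ (Submodule.subset_span ⟨u ∘ σ.symm, ?_⟩)
    refine Prod.ext (permL_tensor σ fun i => (u i : OneParticle)).symm ?_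
    change ∑ j, tensor (Function.update (fun i => ((u ∘ σ.symm) i : OneParticle)) j _) =
      permL σ (∑ j, tensor (Function.update (fun i => (u i : OneParticle)) j (H0 (u j))))
    rw [map_sum, ← Equiv.sum_comp σ]
    refine Finset.sum_congr rfl fun j _ => ?_
    rw [permL_tensor]
    congr 1
    ext i : 1
    by_cases hij : i = σ j
    · subst hij
      simp
    · have : σ.symm i ≠ j := fun h => hij (by rw [← h, Equiv.apply_symm_apply])
      simp [hij, this]
  exact this hz

theorem pairPotential_comp_perm (he : ∀ x, v (-x) = v x) (σ : Equiv.Perm (Fin N))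
    (x : Config N) : pairPotential N v (x ∘ σ) = pairPotential N v x := by
  -- Twice the sum over i < j is the sum over all ordered pairs minus the diagonal, a form visibly
  -- invariant under permutations.
  have key : ∀ y : Config N, 2 * pairPotential N v y = ∑ i, ∑ j, v (y i - y j) - ∑ _i : Fin N, v 0 := by
    intro y
    have h1 : pairPotential N v y = ∑ i, ∑ j, if j < i then v (y i - y j) else 0 := by
      rw [pairPotential_eq_sum, Finset.sum_comm]
      refine Finset.sum_congr rfl fun i _ => Finset.sum_congr rfl fun j _ => ?_
      rw [← neg_sub, he]
    rw [two_mul]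
    nth_rw 2 [h1]
    rw [pairPotential_eq_sum, ← Finset.sum_add_distrib, ← Finset.sum_sub_distrib]
    refine Finset.sum_congr rfl fun i _ => ?_
    rw [← Finset.sum_add_distrib, eq_sub_iff_add_eq]
    have h2 : v 0 = ∑ j, if j = i then v (y i - y j) else 0 := by simp
    rw [h2, ← Finset.sum_add_distrib]
    refine Finset.sum_congr rfl fun j _ => ?_
    rcases lt_trichotomy i j with h | h | h
    · simp [h, h.ne', h.not_gt]
    · simp [h]
    · simp [h, h.ne, h.not_gt]
  have h1 := key (x ∘ σ)
  have h2 : ∑ i, ∑ j, v ((x ∘ σ) i - (x ∘ σ) j) = ∑ i, ∑ j, v (x i - x j) := by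
    rw [← Equiv.sum_comp σ fun i => ∑ j, v (x i - x j)]
    refine Finset.sum_congr rfl fun i _ => ?_
    exact Equiv.sum_comp σ fun j => v (x (σ i) - x j)
  rw [h2, ← key x] at h1
  linarith

theorem permL_mem_graph_mulOp {V : Config N → ℝ} {σ : Equiv.Perm (Fin N)}
    (hV : ∀ x, V (x ∘ σ) = V x) {z : NParticle N × NParticle N} (hz : z ∈ (mulOp V).graph) :
    (permL σ z.1, permL σ z.2) ∈ (mulOp V).graph := by
  obtain ⟨ξ, h1, h2⟩ := (mulOp V).mem_graph_iff.1 hz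
  have e : ∀ᵐ x, permL σ z.2 x = (V x : ℂ) * permL σ z.1 x := by
    have h3 : ∀ᵐ x, z.2 x = (V x : ℂ) * z.1 x := by
      rw [← h2, ← h1]
      exact (memLp_of_mulDomain ξ).coeFn_toLp
    filter_upwards [coeFn_permL σ z.1, coeFn_permL σ z.2,
      (measurePreserving_comp_perm σ).quasiMeasurePreserving.ae h3] with x h4 h5 h6
    rw [h4, h5, h6, hV]
  have hm : permL σ z.1 ∈ mulDomain V := (memLp_congr_ae e).1 (Lp.memLp (permL σ z.2))
  refine (mulOp V).mem_graph_iff.2 ⟨⟨_, hm⟩, rfl, Lp.ext ?_⟩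
  filter_upwards [(memLp_of_mulDomain ⟨_, hm⟩).coeFn_toLp, e] with x h7 h8
  exact h7.trans h8.symm

theorem permL_mem_graph_add (hH0 : IsSelfAdjoint H0) (he : ∀ x, v (-x) = v x)
    (σ : Equiv.Perm (Fin N)) {z : NParticle N × NParticle N}
    (hz : z ∈ (freeHamiltonian N H0 + mulOp (pairPotential N v)).graph) :
    (permL σ z.1, permL σ z.2) ∈ (freeHamiltonian N H0 + mulOp (pairPotential N v)).graph := by
  obtain ⟨z₁, z₂⟩ := z
  obtain ⟨h1, rfl⟩ := exists_apply_of_mem_graph hz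
  obtain ⟨ha, ha'⟩ := exists_apply_of_mem_graph (permL_mem_graph_freeHamiltonian hH0 σ
    ((freeHamiltonian N H0).mem_graph ⟨z₁, h1.1⟩))
  obtain ⟨hb, hb'⟩ := exists_apply_of_mem_graph (permL_mem_graph_mulOp
    (pairPotential_comp_perm he σ) ((mulOp (pairPotential N v)).mem_graph ⟨z₁, h1.2⟩))
  refine LinearPMap.mem_graph_iff _ |>.2 ⟨⟨permL σ z₁, ha, hb⟩, rfl, ?_⟩
  rw [LinearPMap.add_apply]
  refine (congrArg₂ (· + ·) ha' hb').trans ?_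
  rw [LinearPMap.add_apply]
  exact (map_add (permL σ) _ _).symm

theorem permL_mem_graph_hamiltonian (hH0 : IsSelfAdjoint H0) (he : ∀ x, v (-x) = v x)
    (hH : IsSelfAdjoint (hamiltonian N H0 v)) (σ : Equiv.Perm (Fin N))
    {z : NParticle N × NParticle N} (hz : z ∈ (hamiltonian N H0 v).graph) :
    (permL σ z.1, permL σ z.2) ∈ (hamiltonian N H0 v).graph := by
  rw [hamiltonian, graph_closure_of_isSelfAdjoint hH] at hz ⊢
  exact map_mem_graph_closure (U := (permL σ).toContinuousLinearMap) (fun z hz =>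
    Submodule.le_topologicalClosure _ (permL_mem_graph_add hH0 he σ hz)) hz

theorem permL_map_hamiltonian (hH0 : IsSelfAdjoint H0) (he : ∀ x, v (-x) = v x)
    (hH : IsSelfAdjoint (hamiltonian N H0 v)) (σ : Equiv.Perm (Fin N))
    (ξ : (hamiltonian N H0 v).domain) : ∃ h : permL σ ξ ∈ (hamiltonian N H0 v).domain,
      hamiltonian N H0 v ⟨permL σ ξ, h⟩ = permL σ (hamiltonian N H0 v ξ) :=
  exists_apply_of_mem_graph
    (permL_mem_graph_hamiltonian hH0 he hH σ ((hamiltonian N H0 v).mem_graph ξ))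

theorem permL_resolvent (hH0 : IsSelfAdjoint H0) (he : ∀ x, v (-x) = v x)
    (hH : IsSelfAdjoint (hamiltonian N H0 v)) {l : ℝ} (hl : l ≠ 0) (σ : Equiv.Perm (Fin N))
    (w : NParticle N) : permL σ (resolvent (hamiltonian N H0 v) l w) =
      resolvent (hamiltonian N H0 v) l (permL σ w) := by
  obtain ⟨h, h1⟩ := permL_map_hamiltonian hH0 he hH σ ⟨_, resolvent_mem hH hl w⟩
  have h2 := resolvent_apply_add hH hl ⟨_, h⟩
  rw [h1, ← map_smul, ← map_add, resolvent_add hH hl] at h2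
  exact h2.symm

theorem isAntisymmetric_resolvent (hH0 : IsSelfAdjoint H0) (he : ∀ x, v (-x) = v x)
    (hH : IsSelfAdjoint (hamiltonian N H0 v)) {l : ℝ} (hl : l ≠ 0) {ψ : NParticle N}
    (h : IsAntisymmetric ψ) : IsAntisymmetric (resolvent (hamiltonian N H0 v) l ψ) := by
  rw [isAntisymmetric_iff] at h ⊢
  intro j k hjk
  rw [permL_resolvent hH0 he hH hl, h j k hjk, map_neg]

/-- The Schrödinger equation preserves the antisymmetry. -/
theorem IsSchroedingerSolution.isAntisymmetric (hH0 : IsSelfAdjoint H0) (he : ∀ x, v (-x) = v x)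
    (hH : IsSelfAdjoint (hamiltonian N H0 v)) {T : EReal} {ψ : ℝ → NParticle N}
    (hψ : IsSchroedingerSolution H0 v T ψ) (h0 : IsAntisymmetric (ψ 0)) {t : ℝ}
    (ht : t ∈ timeInterval T) : IsAntisymmetric (ψ t) := by
  rw [isAntisymmetric_iff] at h0 ⊢
  intro j k hjk
  -- The sum of ψ and its transposed copy solves the same equation and vanishes initially; its norm
  -- is conserved.
  have hs : IsSolution (hamiltonian N H0 v) T
      (fun s => permL (Equiv.swap j k) (ψ s) + ψ s) 0 := by
    refine ⟨((permL (Equiv.swap j k)).continuous.comp_continuousOn hψ.1).add hψ.1,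
      fun s hs u => ?_⟩
    obtain ⟨h, h1⟩ := permL_map_hamiltonian hH0 he hH (Equiv.swap j k)⁻¹ u
    have h2 := (hψ.2 s hs ⟨_, h⟩).add (hψ.2 s hs u)
    have e : ∀ (a b : NParticle N), inner ℂ a (permL (Equiv.swap j k) b) =
        inner ℂ (permL (Equiv.swap j k)⁻¹ a) b := fun a b => by
      rw [inner_permL, inv_inv]
    simp only [inner_add_right, e]
    refine h2.congr_deriv ?_
    rw [h1]
    simp only [Pi.zero_apply, inner_zero_right]
    ring
  have h1 := hs.norm_eq hH ht
  rw [h0 j k hjk, neg_add_cancel, norm_zero, norm_eq_zero] at h1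
  exact eq_neg_of_add_eq_zero_left h1

/-! ### The antisymmetriser -/

/-- The projection onto the antisymmetric vectors. -/
def antisymmetrizer (N : ℕ) : NParticle N →L[ℂ] NParticle N :=
  (N.factorial : ℂ)⁻¹ • ∑ σ : Equiv.Perm (Fin N),
    ((Equiv.Perm.sign σ : ℤ) : ℂ) • (permL σ).toContinuousLinearMap

theorem antisymmetrizer_apply (ψ : NParticle N) : antisymmetrizer N ψ =
    (N.factorial : ℂ)⁻¹ • ∑ σ : Equiv.Perm (Fin N), ((Equiv.Perm.sign σ : ℤ) : ℂ) • permL σ ψ := by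
  simp [antisymmetrizer]

theorem isAntisymmetric_antisymmetrizer (ψ : NParticle N) :
    IsAntisymmetric (antisymmetrizer N ψ) := by
  rw [isAntisymmetric_iff]
  intro j k hjk
  rw [antisymmetrizer_apply, map_smul, map_sum, ← smul_neg, ← Finset.sum_neg_distrib]
  congr 1
  rw [← Equiv.sum_comp (Equiv.mulLeft (Equiv.swap j k)) fun σ =>
    -(((Equiv.Perm.sign σ : ℤ) : ℂ) • permL σ ψ)]
  refine Finset.sum_congr rfl fun σ _ => ?_
  rw [map_smul, ← permL_mul, Equiv.coe_mulLeft, Equiv.Perm.sign_mul, Equiv.Perm.sign_swap hjk]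
  simp

theorem antisymmetrizer_of_isAntisymmetric {ψ : NParticle N} (h : IsAntisymmetric ψ) :
    antisymmetrizer N ψ = ψ := by
  rw [antisymmetrizer_apply]
  have : ∀ σ : Equiv.Perm (Fin N), ((Equiv.Perm.sign σ : ℤ) : ℂ) • permL σ ψ = ψ := fun σ => by
    rw [permL_eq_sign_smul h, smul_smul, ← Int.cast_mul, Int.units_coe_mul_self, Int.cast_one,
      one_smul]
  simp only [this]
  rw [Finset.sum_const, Finset.card_univ, Fintype.card_perm, Fintype.card_fin,
    ← Nat.cast_smul_eq_nsmul ℂ, smul_smul, inv_mul_cancel₀, one_smul]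
  exact_mod_cast N.factorial_ne_zero

theorem antisymmetrizer_mem_graph {A : NParticle N →ₗ.[ℂ] NParticle N}
    (hA : ∀ (σ : Equiv.Perm (Fin N)) (z), z ∈ A.graph → (permL σ z.1, permL σ z.2) ∈ A.graph)
    {z : NParticle N × NParticle N} (hz : z ∈ A.graph) :
    (antisymmetrizer N z.1, antisymmetrizer N z.2) ∈ A.graph := by
  have : (antisymmetrizer N z.1, antisymmetrizer N z.2) = (N.factorial : ℂ)⁻¹ •
      ∑ σ : Equiv.Perm (Fin N), ((Equiv.Perm.sign σ : ℤ) : ℂ) • (permL σ z.1, permL σ z.2) := by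
    refine Prod.ext ?_ ?_
    · simp [antisymmetrizer_apply, Prod.fst_sum]
    · simp [antisymmetrizer_apply, Prod.snd_sum]
  rw [this]
  exact Submodule.smul_mem _ _ (Submodule.sum_mem _ fun σ _ => Submodule.smul_mem _ _ (hA σ z hz))

end

/-! ### Weak operator integrals and the Hartree flow. -/

section

/-! ### Weak integrals of operators -/

section Abstract

variable {E : Type*} [NormedAddCommGroup E] [InnerProductSpace ℂ E]

/-- Vectors whose matrix elements are measurable are closed under linear combinations and sequential
limits. This is needed because derivatives in time are available only on products of domain vectors.
-/
theorem aestronglyMeasurable_inner_of_dense {α : Type*} [MeasurableSpace α] {μ : Measure α}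
    {S : α → E →L[ℂ] E} {Γ : Set E} (hΓ : Dense (Submodule.span ℂ Γ : Set E))
    (h : ∀ x ∈ Γ, ∀ y ∈ Γ, AEStronglyMeasurable (fun r => inner ℂ x (S r y)) μ) (x y : E) :
    AEStronglyMeasurable (fun r => inner ℂ x (S r y)) μ := by
  have hlim : ∀ (P : E → Prop), (∀ x ∈ Γ, P x) → P 0 → (∀ a b, P a → P b → P (a + b)) →
      (∀ (c : ℂ) a, P a → P (c • a)) →
      (∀ (u : ℕ → E) a, (∀ k, P (u k)) → Tendsto u atTop (𝓝 a) → P a) → ∀ x, P x := by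
    intro P hP h0 hadd hsmul hcl x
    obtain ⟨u, hu, hux⟩ := mem_closure_iff_seq_limit.1 (hΓ x)
    exact hcl u x (fun k => Submodule.span_induction (p := fun a _ => P a) hP h0
      (fun a b _ _ => hadd a b) (fun c a _ => hsmul c a) (hu k)) hux
  have h1 : ∀ x ∈ Γ, ∀ y, AEStronglyMeasurable (fun r => inner ℂ x (S r y)) μ := by
    intro x hx
    refine hlim _ (h x hx) ?_ (fun a b ha hb => ?_) (fun c a ha => ?_) fun u a hu hua => ?_
    · simpa using aestronglyMeasurable_const
    · simp only [map_add, inner_add_right]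
      exact ha.add hb
    · simp only [map_smul, inner_smul_right]
      exact ha.const_mul c
    · exact aestronglyMeasurable_of_tendsto_ae atTop hu (Eventually.of_forall fun r =>
        tendsto_const_nhds.inner (((S r).continuous.tendsto _).comp hua))
  revert x
  refine hlim _ (fun x hx => h1 x hx y) ?_ (fun a b ha hb => ?_) (fun c a ha => ?_)
    fun u a hu hua => ?_
  · simpa using aestronglyMeasurable_const
  · simp only [inner_add_left]
    exact ha.add hb
  · simp only [inner_smul_left]
    exact ha.const_mul _
  · exact aestronglyMeasurable_of_tendsto_ae atTop hu (Eventually.of_forall fun r =>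
      hua.inner tendsto_const_nhds)

variable {S : ℝ → E →L[ℂ] E} {a b : ℝ} {c : ℝ → ℝ}

theorem intervalIntegrable_inner (hab : a ≤ b) (hc : IntervalIntegrable c volume a b)
    (hb : ∀ r ∈ Ioc a b, ‖S r‖ ≤ c r) {x y : E}
    (hm : AEStronglyMeasurable (fun r => inner ℂ x (S r y)) (volume.restrict (Ioc a b))) :
    IntervalIntegrable (fun r => inner ℂ x (S r y)) volume a b := by
  refine (hc.const_mul (‖x‖ * ‖y‖)).mono_fun (by rwa [uIoc_of_le hab]) ?_
  rw [uIoc_of_le hab]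
  refine (ae_restrict_mem measurableSet_Ioc).mono fun r hr => ?_
  refine le_trans ?_ (le_abs_self _)
  calc ‖inner ℂ x (S r y)‖ ≤ ‖x‖ * (‖S r‖ * ‖y‖) :=
        (norm_inner_le_norm _ _).trans (by gcongr; exact (S r).le_opNorm y)
    _ ≤ ‖x‖ * (c r * ‖y‖) := by gcongr; exact hb r hr
    _ = _ := by ring

/-- The integrated sesquilinear form is bounded, so the Riesz theorem represents it. Only matrix
elements need be measurable, not the operator-valued function. -/
theorem exists_weakIntegral [CompleteSpace E] (hab : a ≤ b)
    (hc : IntervalIntegrable c volume a b) (hb : ∀ r ∈ Ioc a b, ‖S r‖ ≤ c r)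
    (hm : ∀ x y, AEStronglyMeasurable (fun r => inner ℂ x (S r y)) (volume.restrict (Ioc a b))) :
    ∃ W : E →L[ℂ] E, ∀ x y, inner ℂ x (W y) = ∫ r in a..b, inner ℂ x (S r y) := by
  have hi := fun x y => intervalIntegrable_inner hab hc hb (hm x y)
  let B : E →L⋆[ℂ] E →L[ℂ] ℂ := LinearMap.mkContinuous₂
    (LinearMap.mk₂'ₛₗ (starRingEnd ℂ) (RingHom.id ℂ) (fun x y => ∫ r in a..b, inner ℂ x (S r y))
      (fun x x' y => by
        simp only [inner_add_left]
        exact intervalIntegral.integral_add (hi x y) (hi x' y))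
      (fun k x y => by
        simp only [inner_smul_left, intervalIntegral.integral_const_mul, smul_eq_mul])
      (fun x y y' => by
        simp only [map_add, inner_add_right]
        exact intervalIntegral.integral_add (hi x y) (hi x y'))
      (fun k x y => by
        simp only [map_smul, inner_smul_right, intervalIntegral.integral_const_mul, smul_eq_mul,
          RingHom.id_apply]))
    (∫ r in a..b, c r) (fun x y => by
      change ‖∫ r in a..b, inner ℂ x (S r y)‖ ≤ _
      have h1 : ∀ r ∈ Ioc a b, ‖inner ℂ x (S r y)‖ ≤ c r * (‖x‖ * ‖y‖) := fun r hr =>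
        calc ‖inner ℂ x (S r y)‖ ≤ ‖x‖ * (‖S r‖ * ‖y‖) :=
              (norm_inner_le_norm _ _).trans (by gcongr; exact (S r).le_opNorm y)
          _ ≤ ‖x‖ * (c r * ‖y‖) := by gcongr; exact hb r hr
          _ = _ := by ring
      refine (intervalIntegral.norm_integral_le_of_norm_le hab
        (Eventually.of_forall h1) (hc.mul_const _)).trans (le_of_eq ?_)
      rw [intervalIntegral.integral_mul_const, mul_assoc])
  refine ⟨ContinuousLinearMap.adjoint (InnerProductSpace.continuousLinearMapOfBilin B),
    fun x y => ?_⟩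
  rw [ContinuousLinearMap.adjoint_inner_right,
    InnerProductSpace.continuousLinearMapOfBilin_apply]
  rfl

end Abstract

/-! ### The mean field along the Hartree flow -/

variable {n : ℕ}

theorem norm_rankOneAt_le (m : Fin (n + 1)) (f g : OneParticle) :
    ‖rankOneAt m f g‖ ≤ ‖f‖ * ‖g‖ := by
  refine ContinuousLinearMap.opNorm_le_bound _ (by positivity) fun ψ => ?_
  rw [rankOneAt_apply, norm_insertL, mul_assoc]
  gcongr
  exact norm_partialInner_le m g ψ

theorem rankOneAt_sub_left (m : Fin (n + 1)) (f f' g : OneParticle) :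
    rankOneAt m (f - f') g = rankOneAt m f g - rankOneAt m f' g := by
  ext1 ψ
  rw [sub_apply, rankOneAt_apply, rankOneAt_apply, rankOneAt_apply, map_sub, sub_apply]

theorem rankOneAt_sub_right (m : Fin (n + 1)) (f g g' : OneParticle) :
    rankOneAt m f (g - g') = rankOneAt m f g - rankOneAt m f g' := by
  ext1 ψ
  rw [sub_apply, rankOneAt_apply, rankOneAt_apply, rankOneAt_apply, partialInner_sub, map_sub]

theorem continuous_rankOneAt (m : Fin (n + 1)) :
    Continuous fun p : OneParticle × OneParticle => rankOneAt m p.1 p.2 := by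
  refine continuous_iff_continuousAt.2 fun p => ?_
  rw [ContinuousAt, tendsto_iff_norm_sub_tendsto_zero]
  have h1 : Tendsto (fun q : OneParticle × OneParticle => ‖q.1 - p.1‖ * ‖q.2‖ + ‖p.1‖ * ‖q.2 - p.2‖)
      (𝓝 p) (𝓝 (‖p.1 - p.1‖ * ‖p.2‖ + ‖p.1‖ * ‖p.2 - p.2‖)) :=
    (by fun_prop : Continuous fun q : OneParticle × OneParticle =>
      ‖q.1 - p.1‖ * ‖q.2‖ + ‖p.1‖ * ‖q.2 - p.2‖).tendsto p
  simp only [sub_self, norm_zero, zero_mul, mul_zero, add_zero] at h1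
  refine squeeze_zero (fun _ => norm_nonneg _) (fun q => ?_) h1
  have : rankOneAt m q.1 q.2 - rankOneAt m p.1 p.2 =
      rankOneAt m (q.1 - p.1) q.2 + rankOneAt m p.1 (q.2 - p.2) := by
    rw [rankOneAt_sub_left, rankOneAt_sub_right]
    abel
  rw [this]
  exact (norm_add_le _ _).trans (add_le_add (norm_rankOneAt_le _ _ _) (norm_rankOneAt_le _ _ _))

/-- Solutions of the Hartree equations with an interaction which is bounded in the sense of
the mean field. -/
structure HartreeFlow (H0 : OneParticle →ₗ.[ℂ] OneParticle) (v : Space → ℝ) (T : EReal)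
    (φ : ℝ → Fin (n + 1) → OneParticle) (g : Fin (n + 1) → ℝ → OneParticle) (D : ℝ → ℝ) : Prop where
  selfAdjoint : IsSelfAdjoint H0
  measurable : Measurable v
  even : ∀ x, v (-x) = v x
  solution : ∀ j, IsSolution H0 T (fun t => φ t j) (g j)
  source : ∀ j, ∀ t ∈ timeInterval T,
    g j t =ᵐ[volume] fun x => (meanField v (φ t) x : ℂ) * φ t j x
  orthonormal_zero : Orthonormal ℂ (φ 0)
  nonneg : ∀ t ∈ timeInterval T, 0 ≤ D t
  intervalIntegrable : ∀ t ∈ timeInterval T, IntervalIntegrable (fun s => √(D s)) volume 0 t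
  integrable : ∀ t ∈ timeInterval T, ∀ z,
    Integrable fun y => v (z - y) ^ 2 * ∑ j, ‖φ t j y‖ ^ 2
  integral_le : ∀ t ∈ timeInterval T, ∀ z,
    ∫ y, v (z - y) ^ 2 * ∑ j, ‖φ t j y‖ ^ 2 ≤ D t / (n + 1)

variable {H0 : OneParticle →ₗ.[ℂ] OneParticle} {v : Space → ℝ} {T : EReal}
  {φ : ℝ → Fin (n + 1) → OneParticle} {g : Fin (n + 1) → ℝ → OneParticle} {D : ℝ → ℝ} {t : ℝ}

namespace HartreeFlow

variable (F : HartreeFlow H0 v T φ g D)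
include F

theorem isBddMeas_meanField (ht : t ∈ timeInterval T) : IsBddMeas (meanField v (φ t)) :=
  isBddMeas_integral_mul_sum_norm_sq F.measurable (F.integrable t ht) (F.integral_le t ht)

theorem isBddMeas_meanField_coord (ht : t ∈ timeInterval T) :
    IsBddMeas fun x : Config (n + 1) => ∫ y, v (x 0 - y) * ∑ j, ‖φ t j y‖ ^ 2 :=
  (F.isBddMeas_meanField ht).comp (measurable_pi_apply 0)

/-- The bound keeps the norms of the orbitals at time t instead of replacing their sum by N:
orthonormality at positive times is itself deduced from it, through `exists_norm_source_le`. -/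
theorem abs_meanField_le (ht : t ∈ timeInterval T) (x : Space) :
    |meanField v (φ t) x| ≤ √(D t) * (1 + ∑ j, ‖φ t j‖ ^ 2) := by
  have hR : 0 ≤ ∑ j, ‖φ t j‖ ^ 2 := by positivity
  have hτ : ∀ τ : ℝ, 0 < τ → |meanField v (φ t) x| ≤
      (τ * (D t / (n + 1)) + τ⁻¹ * ∑ j, ‖φ t j‖ ^ 2) / 2 := fun τ hτ =>
    abs_integral_mul_sum_norm_sq_le (F.integrable t ht) (F.integral_le t ht) hτ x
  have hD := F.nonneg t ht
  have hDN : D t / (n + 1) ≤ D t := div_le_self hD (by linarith [Nat.cast_nonneg (α := ℝ) n])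
  refine le_of_forall_pos_le_add fun ε hε => ?_
  -- Slightly more than √D, so that the weight τ = 1/s makes sense even when D vanishes.
  let s := √(D t) + ε / (1 + ∑ j, ‖φ t j‖ ^ 2)
  have hs0 : 0 < s := by positivity
  have hs : √(D t) ≤ s := le_add_of_nonneg_right (by positivity)
  have h1 : s⁻¹ * (D t / (n + 1)) ≤ s := by
    rw [inv_mul_le_iff₀ hs0]
    exact hDN.trans ((Real.sqrt_le_left hs0.le).1 hs |>.trans_eq (sq s))
  calc _ ≤ (s⁻¹ * (D t / (n + 1)) + s⁻¹⁻¹ * ∑ j, ‖φ t j‖ ^ 2) / 2 := hτ _ (inv_pos.2 hs0)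
    _ ≤ (s + s * ∑ j, ‖φ t j‖ ^ 2) / 2 := by rw [inv_inv]; gcongr
    _ ≤ s * (1 + ∑ j, ‖φ t j‖ ^ 2) := by nlinarith
    _ = _ := by simp only [s]; field_simp

theorem continuousOn (j : Fin (n + 1)) : ContinuousOn (fun t => φ t j) (timeInterval T) :=
  (F.solution j).1

theorem exists_norm_source_le (ht : t ∈ timeInterval T) :
    ∃ C, 0 ≤ C ∧ ∀ s ∈ Icc 0 t, ∀ j, ‖φ s j‖ ≤ C ∧ ‖g j s‖ ≤ C * √(D s) := by
  have h1 : ∀ j, ∃ K, ∀ s ∈ Icc 0 t, ‖φ s j‖ ≤ K := fun j =>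
    exists_bound_of_continuousOn_timeInterval (F.continuousOn j) ht
  choose K hK using h1
  have hK0 : ∀ j, 0 ≤ K j := fun j => (norm_nonneg _).trans (hK j 0 ⟨le_rfl, ht.1⟩)
  let M := ∑ j, K j
  have hM : ∀ s ∈ Icc 0 t, ∀ j, ‖φ s j‖ ≤ M := fun s hs j =>
    (hK j s hs).trans (Finset.single_le_sum (fun j _ => hK0 j) (Finset.mem_univ j))
  have hM0 : 0 ≤ M := Finset.sum_nonneg fun j _ => hK0 j
  have hR : ∀ s ∈ Icc 0 t, ∑ j, ‖φ s j‖ ^ 2 ≤ (n + 1) * M ^ 2 := fun s hs => by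
    refine (Finset.sum_le_card_nsmul _ _ (M ^ 2) fun j _ =>
      pow_le_pow_left₀ (norm_nonneg _) (hM s hs j) 2).trans (le_of_eq ?_)
    simp
  refine ⟨M + (1 + (n + 1) * M ^ 2) * M, by positivity, fun s hs j => ⟨?_, ?_⟩⟩
  · exact (hM s hs j).trans (le_add_of_nonneg_right (by positivity))
  · have h2 : ‖g j s‖ ≤ √(D s) * (1 + ∑ j, ‖φ s j‖ ^ 2) * ‖φ s j‖ := by
      refine Lp.norm_le_mul_norm_of_ae_le_mul ?_
      filter_upwards [F.source j s (Icc_subset_timeInterval ht hs)] with x hx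
      rw [hx, norm_mul, Complex.norm_real]
      exact mul_le_mul_of_nonneg_right (F.abs_meanField_le (Icc_subset_timeInterval ht hs) x)
        (norm_nonneg _)
    refine h2.trans ?_
    calc _ ≤ √(D s) * (1 + (n + 1) * M ^ 2) * M := by
          gcongr
          · exact hR s hs
          · exact hM s hs j
      _ ≤ √(D s) * (M + (1 + (n + 1) * M ^ 2) * M) := by
          rw [mul_assoc]
          exact mul_le_mul_of_nonneg_left (le_add_of_nonneg_left hM0) (Real.sqrt_nonneg _)
      _ = _ := mul_comm _ _

theorem inner_source (ht : t ∈ timeInterval T) (i j : Fin (n + 1)) :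
    inner ℂ (g i t) (φ t j) = inner ℂ (φ t i) (g j t) := by
  rw [inner_eq_integral, inner_eq_integral]
  refine integral_congr_ae ?_
  filter_upwards [F.source i t ht, F.source j t ht] with x h1 h2
  rw [h1, h2, map_mul, Complex.conj_ofReal]
  ring

/-- The Hartree flow preserves orthonormality. -/
theorem orthonormal (ht : t ∈ timeInterval T) : Orthonormal ℂ (φ t) := by
  classical
  obtain ⟨C, -, hC⟩ := F.exists_norm_source_le ht
  rw [orthonormal_iff_ite]
  intro i j
  rw [← orthonormal_iff_ite.1 F.orthonormal_zero i j]
  exact (F.solution i).inner_eq F.selfAdjoint (F.solution j) ht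
    (fun s hs => F.inner_source (Icc_subset_timeInterval ht hs) i j)
    ((F.intervalIntegrable t ht).const_mul C) (fun s hs => (hC s hs i).2) fun s hs => (hC s hs j).2

theorem continuousOn_projAt :
    ContinuousOn (fun t => projAt (n := n) (φ t) 0) (timeInterval T) := by
  have h : ∀ j, ContinuousOn (fun t => rankOneAt (n := n) 0 (φ t j) (φ t j)) (timeInterval T) :=
    fun j => (continuous_rankOneAt (n := n) 0).comp_continuousOn
      (f := fun t => (φ t j, φ t j)) ((F.continuousOn j).prodMk (F.continuousOn j))
  exact continuousOn_finsetSum Finset.univ fun j _ => h j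

end HartreeFlow

/-- The commutator of the mean field with the projection onto the orbitals. -/
def meanFieldComm (φ : ℝ → Fin (n + 1) → OneParticle) (g : Fin (n + 1) → ℝ → OneParticle) (t : ℝ) :
    NParticle (n + 1) →L[ℂ] NParticle (n + 1) :=
  ∑ j, (rankOneAt 0 (g j t) (φ t j) - rankOneAt 0 (φ t j) (g j t))

namespace HartreeFlow

variable (F : HartreeFlow H0 v T φ g D)
include F

theorem exists_norm_meanFieldComm_le (ht : t ∈ timeInterval T) :
    ∃ C, 0 ≤ C ∧ ∀ s ∈ Icc 0 t, ‖meanFieldComm φ g s‖ ≤ C * √(D s) := by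
  obtain ⟨C, h0, hC⟩ := F.exists_norm_source_le ht
  refine ⟨(n + 1) * (2 * C ^ 2), by positivity, fun s hs => ?_⟩
  refine (norm_sum_le _ _).trans ?_
  refine (Finset.sum_le_card_nsmul _ _ (2 * C ^ 2 * √(D s)) fun j _ => ?_).trans (le_of_eq ?_)
  · obtain ⟨h1, h2⟩ := hC s hs j
    calc _ ≤ ‖g j s‖ * ‖φ s j‖ + ‖φ s j‖ * ‖g j s‖ :=
          (norm_sub_le _ _).trans (add_le_add (norm_rankOneAt_le _ _ _) (norm_rankOneAt_le _ _ _))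
      _ ≤ (C * √(D s)) * C + C * (C * √(D s)) := by gcongr
      _ = _ := by ring
  · rw [Finset.card_univ, Fintype.card_fin, nsmul_eq_mul]
    push_cast
    ring

/-- Since g_j is V φ_j with V the real mean field, the operator is V p_0 - p_0 V, whose expectation
is a number minus its conjugate. -/
theorem inner_meanFieldComm (ht : t ∈ timeInterval T) (ξ : NParticle (n + 1)) :
    inner ℂ ξ (meanFieldComm φ g t ξ) = (2 * Complex.I) *
      ((inner ℂ ξ (mulL _ (F.isBddMeas_meanField_coord ht) (projAt (φ t) 0 ξ))).im : ℂ) := by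
  have h1 : ∀ j, rankOneAt 0 (g j t) (φ t j) ξ =
      mulL _ (F.isBddMeas_meanField_coord ht) (rankOneAt 0 (φ t j) (φ t j) ξ) := fun j => by
    rw [rankOneAt_apply, rankOneAt_apply]
    refine Lp.ext ?_
    filter_upwards [coeFn_insertL 0 (g j t) (partialInner 0 (φ t j) ξ),
      coeFn_insertL 0 (φ t j) (partialInner 0 (φ t j) ξ),
      coeFn_mulL (F.isBddMeas_meanField_coord ht) (insertL 0 (φ t j) (partialInner 0 (φ t j) ξ)),
      (quasiMeasurePreserving_coord 0).ae (F.source j t ht)] with x h1 h2 h3 h4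
    rw [h1, h3, h2, h4, mul_assoc]
    rfl
  have h2 : ∑ j, rankOneAt 0 (g j t) (φ t j) ξ =
      mulL _ (F.isBddMeas_meanField_coord ht) (projAt (φ t) 0 ξ) := by
    simp only [h1, projAt_apply, map_sum]
  have h3 : inner ℂ ξ (∑ j, rankOneAt 0 (φ t j) (g j t) ξ) =
      conj (inner ℂ ξ (∑ j, rankOneAt 0 (g j t) (φ t j) ξ)) := by
    rw [inner_conj_symm, sum_inner, inner_sum]
    exact Finset.sum_congr rfl fun j _ => (inner_rankOneAt _ _ _ _ _).symm
  have h4 : meanFieldComm φ g t ξ = ∑ j, rankOneAt 0 (g j t) (φ t j) ξ -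
      ∑ j, rankOneAt 0 (φ t j) (g j t) ξ := by
    simp [meanFieldComm]
  rw [h4, inner_sub_right, h3, h2, Complex.sub_conj]
  push_cast
  ring

end HartreeFlow

end

/-! ### Evolution of the projection relative to the free Hamiltonian. -/

section

variable {n : ℕ} {H0 : OneParticle →ₗ.[ℂ] OneParticle} {v : Space → ℝ} {T : EReal}
  {φ : ℝ → Fin (n + 1) → OneParticle} {g : Fin (n + 1) → ℝ → OneParticle} {D : ℝ → ℝ} {t : ℝ}

/-! ### The projection onto the orbitals and the free Hamiltonian -/

theorem partialInner_freeGenerator_fst (f : OneParticle) (u : Fin (n + 1) → H0.domain) :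
    partialInner 0 f (freeGenerator H0 u).1 =
      inner ℂ f (u 0 : OneParticle) • (freeGenerator H0 fun i => u i.succ).1 :=
  partialInner_tensor 0 f _

theorem partialInner_freeGenerator_snd (f : OneParticle) (u : Fin (n + 1) → H0.domain) :
    partialInner 0 f (freeGenerator H0 u).2 =
      inner ℂ f (H0 (u 0)) • (freeGenerator H0 fun i => u i.succ).1 +
        inner ℂ f (u 0 : OneParticle) • (freeGenerator H0 fun i => u i.succ).2 := by
  change partialInner 0 f (∑ j, tensor (Function.update (fun i => (u i : OneParticle)) j
    (H0 (u j)))) = _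
  rw [Fin.sum_univ_succ, map_add, map_sum, partialInner_tensor, Function.update_self,
    Fin.removeNth_update]
  refine congrArg₂ (· + ·) rfl ?_
  change _ = _ • ∑ j, tensor (Function.update (fun i : Fin n => (u i.succ : OneParticle)) j
    (H0 (u j.succ)))
  rw [Finset.smul_sum]
  refine Finset.sum_congr rfl fun j _ => ?_
  rw [partialInner_tensor, Function.update_of_ne (Fin.succ_ne_zero j).symm]
  congr 2
  ext i : 1
  change Function.update (fun i => (u i : OneParticle)) j.succ (H0 (u j.succ)) i.succ = _
  by_cases hij : i = j
  · subst hij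
    rw [Function.update_self, Function.update_self]
  · rw [Function.update_of_ne hij, Function.update_of_ne fun h => hij (Fin.succ_injective _ h)]

theorem inner_projAt_right (φ : Fin (n + 1) → OneParticle) (ψ χ : NParticle (n + 1)) :
    inner ℂ ψ (projAt φ 0 χ) =
      ∑ j, inner ℂ (partialInner 0 (φ j) ψ) (partialInner 0 (φ j) χ) := by
  simp only [projAt_apply, inner_sum, inner_rankOneAt_right]

theorem inner_meanFieldComm_right (ψ χ : NParticle (n + 1)) :
    inner ℂ ψ (meanFieldComm φ g t χ) =
      ∑ j, (inner ℂ (partialInner 0 (g j t) ψ) (partialInner 0 (φ t j) χ) -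
        inner ℂ (partialInner 0 (φ t j) ψ) (partialInner 0 (g j t) χ)) := by
  simp [meanFieldComm, inner_sum, inner_sub_right, inner_rankOneAt_right]

namespace HartreeFlow

variable (F : HartreeFlow H0 v T φ g D)
include F

/-- On products of domain vectors the matrix element is ∑_j ⟨u_0, φ_j⟩⟨φ_j, w_0⟩ times a constant,
so the weak Hartree equation applies to each factor although φ_j need not lie in the domain of H^0.
The free Hamiltonian of the other particles is symmetric and cancels in the commutator. -/
theorem hasDerivWithinAt_inner_projAt (ht : t ∈ timeInterval T) (u w : Fin (n + 1) → H0.domain) :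
    HasDerivWithinAt
      (fun r => inner ℂ (freeGenerator H0 u).1 (projAt (φ r) 0 (freeGenerator H0 w).1))
      (-Complex.I * (inner ℂ (freeGenerator H0 u).2 (projAt (φ t) 0 (freeGenerator H0 w).1) -
        inner ℂ (freeGenerator H0 u).1 (projAt (φ t) 0 (freeGenerator H0 w).2) +
        inner ℂ (freeGenerator H0 u).1 (meanFieldComm φ g t (freeGenerator H0 w).1)))
      (timeInterval T) t := by
  have hsym := inner_freeGenerator F.selfAdjoint (fun i => u i.succ) fun i : Fin n => w i.succ
  simp only [inner_projAt_right, inner_meanFieldComm_right, partialInner_freeGenerator_fst,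
    partialInner_freeGenerator_snd, inner_add_left, inner_add_right, inner_smul_left,
    inner_smul_right, inner_conj_symm]
  have h1 : ∀ j, HasDerivWithinAt (fun r => inner ℂ (u 0 : OneParticle) (φ r j))
      (-Complex.I * (inner ℂ (H0 (u 0)) (φ t j) + inner ℂ (u 0 : OneParticle) (g j t)))
      (timeInterval T) t := fun j => (F.solution j).2 t ht (u 0)
  have h2 : ∀ j, HasDerivWithinAt (fun r => inner ℂ (φ r j) (w 0 : OneParticle))
      (Complex.I * (inner ℂ (φ t j) (H0 (w 0)) + inner ℂ (g j t) (w 0 : OneParticle)))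
      (timeInterval T) t := fun j => by
    have h := ((F.solution j).2 t ht (w 0)).star
    simp only [RCLike.star_def, inner_conj_symm] at h
    refine h.congr_deriv ?_
    simp [inner_conj_symm]
  have h3 := HasDerivWithinAt.fun_sum (u := Finset.univ) fun j _ => ((h1 j).mul (h2 j)).mul_const
    (inner ℂ (freeGenerator H0 fun i : Fin n => u i.succ).1 (freeGenerator H0 fun i => w i.succ).1)
  refine (h3.congr_deriv ?_).congr_of_eventuallyEq ?_ ?_
  · rw [← Finset.sum_sub_distrib, ← Finset.sum_add_distrib, Finset.mul_sum]
    refine Finset.sum_congr rfl fun j _ => ?_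
    rw [hsym]
    ring
  · refine Eventually.of_forall fun r => Finset.sum_congr rfl fun j _ => ?_
    simp only [Pi.mul_apply]
    ring
  · refine Finset.sum_congr rfl fun j _ => ?_
    simp only [Pi.mul_apply]
    ring

theorem continuousOn_inner_projAt (x y : NParticle (n + 1)) :
    ContinuousOn (fun r => inner ℂ x (projAt (φ r) 0 y)) (timeInterval T) :=
  continuousOn_const.inner (F.continuousOn_projAt.clm_apply continuousOn_const)

theorem norm_projAt_le_one (ht : t ∈ timeInterval T) : ‖projAt (n := n) (φ t) 0‖ ≤ 1 :=
  ContinuousLinearMap.opNorm_le_bound _ zero_le_one fun x => by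
    rw [one_mul]; exact norm_projAt_le (F.orthonormal ht) 0 x

variable {a b : ℝ} (ha : 0 ≤ a) (hb : b ∈ timeInterval T)
include ha hb

omit F in
theorem _root_.FermionMF.Icc_subset_timeInterval_of_nonneg : Icc a b ⊆ timeInterval T :=
  fun _ hs => mem_timeInterval_of_le hb (ha.trans hs.1) hs.2

theorem intervalIntegrable_sqrt (hab : a ≤ b) : IntervalIntegrable (fun s => √(D s)) volume a b :=
  (F.intervalIntegrable b hb).mono_set (by
    rw [uIcc_of_le hab, uIcc_of_le (ha.trans hab)]
    exact Icc_subset_Icc_left ha)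

theorem aestronglyMeasurable_inner_projAt (x y : NParticle (n + 1)) :
    AEStronglyMeasurable (fun r => inner ℂ x (projAt (φ r) 0 y)) (volume.restrict (Ioc a b)) :=
  (((F.continuousOn_inner_projAt x y).mono (Icc_subset_timeInterval_of_nonneg ha hb)).mono
    Ioc_subset_Icc_self).aestronglyMeasurable measurableSet_Ioc

theorem hasDerivAt_inner_projAt (u w : Fin (n + 1) → H0.domain) {r : ℝ} (hr : r ∈ Ioo a b) :
    HasDerivAt
      (fun r => inner ℂ (freeGenerator H0 u).1 (projAt (φ r) 0 (freeGenerator H0 w).1))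
      (-Complex.I * (inner ℂ (freeGenerator H0 u).2 (projAt (φ r) 0 (freeGenerator H0 w).1) -
        inner ℂ (freeGenerator H0 u).1 (projAt (φ r) 0 (freeGenerator H0 w).2) +
        inner ℂ (freeGenerator H0 u).1 (meanFieldComm φ g r (freeGenerator H0 w).1))) r := by
  have h := Icc_subset_timeInterval_of_nonneg ha hb (Ioo_subset_Icc_self hr)
  exact (F.hasDerivWithinAt_inner_projAt h u w).hasDerivAt
    (timeInterval_mem_nhds h (ha.trans_lt hr.1))

/-- The sources carry no measurability assumption in time. On product vectors the matrix element is
recovered from the derivative formula, where every other term is measurable. -/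
theorem aestronglyMeasurable_inner_meanFieldComm (x y : NParticle (n + 1)) :
    AEStronglyMeasurable (fun r => inner ℂ x (meanFieldComm φ g r y))
      (volume.restrict (Ioc a b)) := by
  refine aestronglyMeasurable_inner_of_dense
    (dense_span_domain_tensor (N := n + 1) F.selfAdjoint) ?_ x y
  rintro _ ⟨u, rfl⟩ _ ⟨w, rfl⟩
  have h1 : AEStronglyMeasurable (fun r => Complex.I * deriv
      (fun r => inner ℂ (freeGenerator H0 u).1 (projAt (φ r) 0 (freeGenerator H0 w).1)) r -
      inner ℂ (freeGenerator H0 u).2 (projAt (φ r) 0 (freeGenerator H0 w).1) +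
      inner ℂ (freeGenerator H0 u).1 (projAt (φ r) 0 (freeGenerator H0 w).2))
      (volume.restrict (Ioc a b)) :=
    (((stronglyMeasurable_deriv _).aestronglyMeasurable.const_mul _).sub
      (F.aestronglyMeasurable_inner_projAt ha hb _ _)).add
      (F.aestronglyMeasurable_inner_projAt ha hb _ _)
  refine h1.congr ?_
  rw [← restrict_Ioo_eq_restrict_Ioc]
  filter_upwards [ae_restrict_mem measurableSet_Ioo] with r hr
  rw [(F.hasDerivAt_inner_projAt ha hb u w hr).deriv, ← mul_assoc, mul_neg, Complex.I_mul_I,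
    neg_neg, one_mul]
  change _ = inner ℂ (freeGenerator H0 u).1 (meanFieldComm φ g r (freeGenerator H0 w).1)
  ring

/-- The time evolution of the projection onto the orbitals, in integrated form. -/
theorem exists_integral_projAt (hab : a ≤ b) : ∃ P S R : NParticle (n + 1) →L[ℂ] NParticle (n + 1),
    (∀ x y, inner ℂ x (P y) = ∫ r in a..b, inner ℂ x (projAt (φ r) 0 y)) ∧
    (∀ x y, inner ℂ x (S y) = ∫ r in a..b, inner ℂ x (meanFieldComm φ g r y)) ∧
    (∀ x y, inner ℂ x (R y) = ∫ r in a..b, (6 * √(D r) : ℝ) * inner ℂ x (projAt (φ r) 0 y)) ∧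
    ∀ x ∈ (freeHamiltonian (n + 1) H0).graph, ∀ y ∈ (freeHamiltonian (n + 1) H0).graph,
      Complex.I * inner ℂ x.1 (projAt (φ b) 0 y.1 - projAt (φ a) 0 y.1) =
        inner ℂ x.2 (P y.1) - inner ℂ x.1 (P y.2) + inner ℂ x.1 (S y.1) := by
  have hsub := Icc_subset_timeInterval_of_nonneg ha hb
  have hD := F.intervalIntegrable_sqrt ha hb hab
  obtain ⟨C, -, hC⟩ := F.exists_norm_meanFieldComm_le hb
  have hPm := F.aestronglyMeasurable_inner_projAt ha hb
  have hSm := F.aestronglyMeasurable_inner_meanFieldComm ha hb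
  have hPb : ∀ r ∈ Ioc a b, ‖projAt (n := n) (φ r) 0‖ ≤ 1 := fun r hr =>
    F.norm_projAt_le_one (hsub (Ioc_subset_Icc_self hr))
  have hSb : ∀ r ∈ Ioc a b, ‖meanFieldComm φ g r‖ ≤ C * √(D r) := fun r hr =>
    hC r ⟨ha.trans hr.1.le, hr.2⟩
  have h1 : IntervalIntegrable (fun _ : ℝ => (1 : ℝ)) volume a b := intervalIntegrable_const
  obtain ⟨P, hP⟩ := exists_weakIntegral hab h1 hPb hPm
  obtain ⟨S, hS⟩ := exists_weakIntegral hab (hD.const_mul C) hSb hSm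
  obtain ⟨R, hR⟩ := exists_weakIntegral (S := fun r => ((6 * √(D r) : ℝ) : ℂ) • projAt (φ r) 0)
    hab (hD.const_mul 6) (fun r hr => by
      rw [norm_smul, Complex.norm_real, Real.norm_eq_abs, abs_of_nonneg (by positivity)]
      exact mul_le_of_le_one_right (by positivity) (hPb r hr)) (fun x y => by
      simp only [smul_apply, inner_smul_right]
      have : AEStronglyMeasurable (fun r => ((6 * √(D r) : ℝ) : ℂ)) (volume.restrict (Ioc a b)) :=
        Complex.continuous_ofReal.comp_aestronglyMeasurable
          (hD.const_mul 6).aestronglyMeasurable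
      exact this.mul (hPm x y))
  refine ⟨P, S, R, hP, hS, fun x y => by simp only [hR, smul_apply, inner_smul_right], ?_⟩
  intro x hx y hy
  rw [graph_freeHamiltonian F.selfAdjoint] at hx hy
  -- After integration in time only bounded operators act on the two components of the graph
  -- elements, so the identity passes from the generators to the closed graph; a pointwise
  -- derivative would not pass to the limit so directly.
  have key := inner_eq_of_mem_closure_span
    (L₁ := (Complex.I • (projAt (φ b) 0 - projAt (φ a) 0) - S).comp (ContinuousLinearMap.fst ℂ _ _) +
      P.comp (ContinuousLinearMap.snd ℂ _ _))
    (L₂ := P.comp (ContinuousLinearMap.fst ℂ _ _))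
    (Γ := range (freeGenerator (N := n + 1) H0)) ?_ hx hy
  · simp only [ContinuousLinearMap.comp_apply, add_apply, sub_apply, smul_apply, inner_add_right,
      inner_sub_right, inner_smul_right, ContinuousLinearMap.coe_fst',
      ContinuousLinearMap.coe_snd'] at key
    rw [inner_sub_right, ← key]
    ring
  · rintro _ ⟨u, rfl⟩ _ ⟨w, rfl⟩
    have hi1 := fun x y => intervalIntegrable_inner hab h1 hPb (hPm x y)
    have hi2 := fun x y => intervalIntegrable_inner hab (hD.const_mul C) hSb (hSm x y)
    have hftc := intervalIntegral.integral_eq_sub_of_hasDerivAt_of_le hab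
      ((F.continuousOn_inner_projAt _ _).mono hsub)
      (fun r hr => F.hasDerivAt_inner_projAt ha hb u w hr)
      ((((hi1 _ _).sub (hi1 _ _)).add (hi2 _ _)).const_mul _)
    rw [intervalIntegral.integral_const_mul, intervalIntegral.integral_add
      ((hi1 _ _).sub (hi1 _ _)) (hi2 _ _), intervalIntegral.integral_sub (hi1 _ _) (hi1 _ _),
      ← hP, ← hP, ← hS] at hftc
    simp only [ContinuousLinearMap.comp_apply, add_apply, sub_apply, smul_apply, inner_add_right,
      inner_sub_right, inner_smul_right, ContinuousLinearMap.coe_fst',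
      ContinuousLinearMap.coe_snd']
    rw [← hftc]
    linear_combination (-1 : ℂ) * (inner ℂ (freeGenerator H0 u).2 (P (freeGenerator H0 w).1) -
      inner ℂ (freeGenerator H0 u).1 (P (freeGenerator H0 w).2) +
      inner ℂ (freeGenerator H0 u).1 (S (freeGenerator H0 w).1)) * Complex.I_mul_I

end HartreeFlow

end

/-! ### Evolution of the projection relative to the interacting Hamiltonian. -/

section

variable {n : ℕ} {H0 : OneParticle →ₗ.[ℂ] OneParticle} {v : Space → ℝ} {T : EReal}
  {φ : ℝ → Fin (n + 1) → OneParticle} {g : Fin (n + 1) → ℝ → OneParticle} {D : ℝ → ℝ} {t : ℝ}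

/-! ### The projection onto the orbitals and the full Hamiltonian -/

theorem excitation_eq_sub_re {φ : Fin (n + 1) → OneParticle} (hφ : Orthonormal ℂ φ)
    (ξ : NParticle (n + 1)) :
    excitation φ ξ = ‖ξ‖ ^ 2 - (inner ℂ ξ (projAt φ 0 ξ)).re := by
  have h := congrArg Complex.re (inner_sub_projAt hφ 0 ξ)
  rw [inner_sub_right, Complex.sub_re, Complex.ofReal_re] at h
  rw [excitation, ← h]
  congr 1
  exact inner_self_eq_norm_sq (𝕜 := ℂ) ξ

namespace HartreeFlow

variable (F : HartreeFlow H0 v T φ g D)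
include F

/-- The bound on the part of the commutator which is not due to the free Hamiltonian. -/
theorem norm_inner_mulOp_comm_le (ht : t ∈ timeInterval T) {ξ : NParticle (n + 1)}
    (hξ : IsAntisymmetric ξ) (hξV : ξ ∈ (mulOp (pairPotential (n + 1) v)).domain) :
    ‖inner ℂ ξ (meanFieldComm φ g t ξ) -
      (inner ℂ (mulOp (pairPotential (n + 1) v) ⟨ξ, hξV⟩) (projAt (φ t) 0 ξ) -
        inner ℂ ξ (projAt (φ t) 0 (mulOp (pairPotential (n + 1) v) ⟨ξ, hξV⟩)))‖ ≤
      6 * √(D t) * ((1 + 1 / (n + 1)) * ‖ξ‖ ^ 2 - (inner ℂ ξ (projAt (φ t) 0 ξ)).re) := by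
  have hφ := F.orthonormal ht
  have hN : (0 : ℝ) < n + 1 := by positivity
  set ζ := mulOp (pairPotential (n + 1) v) ⟨ξ, hξV⟩ with hζ
  set V := mulL _ (F.isBddMeas_meanField_coord ht) with hV
  have hconj : inner ℂ ξ (projAt (φ t) 0 ζ) = conj (inner ℂ ζ (projAt (φ t) 0 ξ)) := by
    rw [inner_conj_symm, inner_projAt]
  have e : inner ℂ ξ (meanFieldComm φ g t ξ) -
      (inner ℂ ζ (projAt (φ t) 0 ξ) - inner ℂ ξ (projAt (φ t) 0 ζ)) =
      -(2 * Complex.I) *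
        (((inner ℂ ζ (projAt (φ t) 0 ξ) - inner ℂ ξ (V (projAt (φ t) 0 ξ))).im : ℝ) : ℂ) := by
    rw [F.inner_meanFieldComm ht, hconj, Complex.sub_conj, Complex.sub_im]
    push_cast
    ring
  -- The derivative estimate needs κ > 0 while D may vanish, so it is applied for κ > √D and the
  -- limit is taken afterwards.
  have h1 : ∀ κ : ℝ, √(D t) < κ →
      |(inner ℂ ζ (projAt (φ t) 0 ξ) - inner ℂ ξ (V (projAt (φ t) 0 ξ))).im| ≤
        3 * κ * (excitation (φ t) ξ + ‖ξ‖ ^ 2 / (n + 1)) := fun κ hκ => by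
    have hκ0 : 0 < κ := (Real.sqrt_nonneg _).trans_lt hκ
    refine abs_im_inner_mulOp_sub_le hφ F.measurable F.even hκ0 (F.integrable t ht) (fun z => ?_)
      (F.isBddMeas_meanField_coord ht) hξ hξV
    refine (F.integral_le t ht z).trans ?_
    gcongr
    exact (Real.sqrt_le_left hκ0.le).1 hκ.le
  have h2 : |(inner ℂ ζ (projAt (φ t) 0 ξ) - inner ℂ ξ (V (projAt (φ t) 0 ξ))).im| ≤
      3 * √(D t) * (excitation (φ t) ξ + ‖ξ‖ ^ 2 / (n + 1)) := by
    have hlim : Tendsto (fun κ : ℝ => 3 * κ * (excitation (φ t) ξ + ‖ξ‖ ^ 2 / (n + 1)))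
        (𝓝[>] √(D t)) (𝓝 (3 * √(D t) * (excitation (φ t) ξ + ‖ξ‖ ^ 2 / (n + 1)))) :=
      ((by fun_prop : Continuous fun κ : ℝ => 3 * κ * (excitation (φ t) ξ + ‖ξ‖ ^ 2 / (n + 1))).tendsto
        _).mono_left nhdsWithin_le_nhds
    exact ge_of_tendsto hlim (eventually_mem_nhdsWithin.mono h1)
  rw [e, norm_mul, norm_neg, norm_mul, Complex.norm_I, Complex.norm_real, Real.norm_eq_abs]
  have h3 : ‖(2 : ℂ)‖ = 2 := by simp
  rw [h3, mul_one]
  refine (mul_le_mul_of_nonneg_left h2 zero_le_two).trans (le_of_eq ?_)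
  rw [excitation_eq_sub_re hφ]
  ring

/-- The time evolution of the projection onto the orbitals on the domain of the Hamiltonian, in
integrated form. -/
theorem exists_norm_inner_projAt_sub_le (hH : IsSelfAdjoint (hamiltonian (n + 1) H0 v))
    {a b : ℝ} (ha : 0 ≤ a) (hb : b ∈ timeInterval T) (hab : a ≤ b)
    {ξ : NParticle (n + 1)} (hξ : IsAntisymmetric ξ)
    (hξH : ξ ∈ (hamiltonian (n + 1) H0 v).domain) :
    ‖Complex.I * inner ℂ ξ (projAt (φ b) 0 ξ - projAt (φ a) 0 ξ) -
      ∫ r in a..b, (inner ℂ (hamiltonian (n + 1) H0 v ⟨ξ, hξH⟩) (projAt (φ r) 0 ξ) -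
        inner ℂ ξ (projAt (φ r) 0 (hamiltonian (n + 1) H0 v ⟨ξ, hξH⟩)))‖ ≤
      ∫ r in a..b, 6 * √(D r) *
        ((1 + 1 / (n + 1)) * ‖ξ‖ ^ 2 - (inner ℂ ξ (projAt (φ r) 0 ξ)).re) := by
  obtain ⟨P, S, R, hP, hS, hR, hK⟩ := F.exists_integral_projAt ha hb hab
  have hsub := Icc_subset_timeInterval_of_nonneg ha hb
  have hD := F.intervalIntegrable_sqrt ha hb hab
  have hPi : ∀ x y : NParticle (n + 1), IntervalIntegrable (fun r => inner ℂ x (projAt (φ r) 0 y))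
      volume a b := fun x y => by
    refine ContinuousOn.intervalIntegrable ?_
    rw [uIcc_of_le hab]
    exact (F.continuousOn_inner_projAt x y).mono hsub
  have hRi : ∀ x y : NParticle (n + 1), IntervalIntegrable
      (fun r => (6 * √(D r) : ℝ) * inner ℂ x (projAt (φ r) 0 y)) volume a b := fun x y => by
    have h6 : IntervalIntegrable (fun r => ((6 * √(D r) : ℝ) : ℂ)) volume a b :=
      ⟨(hD.const_mul 6).1.ofReal, (hD.const_mul 6).2.ofReal⟩
    refine h6.mul_continuousOn ?_
    rw [uIcc_of_le hab]
    exact (F.continuousOn_inner_projAt x y).mono hsub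
  have hRe : ∀ x : NParticle (n + 1), (inner ℂ x (R x)).re =
      ∫ r in a..b, 6 * √(D r) * (inner ℂ x (projAt (φ r) 0 x)).re := fun x => by
    rw [hR]
    refine (Complex.reCLM.intervalIntegral_comp_comm (hRi x x)).symm.trans ?_
    simp only [Complex.reCLM_apply, Complex.re_ofReal_mul]
  have hRre : ∀ x : NParticle (n + 1), IntervalIntegrable
      (fun r => 6 * √(D r) * (inner ℂ x (projAt (φ r) 0 x)).re) volume a b := fun x => by
    refine (hD.const_mul 6).mul_continuousOn ?_
    rw [uIcc_of_le hab]
    exact Complex.continuous_re.comp_continuousOn ((F.continuousOn_inner_projAt x x).mono hsub)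
  have hRHS : ∀ x : NParticle (n + 1), ∫ r in a..b, 6 * √(D r) *
      ((1 + 1 / (n + 1)) * ‖x‖ ^ 2 - (inner ℂ x (projAt (φ r) 0 x)).re) =
      (∫ r in a..b, 6 * √(D r)) * ((1 + 1 / (n + 1)) * ‖x‖ ^ 2) - (inner ℂ x (R x)).re :=
    fun x => by
    simp only [mul_sub]
    rw [intervalIntegral.integral_sub ((hD.const_mul 6).mul_const _) (hRre x), hRe,
      intervalIntegral.integral_mul_const]
  have hLHS : ∀ x y : NParticle (n + 1), ∫ r in a..b, (inner ℂ y (projAt (φ r) 0 x) -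
      inner ℂ x (projAt (φ r) 0 y)) = inner ℂ y (P x) - inner ℂ x (P y) := fun x y => by
    rw [intervalIntegral.integral_sub (hPi _ _) (hPi _ _), hP, hP]
  rw [hRHS, hLHS]
  set c := ∫ r in a..b, 6 * √(D r) with hc
  -- the estimate on the core
  have hcore : ∀ x (hx : x ∈ (freeHamiltonian (n + 1) H0 +
      mulOp (pairPotential (n + 1) v)).domain), IsAntisymmetric x →
      ‖Complex.I * inner ℂ x (projAt (φ b) 0 x - projAt (φ a) 0 x) -
        (inner ℂ ((freeHamiltonian (n + 1) H0 + mulOp (pairPotential (n + 1) v)) ⟨x, hx⟩) (P x) -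
          inner ℂ x (P ((freeHamiltonian (n + 1) H0 +
            mulOp (pairPotential (n + 1) v)) ⟨x, hx⟩)))‖ ≤
        c * ((1 + 1 / (n + 1)) * ‖x‖ ^ 2) - (inner ℂ x (R x)).re := by
    intro x hx hxa
    have h1 := hK _ ((freeHamiltonian (n + 1) H0).mem_graph ⟨x, hx.1⟩) _
      ((freeHamiltonian (n + 1) H0).mem_graph ⟨x, hx.1⟩)
    rw [h1, LinearPMap.add_apply]
    set ζ := mulOp (pairPotential (n + 1) v) ⟨x, hx.2⟩ with hζ
    obtain ⟨C, -, hC⟩ := F.exists_norm_meanFieldComm_le hb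
    have hSi : IntervalIntegrable (fun r => inner ℂ x (meanFieldComm φ g r x)) volume a b :=
      intervalIntegrable_inner hab (hD.const_mul C) (fun r hr => hC r ⟨ha.trans hr.1.le, hr.2⟩)
        (F.aestronglyMeasurable_inner_meanFieldComm ha hb x x)
    have e : ∀ κ : NParticle (n + 1), inner ℂ κ (P x) - inner ℂ x (P κ) + inner ℂ x (S x) -
        (inner ℂ (κ + ζ) (P x) - inner ℂ x (P (κ + ζ))) =
        ∫ r in a..b, (inner ℂ x (meanFieldComm φ g r x) -
          (inner ℂ ζ (projAt (φ r) 0 x) - inner ℂ x (projAt (φ r) 0 ζ))) := fun κ => by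
      rw [intervalIntegral.integral_sub hSi ((hPi _ _).sub (hPi _ _)), hLHS, ← hS, map_add,
        inner_add_left, inner_add_right]
      ring
    refine (congrArg norm (e _)).le.trans ?_
    rw [← hRHS]
    refine intervalIntegral.norm_integral_le_of_norm_le hab
      (Eventually.of_forall fun r hr => F.norm_inner_mulOp_comm_le
        (hsub (Ioc_subset_Icc_self hr)) hxa hx.2) ?_
    simp only [mul_sub]
    exact ((hD.const_mul 6).mul_const _).sub (hRre x)
  -- extension to the domain of the Hamiltonian
  let η := hamiltonian (n + 1) H0 v ⟨ξ, hξH⟩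
  have hmem : (ξ, η) ∈ (freeHamiltonian (n + 1) H0 +
      mulOp (pairPotential (n + 1) v)).graph.topologicalClosure := by
    rw [← graph_closure_of_isSelfAdjoint hH]
    exact (hamiltonian (n + 1) H0 v).mem_graph ⟨ξ, hξH⟩
  obtain ⟨z, hz, hzlim⟩ := mem_closure_iff_seq_limit.1 hmem
  have hη : antisymmetrizer (n + 1) η = η := by
    have h1 := antisymmetrizer_mem_graph (fun σ z hz =>
      permL_mem_graph_hamiltonian F.selfAdjoint F.even hH σ hz)
      ((hamiltonian (n + 1) H0 v).mem_graph ⟨ξ, hξH⟩)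
    simp only [antisymmetrizer_of_isAntisymmetric hξ] at h1
    exact (exists_apply_of_mem_graph h1).choose_spec.symm
  -- The estimate on the core holds for antisymmetric vectors only, so the approximants are
  -- antisymmetrised. They stay in the core by permutation invariance and keep their limits, because
  -- ξ and its image are both fixed by the antisymmetriser.
  have hlim1 : Tendsto (fun k => antisymmetrizer (n + 1) (z k).1) atTop (𝓝 ξ) := by
    have := (((antisymmetrizer (n + 1)).continuous.comp continuous_fst).tendsto _).comp hzlim
    simpa only [Function.comp_def, antisymmetrizer_of_isAntisymmetric hξ] using this
  have hlim2 : Tendsto (fun k => antisymmetrizer (n + 1) (z k).2) atTop (𝓝 η) := by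
    have := (((antisymmetrizer (n + 1)).continuous.comp continuous_snd).tendsto _).comp hzlim
    simpa only [Function.comp_def, hη] using this
  have hk : ∀ k, ‖Complex.I * inner ℂ (antisymmetrizer (n + 1) (z k).1)
        (projAt (φ b) 0 (antisymmetrizer (n + 1) (z k).1) -
          projAt (φ a) 0 (antisymmetrizer (n + 1) (z k).1)) -
        (inner ℂ (antisymmetrizer (n + 1) (z k).2) (P (antisymmetrizer (n + 1) (z k).1)) -
          inner ℂ (antisymmetrizer (n + 1) (z k).1) (P (antisymmetrizer (n + 1) (z k).2)))‖ ≤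
        c * ((1 + 1 / (n + 1)) * ‖antisymmetrizer (n + 1) (z k).1‖ ^ 2) -
          (inner ℂ (antisymmetrizer (n + 1) (z k).1) (R (antisymmetrizer (n + 1) (z k).1))).re := by
    intro k
    obtain ⟨h1, h2⟩ := exists_apply_of_mem_graph (antisymmetrizer_mem_graph (fun σ z hz =>
      permL_mem_graph_add F.selfAdjoint F.even σ hz) (hz k))
    have := hcore _ h1 (isAntisymmetric_antisymmetrizer _)
    rwa [h2] at this
  have hcont1 : Continuous fun z : NParticle (n + 1) × NParticle (n + 1) =>
      ‖Complex.I * inner ℂ z.1 (projAt (φ b) 0 z.1 - projAt (φ a) 0 z.1) -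
        (inner ℂ z.2 (P z.1) - inner ℂ z.1 (P z.2))‖ := by fun_prop
  have hcont2 : Continuous fun z : NParticle (n + 1) =>
      c * ((1 + 1 / ((n : ℝ) + 1)) * ‖z‖ ^ 2) - (inner ℂ z (R z)).re := by fun_prop
  exact le_of_tendsto_of_tendsto' ((hcont1.tendsto (ξ, η)).comp (hlim1.prodMk_nhds hlim2))
    ((hcont2.tendsto ξ).comp hlim1) hk

end HartreeFlow

end

/-! ### The one-step estimate, Gronwall's inequality and removal of the regularisation. -/

section

/-! ### The Gronwall estimate -/

section Abstract

variable {E : Type*} [NormedAddCommGroup E] [InnerProductSpace ℂ E]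

/-- One time step with ξ' = ξ - i h ζ + e and ‖e‖ ≤ ε h. The first-order change of ξ is matched by
Z, which stands for the integrated commutator; the change of P not accounted for by Z is R. The
terms with e, the quadratic term in ξ' - ξ and the error in Z make up the ε h contribution. -/
theorem norm_inner_sub_inner_le {P P' : E →L[ℂ] E} {ξ ζ ξ' : E} {h ε M R : ℝ} {Z : ℂ}
    (hP : ‖P'‖ ≤ 1) (hξ : ‖ξ‖ ≤ M) (hζ : ‖ζ‖ ≤ M) (hh : 0 ≤ h) (hhε : h ≤ ε) (hε1 : ε ≤ 1)
    (hξ' : ‖ξ' - ξ + (Complex.I * h) • ζ‖ ≤ ε * h)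
    (hZ : ‖Z - h * (inner ℂ ζ (P' ξ) - inner ℂ ξ (P' ζ))‖ ≤ 2 * ε * M ^ 2 * h)
    (hR : ‖Complex.I * inner ℂ ξ (P' ξ - P ξ) - Z‖ ≤ R) :
    ‖inner ℂ ξ' (P' ξ') - inner ℂ ξ (P ξ)‖ ≤ R + ε * (2 * M ^ 2 + 2 * M + (M + 1) ^ 2) * h := by
  have hM : 0 ≤ M := (norm_nonneg _).trans hξ
  have hε0 : 0 ≤ ε := hh.trans hhε
  set e := ξ' - ξ + (Complex.I * h) • ζ with he
  set d := ξ' - ξ with hd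
  have hde : d = e - (Complex.I * h) • ζ := by rw [he]; abel
  have hb : ∀ x y : E, ‖inner ℂ x (P' y)‖ ≤ ‖x‖ * ‖y‖ := fun x y =>
    (norm_inner_le_norm _ _).trans (mul_le_mul_of_nonneg_left
      ((P'.le_opNorm y).trans (mul_le_of_le_one_left (norm_nonneg _) hP)) (norm_nonneg _))
  have hdn : ‖d‖ ≤ (M + 1) * h := by
    rw [hde]
    refine (norm_sub_le _ _).trans ?_
    rw [norm_smul, norm_mul, Complex.norm_I, Complex.norm_real, Real.norm_eq_abs, abs_of_nonneg hh]
    nlinarith [mul_le_mul_of_nonneg_left hζ hh, mul_le_mul_of_nonneg_right hε1 hh]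
  have key : inner ℂ ξ' (P' ξ') - inner ℂ ξ (P ξ) =
      -Complex.I * (Complex.I * inner ℂ ξ (P' ξ - P ξ) - Z) +
      -Complex.I * (Z - h * (inner ℂ ζ (P' ξ) - inner ℂ ξ (P' ζ))) +
      (inner ℂ ξ (P' e) + inner ℂ e (P' ξ)) + inner ℂ d (P' d) := by
    have h1 : ξ' = ξ + d := by rw [hd]; abel
    have h2 : inner ℂ ξ (P' d) = inner ℂ ξ (P' e) - Complex.I * h * inner ℂ ξ (P' ζ) := by
      rw [hde, map_sub, map_smul, inner_sub_right, inner_smul_right]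
    have h3 : inner ℂ d (P' ξ) = inner ℂ e (P' ξ) + Complex.I * h * inner ℂ ζ (P' ξ) := by
      rw [hde, inner_sub_left, inner_smul_left]
      simp
    rw [h1, map_add, inner_add_left, inner_add_right, inner_add_right, h2, h3, inner_sub_right]
    linear_combination (inner ℂ ξ (P ξ) - inner ℂ ξ (P' ξ)) * (-Complex.I_mul_I)
  rw [key]
  refine (norm_add_le _ _).trans ((add_le_add_left ((norm_add₃_le).trans (add_le_add_right
    (norm_add_le _ _) _)) _).trans ?_)
  rw [norm_mul, norm_mul, norm_neg, Complex.norm_I, one_mul, one_mul]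
  have h1 : ‖inner ℂ ξ (P' e)‖ ≤ M * (ε * h) := (hb _ _).trans (by gcongr)
  have h2 : ‖inner ℂ e (P' ξ)‖ ≤ ε * h * M := (hb _ _).trans (by gcongr)
  have h3 : ‖inner ℂ d (P' d)‖ ≤ (M + 1) ^ 2 * ε * h := by
    refine (hb _ _).trans ?_
    calc ‖d‖ * ‖d‖ ≤ ((M + 1) * h) * ((M + 1) * h) := by gcongr
      _ = (M + 1) ^ 2 * h * h := by ring
      _ ≤ _ := by gcongr
  linarith

variable [CompleteSpace E] {A : E →ₗ.[ℂ] E} {T : EReal} {l : ℝ}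

theorem IsSolution.resolvent (hA : IsSelfAdjoint A) (hl : l ≠ 0) {f : ℝ → E}
    (h : IsSolution A T f 0) : IsSolution A T (fun s => resolvent A l (f s)) 0 := by
  refine ⟨(FermionMF.resolvent A l).continuous.comp_continuousOn h.1, fun t ht u => ?_⟩
  refine (h.hasDerivWithinAt_resolvent hA hl ht u).congr_deriv ?_
  have := inner_map_eq_of_isSelfAdjoint hA u ⟨_, resolvent_mem hA hl (f t)⟩
  simp only [Pi.zero_apply, map_zero, add_zero, inner_smul_right, inner_zero_right]
  rw [← this]

theorem norm_map_resolvent_le (hA : IsSelfAdjoint A) (hl : l ≠ 0) (w : E) :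
    ‖A ⟨FermionMF.resolvent A l w, resolvent_mem hA hl w⟩‖ ≤ |l|⁻¹ * (2 * ‖w‖) := by
  rw [map_resolvent hA hl, norm_smul, norm_inv, norm_mul, Complex.norm_I, one_mul, Complex.norm_real,
    Real.norm_eq_abs]
  refine mul_le_mul_of_nonneg_left ((norm_sub_le _ _).trans ?_) (by positivity)
  linarith [norm_resolvent_le hA hl w]

end Abstract

variable {n : ℕ} {H0 : OneParticle →ₗ.[ℂ] OneParticle} {v : Space → ℝ} {T : EReal}
  {φ : ℝ → Fin (n + 1) → OneParticle} {g : Fin (n + 1) → ℝ → OneParticle} {D : ℝ → ℝ} {t : ℝ}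

namespace HartreeFlow

variable (F : HartreeFlow H0 v T φ g D) (hH : IsSelfAdjoint (hamiltonian (n + 1) H0 v))
  {ψ : ℝ → NParticle (n + 1)} (hψ : IsSchroedingerSolution H0 v T ψ)
  (h0 : IsAntisymmetric (ψ 0)) (ht : t ∈ timeInterval T)
include F hH hψ h0 ht

/-- The controlled quantity is the excitation plus ‖ξ‖²/N for the regularised state ξ, which is
antisymmetric, lies in the domain and solves the same equation. The norm is carried along because
the resolvent destroys normalisation, but it is constant in time. -/
theorem resolvent_gronwall {l : ℝ} (hl : l ≠ 0) :
    (1 + 1 / (n + 1)) * ‖resolvent (hamiltonian (n + 1) H0 v) l (ψ t)‖ ^ 2 -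
      (inner ℂ (resolvent (hamiltonian (n + 1) H0 v) l (ψ t))
        (projAt (φ t) 0 (resolvent (hamiltonian (n + 1) H0 v) l (ψ t)))).re ≤
    Real.exp (∫ s in (0 : ℝ)..t, 6 * √(D s)) *
      ((1 + 1 / (n + 1)) * ‖resolvent (hamiltonian (n + 1) H0 v) l (ψ 0)‖ ^ 2 -
        (inner ℂ (resolvent (hamiltonian (n + 1) H0 v) l (ψ 0))
          (projAt (φ 0) 0 (resolvent (hamiltonian (n + 1) H0 v) l (ψ 0)))).re) := by
  have hN : (0 : ℝ) < n + 1 := by positivity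
  set H := hamiltonian (n + 1) H0 v with hHdef
  let ξ : ℝ → NParticle (n + 1) := fun s => resolvent H l (ψ s)
  let y : ℝ → ℝ := fun s => (1 + 1 / (n + 1)) * ‖ξ s‖ ^ 2 - (inner ℂ (ξ s) (projAt (φ s) 0 (ξ s))).re
  have hsub := Icc_subset_timeInterval ht
  have hξn : ∀ s ∈ Icc 0 t, ‖ξ s‖ = ‖ξ 0‖ := fun s hs =>
    (IsSolution.resolvent hH hl hψ).norm_eq hH (hsub hs)
  have hψn : ∀ s ∈ Icc 0 t, ‖ψ s‖ = ‖ψ 0‖ := fun s hs => IsSolution.norm_eq hH hψ (hsub hs)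
  obtain ⟨M, hM0, hM1, hM2⟩ : ∃ M, 0 ≤ M ∧ (∀ s ∈ Icc 0 t, ‖ξ s‖ ≤ M) ∧
      ∀ s ∈ Icc 0 t, ‖H ⟨ξ s, resolvent_mem hH hl (ψ s)⟩‖ ≤ M := by
    refine ⟨‖ψ 0‖ + |l|⁻¹ * (2 * ‖ψ 0‖), by positivity, fun s hs => ?_, fun s hs => ?_⟩
    · exact (norm_resolvent_le hH hl _).trans ((hψn s hs).le.trans
        (le_add_of_nonneg_right (by positivity)))
    · refine (norm_map_resolvent_le hH hl _).trans ?_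
      rw [hψn s hs]
      exact le_add_of_nonneg_left (norm_nonneg _)
  have hinner : ∀ (S : NParticle (n + 1) →L[ℂ] NParticle (n + 1)) (x z : NParticle (n + 1)) (ε : ℝ),
      ‖S‖ ≤ ε → ‖x‖ ≤ M → ‖z‖ ≤ M → ‖inner ℂ x (S z)‖ ≤ ε * M ^ 2 := fun S x z ε hS hx hz => by
    calc _ ≤ ‖x‖ * (‖S‖ * ‖z‖) := (norm_inner_le_norm _ _).trans (by gcongr; exact S.le_opNorm z)
      _ ≤ M * (ε * M) := by gcongr; exact (norm_nonneg S).trans hS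
      _ = _ := by ring
  refine gronwall_of_local (y := y) (c := fun s => 6 * √(D s)) ht.1 (fun s hs => ?_)
    ((F.intervalIntegrable t ht).const_mul 6) (fun s hs => by positivity) fun ε hε => ?_
  · have h1 := excitation_eq_sub_re (F.orthonormal (hsub hs)) (ξ s)
    have h2 : 0 ≤ excitation (φ s) (ξ s) := sq_nonneg _
    have h3 : 0 ≤ 1 / ((n : ℝ) + 1) * ‖ξ s‖ ^ 2 := by positivity
    simp only [y]
    linarith
  -- the local estimate
  let Q := 2 * M ^ 2 + 2 * M + (M + 1) ^ 2
  have hQ : 0 < Q := by positivity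
  obtain ⟨ε', hε'0, hε'1, hε'Q, hε'M⟩ : ∃ ε' > 0, ε' ≤ 1 ∧ ε' * Q ≤ ε ∧ ε' * M ^ 2 ≤ ε := by
    have hpos : 0 < ε / Q := by positivity
    have h1 : min 1 (ε / Q) * Q ≤ ε := by
      calc _ ≤ ε / Q * Q := by gcongr; exact min_le_right _ _
        _ = ε := by field_simp
    refine ⟨min 1 (ε / Q), lt_min one_pos hpos, min_le_left _ _, h1, le_trans ?_ h1⟩
    have : M ^ 2 ≤ Q := by simp only [Q]; nlinarith [sq_nonneg M, sq_nonneg (M + 1)]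
    gcongr
  obtain ⟨δ₁, hδ₁, h1⟩ := IsSolution.exists_norm_resolvent_sub_le hH hl hψ ht hε'0
  obtain ⟨δ₂, hδ₂, h2⟩ := Metric.uniformContinuousOn_iff_le.1
    (isCompact_Icc.uniformContinuousOn_of_continuous (F.continuousOn_projAt.mono hsub)) ε' hε'0
  refine ⟨min ε' (min δ₁ δ₂), by positivity, fun a b ha hab hb hlt => ?_⟩
  have hba : b - a < ε' := hlt.trans_le (min_le_left _ _)
  have hbδ₁ : b - a < δ₁ := hlt.trans_le ((min_le_right _ _).trans (min_le_left _ _))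
  have hbδ₂ : b - a < δ₂ := hlt.trans_le ((min_le_right _ _).trans (min_le_right _ _))
  have hat : a ∈ Icc 0 t := ⟨ha, hab.trans hb⟩
  have hbt : b ∈ Icc 0 t := ⟨ha.trans hab, hb⟩
  have hPn : ∀ r ∈ Icc a b, ∀ s ∈ Icc a b, ‖projAt (n := n) (φ r) 0 - projAt (φ s) 0‖ ≤ ε' :=
    fun r hr s hs => by
      rw [← dist_eq_norm]
      refine h2 r ⟨ha.trans hr.1, hr.2.trans hb⟩ s ⟨ha.trans hs.1, hs.2.trans hb⟩ ?_
      rw [Real.dist_eq, abs_le]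
      constructor <;> linarith [hr.1, hr.2, hs.1, hs.2]
  set ζ := H ⟨ξ a, resolvent_mem hH hl (ψ a)⟩ with hζ
  have hPi : ∀ x z : NParticle (n + 1), IntervalIntegrable (fun r => inner ℂ x (projAt (φ r) 0 z))
      volume a b := fun x z => by
    refine ContinuousOn.intervalIntegrable ?_
    rw [uIcc_of_le hab]
    exact (F.continuousOn_inner_projAt x z).mono (Icc_subset_timeInterval_of_nonneg ha (hsub hbt))
  have hR := F.exists_norm_inner_projAt_sub_le hH ha (hsub hbt) hab
    (isAntisymmetric_resolvent F.selfAdjoint F.even hH hl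
      (hψ.isAntisymmetric F.selfAdjoint F.even hH h0 (hsub hat))) (resolvent_mem hH hl (ψ a))
  have hZ : ‖(∫ r in a..b, (inner ℂ ζ (projAt (φ r) 0 (ξ a)) - inner ℂ (ξ a) (projAt (φ r) 0 ζ))) -
      ((b - a : ℝ) : ℂ) * (inner ℂ ζ (projAt (φ b) 0 (ξ a)) -
        inner ℂ (ξ a) (projAt (φ b) 0 ζ))‖ ≤ 2 * ε' * M ^ 2 * (b - a) := by
    have e : ((b - a : ℝ) : ℂ) * (inner ℂ ζ (projAt (φ b) 0 (ξ a)) -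
        inner ℂ (ξ a) (projAt (φ b) 0 ζ)) = ∫ _r in a..b, (inner ℂ ζ (projAt (φ b) 0 (ξ a)) -
        inner ℂ (ξ a) (projAt (φ b) 0 ζ)) := by
      rw [intervalIntegral.integral_const, Complex.real_smul]
    rw [e, ← intervalIntegral.integral_sub ((hPi _ _).sub (hPi _ _)) intervalIntegrable_const]
    refine (intervalIntegral.norm_integral_le_of_norm_le_const (C := 2 * ε' * M ^ 2)
      fun r hr => ?_).trans (by rw [abs_of_nonneg (sub_nonneg.2 hab)])
    rw [uIoc_of_le hab] at hr
    let S : NParticle (n + 1) →L[ℂ] NParticle (n + 1) := projAt (φ r) 0 - projAt (φ b) 0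
    have hS : ‖S‖ ≤ ε' := hPn r (Ioc_subset_Icc_self hr) b (right_mem_Icc.2 hab)
    have e2 : inner ℂ ζ (projAt (φ r) 0 (ξ a)) - inner ℂ (ξ a) (projAt (φ r) 0 ζ) -
        (inner ℂ ζ (projAt (φ b) 0 (ξ a)) - inner ℂ (ξ a) (projAt (φ b) 0 ζ)) =
        inner ℂ ζ (S (ξ a)) - inner ℂ (ξ a) (S ζ) := by
      simp only [S, sub_apply, inner_sub_right]
      ring
    rw [e2]
    refine (norm_sub_le _ _).trans ((add_le_add (hinner _ _ _ _ hS (hM2 a hat) (hM1 a hat))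
      (hinner _ _ _ _ hS (hM1 a hat) (hM2 a hat))).trans (le_of_eq ?_))
    ring
  have hstep := norm_inner_sub_inner_le (P := projAt (φ a) 0) (ξ' := ξ b)
    (F.norm_projAt_le_one (hsub hbt)) (hM1 a hat) (hM2 a hat) (sub_nonneg.2 hab) hba.le hε'1
    (h1 a b ha hab hb hbδ₁) hZ hR
  -- Within a short step p_r is replaced by p_a at cost ε, by uniform continuity in operator norm.
  -- What comes out is the bound in terms of `y a` that `gronwall_of_local` requires.
  have hint : ∫ r in a..b, 6 * √(D r) * ((1 + 1 / (n + 1)) * ‖ξ a‖ ^ 2 -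
      (inner ℂ (ξ a) (projAt (φ r) 0 (ξ a))).re) ≤ (y a + ε) * ∫ r in a..b, 6 * √(D r) := by
    have hD := F.intervalIntegrable_sqrt ha (hsub hbt) hab
    rw [mul_comm (y a + ε), ← intervalIntegral.integral_mul_const]
    refine intervalIntegral.integral_mono_on hab ?_ ((hD.const_mul 6).mul_const _) fun r hr => ?_
    · refine (hD.const_mul 6).mul_continuousOn ?_
      rw [uIcc_of_le hab]
      exact continuousOn_const.sub (Complex.continuous_re.comp_continuousOn
        ((F.continuousOn_inner_projAt _ _).mono
          (Icc_subset_timeInterval_of_nonneg ha (hsub hbt))))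
    · refine mul_le_mul_of_nonneg_left ?_ (by positivity)
      have h3 := hinner _ _ _ _ (hPn a (left_mem_Icc.2 hab) r hr) (hM1 a hat) (hM1 a hat)
      have h4 := (Complex.re_le_norm _).trans h3
      rw [sub_apply, inner_sub_right, Complex.sub_re] at h4
      simp only [y]
      linarith
  have hfin : y b - y a ≤ ‖inner ℂ (ξ b) (projAt (φ b) 0 (ξ b)) -
      inner ℂ (ξ a) (projAt (φ a) 0 (ξ a))‖ := by
    have h5 := (neg_abs_le _).trans' (neg_le_neg (Complex.abs_re_le_norm
      (inner ℂ (ξ b) (projAt (φ b) 0 (ξ b)) - inner ℂ (ξ a) (projAt (φ a) 0 (ξ a)))))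
    rw [Complex.sub_re] at h5
    simp only [y]
    rw [hξn b hbt, hξn a hat]
    linarith
  have h6 : ε' * Q * (b - a) ≤ ε * (b - a) :=
    mul_le_mul_of_nonneg_right hε'Q (sub_nonneg.2 hab)
  have h7 := hstep.trans (add_le_add_left hint _)
  simp only [Q] at h6
  linarith

/-- The Gronwall estimate for the number of excitations. -/
theorem excitation_add_le (hn : ‖ψ 0‖ = 1) : excitation (φ t) (ψ t) + 1 / (n + 1) ≤
    Real.exp (∫ s in (0 : ℝ)..t, 6 * √(D s)) * (excitation (φ 0) (ψ 0) + 1 / (n + 1)) := by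
  have ht0 : (0 : ℝ) ∈ timeInterval T := mem_timeInterval_of_le ht le_rfl ht.1
  have hcont : ∀ s, Continuous fun z : NParticle (n + 1) =>
      (1 + 1 / ((n : ℝ) + 1)) * ‖z‖ ^ 2 - (inner ℂ z (projAt (φ s) 0 z)).re := fun s => by fun_prop
  have hlim := le_of_tendsto_of_tendsto
    (((hcont t).tendsto _).comp (tendsto_resolvent hH (ψ t)))
    ((((hcont 0).tendsto _).comp (tendsto_resolvent hH (ψ 0))).const_mul
      (Real.exp (∫ s in (0 : ℝ)..t, 6 * √(D s))))
    (eventually_mem_nhdsWithin.mono fun l hl => F.resolvent_gronwall hH hψ h0 ht hl)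
  rw [excitation_eq_sub_re (F.orthonormal ht), excitation_eq_sub_re F.orthonormal_zero]
  have hnt : ‖ψ t‖ = 1 := (IsSolution.norm_eq hH hψ ht).trans hn
  rw [hnt, hn] at hlim ⊢
  have e : ∀ r : ℝ, 1 ^ 2 - r + 1 / ((n : ℝ) + 1) = (1 + 1 / ((n : ℝ) + 1)) * 1 ^ 2 - r :=
    fun r => by ring
  rw [e, e]
  exact hlim

theorem excitation_le (hn : ‖ψ 0‖ = 1) : excitation (φ t) (ψ t) ≤
    Real.exp (∫ s in (0 : ℝ)..t, 24 * √(D s)) * excitation (φ 0) (ψ 0) +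
      (Real.exp (∫ s in (0 : ℝ)..t, 24 * √(D s)) - 1) * ((n : ℝ) + 1)⁻¹ := by
  have h := F.excitation_add_le hH hψ h0 ht hn
  have hD := F.intervalIntegrable t ht
  -- The argument yields the rate 6 √D, twice the 3 κ of the bound on the imaginary part; it is only
  -- weakened to 24 √D here.
  have h1 : Real.exp (∫ s in (0 : ℝ)..t, 6 * √(D s)) ≤ Real.exp (∫ s in (0 : ℝ)..t, 24 * √(D s)) :=
    Real.exp_le_exp.2 (intervalIntegral.integral_mono_on ht.1 (hD.const_mul 6) (hD.const_mul 24)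
      fun s _ => by linarith [Real.sqrt_nonneg (D s)])
  have h2 : 0 ≤ excitation (φ 0) (ψ 0) + 1 / ((n : ℝ) + 1) := by
    have : 0 ≤ excitation (φ 0) (ψ 0) := sq_nonneg _
    positivity
  have h3 := h.trans (mul_le_mul_of_nonneg_right h1 h2)
  rw [one_div] at h3
  linarith

end HartreeFlow

/-- A bound on a lower Lebesgue integral as a bound on a Bochner integral. -/
theorem integrable_and_integral_le_of_lintegral_le {α : Type*} [MeasurableSpace α] {μ : Measure α}
    {f : α → ℝ} (hf : AEStronglyMeasurable f μ) (h0 : ∀ x, 0 ≤ f x) {K : ℝ} (hK : 0 ≤ K)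
    (h : ∫⁻ x, ENNReal.ofReal (f x) ∂μ ≤ ENNReal.ofReal K) : Integrable f μ ∧ ∫ x, f x ∂μ ≤ K := by
  have hi : Integrable f μ := by
    refine ⟨hf, ?_⟩
    rw [hasFiniteIntegral_iff_ofReal (Eventually.of_forall h0)]
    exact h.trans_lt ENNReal.ofReal_lt_top
  refine ⟨hi, ?_⟩
  rw [← ENNReal.ofReal_le_ofReal_iff hK,
    ofReal_integral_eq_lintegral_ofReal hi (Eventually.of_forall h0)]
  exact h

end

end FermionMF

end

theorem mainTheorem2 (N : ℕ) (hN : 1 ≤ N) (T : EReal) (hT : 0 < T)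
    (H0 : FermionMF.OneParticle →ₗ.[ℂ] FermionMF.OneParticle) (hH0 : IsSelfAdjoint H0)
    (v : FermionMF.Space → ℝ) (hv_meas : Measurable v) (hv_even : ∀ x, v (-x) = v x)
    (hH : IsSelfAdjoint (FermionMF.hamiltonian N H0 v))
    (ψ : ℝ → FermionMF.NParticle N)
    (hψ : FermionMF.IsSchroedingerSolution H0 v T ψ)
    (hψ_anti : FermionMF.IsAntisymmetric (ψ 0)) (hψ_norm : ‖ψ 0‖ = 1)
    (φ : ℝ → Fin N → FermionMF.OneParticle)
    (hφ : FermionMF.IsHartreeSolution H0 v T φ)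
    (hφ_orth : Orthonormal ℂ (φ 0))
    (D : ℝ → ℝ) (hD_nonneg : ∀ t ∈ FermionMF.timeInterval T, 0 ≤ D t)
    (hD_int : ∀ t ∈ FermionMF.timeInterval T,
      IntervalIntegrable (fun s => √(D s)) volume 0 t)
    (hD : ∀ t ∈ FermionMF.timeInterval T, ∀ y : FermionMF.Space,
      ∫⁻ x, ENNReal.ofReal (v (y - x) ^ 2 * FermionMF.density (φ t) x) ≤
        ENNReal.ofReal (D t * (N : ℝ)⁻¹)) :
    ∀ t ∈ FermionMF.timeInterval T,
      (∀ m : Fin N, (FermionMF.alphaN (ψ t) (φ t) : ℂ) =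
        FermionMF.scp (fun x => ψ t x) (FermionMF.qProj (φ t) m fun x => ψ t x)) ∧
      FermionMF.alphaN (ψ t) (φ t) ≤
        Real.exp (∫ s in (0 : ℝ)..t, 24 * √(D s)) * FermionMF.alphaN (ψ 0) (φ 0) +
          (Real.exp (∫ s in (0 : ℝ)..t, 24 * √(D s)) - 1) * (N : ℝ)⁻¹ := by
  -- With N = n + 1 a particle can be split off by `Fin.insertNth` and `Fin.removeNth`.
  obtain ⟨n, rfl⟩ := Nat.exists_eq_add_of_le' hN
  choose g hg hsol using hφ.2
  -- The lower Lebesgue integral makes the hypothesis include finiteness, so that integrability for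
  -- every z follows along with the bound on the Bochner integral.
  have hb : ∀ t ∈ FermionMF.timeInterval T, ∀ z : FermionMF.Space,
      Integrable (fun y => v (z - y) ^ 2 * ∑ j, ‖φ t j y‖ ^ 2) ∧
        ∫ y, v (z - y) ^ 2 * ∑ j, ‖φ t j y‖ ^ 2 ≤ D t * ((n + 1 : ℕ) : ℝ)⁻¹ := fun t ht z =>
    FermionMF.integrable_and_integral_le_of_lintegral_le
      (((hv_meas.comp (measurable_const.sub measurable_id)).pow_const 2).mul
        (FermionMF.measurable_sum_norm_sq (φ t))).aestronglyMeasurable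
      (fun y => mul_nonneg (sq_nonneg _) (Finset.sum_nonneg fun _ _ => sq_nonneg _)) (mul_nonneg (hD_nonneg t ht) (by positivity)) (hD t ht z)
  have F : FermionMF.HartreeFlow H0 v T φ g D :=
    { selfAdjoint := hH0
      measurable := hv_meas
      even := hv_even
      solution := hsol
      source := hg
      orthonormal_zero := hφ_orth
      nonneg := hD_nonneg
      intervalIntegrable := hD_int
      integrable := fun t ht z => (hb t ht z).1
      integral_le := fun t ht z => by simpa [div_eq_mul_inv] using (hb t ht z).2 }
  intro t ht
  have hψt := hψ.isAntisymmetric hH0 hv_even hH hψ_anti ht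
  have hφt := F.orthonormal ht
  rw [FermionMF.alphaN_eq_excitation hφt hψt, FermionMF.alphaN_eq_excitation hφ_orth hψ_anti]
  refine ⟨fun m => (FermionMF.scp_qProj hφt hψt m).symm, ?_⟩
  simpa using F.excitation_le hH hψ hψ_anti ht hψ_norm
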